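/- All tensor products without subscript are over $\mathbb C$, and Sweedler notation is used. Let $(\mathcal A,\Delta,\epsilon)$ be a Hopf algebra over $\mathbb C$. A *bicovariant $\mathcal A$-bimodule* is an $\mathcal A$-bimodule $\mathcal E$ with a left coaction $m\mapsto m_{(-1)}\otimes m_{(0)}\in\mathcal A\otimes\mathcal E$ and a right coaction $m\mapsto m_{(0)}\otimes m_{(1)}\in\mathcal E\otimes\mathcal A$ of $\mathcal A$ which commute with each other and which satisfy $(am)_{(-1)}\otimes (am)_{(0)}=a_{(1)}m_{(-1)}\otimes a_{(2)}m_{(0)}$, $(ma)_{(-1)}\otimes (ma)_{(0)}=m_{(-1)}a_{(1)}\otimes m_{(0)}a_{(2)}$, $(am)_{(0)}\otimes (am)_{(1)}=a_{(1)}m_{(0)}\otimes a_{(2)}m_{(1)}$ and $(ma)_{(0)}\otimes (ma)_{(1)}=m_{(0)}a_{(1)}\otimes m_{(1)}a_{(2)}$. An element $\omega\in\mathcal E$ is left-invariant if its left coaction is $1\otimes\omega$, and $\eta\in\mathcal E$ is right-invariant if its right coaction is $\eta\otimes 1$. The *Woronowicz braiding* of $\mathcal E$ is the $\mathcal A$-bimodule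 map $\sigma:\mathcal E\otimes_{\mathcal A}\mathcal E\to\mathcal E\otimes_{\mathcal A}\mathcal E$ with $\sigma(\omega\otimes_{\mathcal A}\eta)=\eta\otimes_{\mathcal A}\omega$ for all left-invariant $\omega$ and right-invariant $\eta$. A *cocycle* on $\mathcal A$ is a convolution invertible linear map $\gamma:\mathcal A\otimes\mathcal A\to\mathbb C$, with convolution inverse $\overline\gamma$, such that $\gamma(a\otimes 1)=\epsilon(a)=\gamma(1\otimes a)$ and $$\gamma(a_{(1)}\otimes b_{(1)})\,\gamma(a_{(2)}b_{(2)}\otimes c)=\gamma(b_{(1)}\otimes c_{(1)})\,\gamma(a\otimes b_{(2)}c_{(2)})\qquad(a,b,c\in\mathcal A).$$ It gives the deformed Hopf algebra $\mathcal A_\gamma$, which is $\mathcal A$ as a coalgebra, with the product $a*_\gamma b=\gamma(a_{(1)}\otimes b_{(1)})\,a_{(2)}b_{(2)}\,\overline\gamma(a_{(3)}\otimes b_{(3)})$. The *cocycle deformation* of a bicovariant $\mathcal A$-bimodule $\mathcal E$ is the bicovariant $\mathcal A_\gamma$-bimodule $\mathcal E_\gamma$ which is $\mathcal E$ as a vector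 space with the same two coactions, and with the actions $$a*_\gamma m=\gamma(a_{(1)}\otimes m_{(-1)})\,a_{(2)}m_{(0)}\,\overline\gamma(a_{(3)}\otimes m_{(1)}),\qquad m*_\gamma a=\gamma(m_{(-1)}\otimes a_{(1)})\,m_{(0)}a_{(2)}\,\overline\gamma(m_{(1)}\otimes a_{(3)}).$$ (1) For every Hopf algebra $\mathcal A$ over $\mathbb C$, every bicovariant $\mathcal A$-bimodule $\mathcal E$ and every cocycle $\gamma$ on $\mathcal A$, the Woronowicz braidings $\sigma$ of $\mathcal E$ and $\sigma_\gamma:\mathcal E_\gamma\otimes_{\mathcal A_\gamma}\mathcal E_\gamma\to\mathcal E_\gamma\otimes_{\mathcal A_\gamma}\mathcal E_\gamma$ of $\mathcal E_\gamma$ exist and are unique, and if $\sigma^2=1$, then $\sigma_\gamma^2=1$. (2) Let $G$ be a compact semisimple Lie group, let $\mathcal A$ be the commutative Hopf algebra of regular functions on $G$ (the span of the matrix coefficients of the finite-dimensional continuous complex representations of $G$), and let $\mathcal E=\Omega^1_{\mathcal A/\mathbb C}$ be its space of (Kähler) one-forms, with equal left and right actions and with the coactions $a\,db\mapsto a_{(1)}b_{(1)}\otimes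 a_{(2)}\,db_{(2)}$ and $a\,db\mapsto a_{(1)}\,db_{(1)}\otimes a_{(2)}b_{(2)}$. Then for every cocycle $\gamma$ on $\mathcal A$ the Woronowicz braiding $\sigma_\gamma$ of $\mathcal E_\gamma$ exists, is unique, and satisfies $\sigma_\gamma^2=1$. -/

import Mathlib

open scoped TensorProduct

noncomputable section

set_option linter.unusedSectionVars false
set_option linter.unusedSimpArgs false
set_option linter.unusedVariables false

/-- A bicomodule `N` over a coalgebra `C`: a left coaction `n ↦ n₍₋₁₎ ⊗ n₍₀₎` and a right coaction
`n ↦ n₍₀₎ ⊗ n₍₁₎`, both coassociative and counital, which commute with each other. -/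
@[ext]
structure Bicomodule (k C N : Type*) [Field k] [AddCommMonoid C] [Module k C] [Coalgebra k C]
    [AddCommMonoid N] [Module k N] where
  /-- The left coaction. -/
  lcoact : N →ₗ[k] C ⊗[k] N
  /-- The right coaction. -/
  rcoact : N →ₗ[k] N ⊗[k] C
  lcoassoc : ∀ n, TensorProduct.assoc k C C N (Coalgebra.comul.rTensor N (lcoact n)) =
    lcoact.lTensor C (lcoact n)
  lcounit : ∀ n, TensorProduct.lid k N (Coalgebra.counit.rTensor N (lcoact n)) = n
  rcoassoc : ∀ n, TensorProduct.assoc k N C C (rcoact.rTensor C (rcoact n)) =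
    Coalgebra.comul.lTensor N (rcoact n)
  rcounit : ∀ n, TensorProduct.rid k N (Coalgebra.counit.lTensor N (rcoact n)) = n
  comm : ∀ n, TensorProduct.assoc k C N C (lcoact.rTensor C (rcoact n)) =
    rcoact.lTensor C (lcoact n)

namespace Bicomodule

section Basic

variable {k C D N P : Type*} [Field k]
  [AddCommMonoid C] [Module k C] [Coalgebra k C] [AddCommMonoid D] [Module k D] [Coalgebra k D]
  [AddCommMonoid N] [Module k N] [AddCommMonoid P] [Module k P]

/-- A coalgebra, with its comultiplication as left and as right coaction. -/
def self (k C : Type*) [Field k] [AddCommMonoid C] [Module k C] [Coalgebra k C] :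
    Bicomodule k C C where
  lcoact := Coalgebra.comul
  rcoact := Coalgebra.comul
  lcoassoc := Coalgebra.coassoc_apply
  lcounit n := by simp
  rcoassoc := Coalgebra.coassoc_apply
  rcounit n := by simp
  comm := Coalgebra.coassoc_apply

/-- The tensor product over `k` of a bicomodule over `C` and a bicomodule over `D`, as a bicomodule
over `C ⊗ D`: `n ⊗ p ↦ (n₍₋₁₎ ⊗ p₍₋₁₎) ⊗ (n₍₀₎ ⊗ p₍₀₎)`, and similarly on the right. -/
def tensor (M : Bicomodule k C N) (Q : Bicomodule k D P) : Bicomodule k (C ⊗[k] D) (N ⊗[k] P) where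
  lcoact := (TensorProduct.tensorTensorTensorComm k C N D P).toLinearMap ∘ₗ
    TensorProduct.map M.lcoact Q.lcoact
  rcoact := (TensorProduct.tensorTensorTensorComm k N C P D).toLinearMap ∘ₗ
    TensorProduct.map M.rcoact Q.rcoact
  lcoassoc n := by
    induction n with
    | zero => simp only [LinearMap.map_zero, LinearEquiv.map_zero]
    | add _ _ h₁ h₂ => simp only [LinearMap.map_add, LinearEquiv.map_add, h₁, h₂]
    | tmul x y =>
      let F : (C ⊗[k] (C ⊗[k] N)) ⊗[k] (D ⊗[k] (D ⊗[k] P)) ≃ₗ[k]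
          (C ⊗[k] D) ⊗[k] ((C ⊗[k] D) ⊗[k] (N ⊗[k] P)) :=
        TensorProduct.tensorTensorTensorComm _ _ _ _ _ ≪≫ₗ
          TensorProduct.congr (.refl _ _) (TensorProduct.tensorTensorTensorComm _ _ _ _ _)
      convert! congr(F ($(M.lcoassoc x) ⊗ₜ[k] $(Q.lcoassoc y))) using 1
      · dsimp
        induction M.lcoact x with
        | zero => simp only [LinearMap.map_zero, LinearEquiv.map_zero, TensorProduct.zero_tmul]
        | add _ _ h₁ h₂ => simp only [LinearMap.map_add, LinearEquiv.map_add, TensorProduct.add_tmul, h₁, h₂]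
        | tmul x₁ x₂ =>
        induction Q.lcoact y with
        | zero => simp only [LinearMap.map_zero, LinearEquiv.map_zero, TensorProduct.tmul_zero]
        | add _ _ h₁ h₂ => simp only [LinearMap.map_add, LinearEquiv.map_add, TensorProduct.tmul_add, h₁, h₂]
        | tmul y₁ y₂ =>
        dsimp
        induction Coalgebra.comul (R := k) x₁ with
        | zero => simp only [LinearMap.map_zero, LinearEquiv.map_zero, TensorProduct.zero_tmul]
        | add _ _ h₁ h₂ => simp only [LinearMap.map_add, LinearEquiv.map_add, TensorProduct.add_tmul, h₁, h₂]
        | tmul x₁ x₁' =>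
        induction Coalgebra.comul (R := k) y₁ with
        | zero => simp only [LinearMap.map_zero, LinearEquiv.map_zero, TensorProduct.tmul_zero, TensorProduct.zero_tmul]
        | add _ _ h₁ h₂ =>
          simp only [LinearMap.map_add, LinearEquiv.map_add, TensorProduct.tmul_add, TensorProduct.add_tmul, h₁, h₂]
        | tmul y₁ y₁' => rfl
      · dsimp
        induction M.lcoact x with
        | zero => simp only [LinearMap.map_zero, LinearEquiv.map_zero, TensorProduct.zero_tmul]
        | add _ _ h₁ h₂ => simp only [LinearMap.map_add, LinearEquiv.map_add, TensorProduct.add_tmul, h₁, h₂]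
        | tmul x₁ x₂ =>
        induction Q.lcoact y with
        | zero => simp only [LinearMap.map_zero, LinearEquiv.map_zero, TensorProduct.tmul_zero]
        | add _ _ h₁ h₂ => simp only [LinearMap.map_add, LinearEquiv.map_add, TensorProduct.tmul_add, h₁, h₂]
        | tmul y₁ y₂ => rfl
  lcounit n := by
    induction n with
    | zero => simp only [LinearMap.map_zero, LinearEquiv.map_zero]
    | add _ _ h₁ h₂ => simp only [LinearMap.map_add, LinearEquiv.map_add, h₁, h₂]
    | tmul x y =>
      convert! congr($(M.lcounit x) ⊗ₜ[k] $(Q.lcounit y)) using 1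
      dsimp
      induction M.lcoact x with
      | zero => simp only [LinearMap.map_zero, LinearEquiv.map_zero, TensorProduct.zero_tmul]
      | add _ _ h₁ h₂ => simp only [LinearMap.map_add, LinearEquiv.map_add, TensorProduct.add_tmul, h₁, h₂]
      | tmul x₁ x₂ =>
      induction Q.lcoact y with
      | zero => simp only [LinearMap.map_zero, LinearEquiv.map_zero, TensorProduct.tmul_zero]
      | add _ _ h₁ h₂ => simp only [LinearMap.map_add, LinearEquiv.map_add, TensorProduct.tmul_add, h₁, h₂]
      | tmul y₁ y₂ =>
        simp [TensorProduct.smul_tmul', TensorProduct.tmul_smul, smul_smul, mul_comm]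
  rcoassoc n := by
    induction n with
    | zero => simp only [LinearMap.map_zero, LinearEquiv.map_zero]
    | add _ _ h₁ h₂ => simp only [LinearMap.map_add, LinearEquiv.map_add, h₁, h₂]
    | tmul x y =>
      let F : (N ⊗[k] (C ⊗[k] C)) ⊗[k] (P ⊗[k] (D ⊗[k] D)) ≃ₗ[k]
          (N ⊗[k] P) ⊗[k] ((C ⊗[k] D) ⊗[k] (C ⊗[k] D)) :=
        TensorProduct.tensorTensorTensorComm _ _ _ _ _ ≪≫ₗ
          TensorProduct.congr (.refl _ _) (TensorProduct.tensorTensorTensorComm _ _ _ _ _)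
      convert! congr(F ($(M.rcoassoc x) ⊗ₜ[k] $(Q.rcoassoc y))) using 1
      · dsimp
        induction M.rcoact x with
        | zero => simp only [LinearMap.map_zero, LinearEquiv.map_zero, TensorProduct.zero_tmul]
        | add _ _ h₁ h₂ => simp only [LinearMap.map_add, LinearEquiv.map_add, TensorProduct.add_tmul, h₁, h₂]
        | tmul x₁ x₂ =>
        induction Q.rcoact y with
        | zero => simp only [LinearMap.map_zero, LinearEquiv.map_zero, TensorProduct.tmul_zero]
        | add _ _ h₁ h₂ => simp only [LinearMap.map_add, LinearEquiv.map_add, TensorProduct.tmul_add, h₁, h₂]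
        | tmul y₁ y₂ =>
        dsimp
        induction M.rcoact x₁ with
        | zero => simp only [LinearMap.map_zero, LinearEquiv.map_zero, TensorProduct.zero_tmul]
        | add _ _ h₁ h₂ => simp only [LinearMap.map_add, LinearEquiv.map_add, TensorProduct.add_tmul, h₁, h₂]
        | tmul x₁ x₁' =>
        induction Q.rcoact y₁ with
        | zero => simp only [LinearMap.map_zero, LinearEquiv.map_zero, TensorProduct.tmul_zero, TensorProduct.zero_tmul]
        | add _ _ h₁ h₂ =>
          simp only [LinearMap.map_add, LinearEquiv.map_add, TensorProduct.tmul_add, TensorProduct.add_tmul, h₁, h₂]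
        | tmul y₁ y₁' => rfl
      · dsimp
        induction M.rcoact x with
        | zero => simp only [LinearMap.map_zero, LinearEquiv.map_zero, TensorProduct.zero_tmul]
        | add _ _ h₁ h₂ => simp only [LinearMap.map_add, LinearEquiv.map_add, TensorProduct.add_tmul, h₁, h₂]
        | tmul x₁ x₂ =>
        induction Q.rcoact y with
        | zero => simp only [LinearMap.map_zero, LinearEquiv.map_zero, TensorProduct.tmul_zero]
        | add _ _ h₁ h₂ => simp only [LinearMap.map_add, LinearEquiv.map_add, TensorProduct.tmul_add, h₁, h₂]
        | tmul y₁ y₂ => rfl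
  rcounit n := by
    induction n with
    | zero => simp only [LinearMap.map_zero, LinearEquiv.map_zero]
    | add _ _ h₁ h₂ => simp only [LinearMap.map_add, LinearEquiv.map_add, h₁, h₂]
    | tmul x y =>
      convert! congr($(M.rcounit x) ⊗ₜ[k] $(Q.rcounit y)) using 1
      dsimp
      induction M.rcoact x with
      | zero => simp only [LinearMap.map_zero, LinearEquiv.map_zero, TensorProduct.zero_tmul]
      | add _ _ h₁ h₂ => simp only [LinearMap.map_add, LinearEquiv.map_add, TensorProduct.add_tmul, h₁, h₂]
      | tmul x₁ x₂ =>
      induction Q.rcoact y with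
      | zero => simp only [LinearMap.map_zero, LinearEquiv.map_zero, TensorProduct.tmul_zero]
      | add _ _ h₁ h₂ => simp only [LinearMap.map_add, LinearEquiv.map_add, TensorProduct.tmul_add, h₁, h₂]
      | tmul y₁ y₂ =>
        simp [TensorProduct.smul_tmul', TensorProduct.tmul_smul, smul_smul, mul_comm]
  comm n := by
    induction n with
    | zero => simp only [LinearMap.map_zero, LinearEquiv.map_zero]
    | add _ _ h₁ h₂ => simp only [LinearMap.map_add, LinearEquiv.map_add, h₁, h₂]
    | tmul x y =>
      let F : (C ⊗[k] (N ⊗[k] C)) ⊗[k] (D ⊗[k] (P ⊗[k] D)) ≃ₗ[k]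
          (C ⊗[k] D) ⊗[k] ((N ⊗[k] P) ⊗[k] (C ⊗[k] D)) :=
        TensorProduct.tensorTensorTensorComm _ _ _ _ _ ≪≫ₗ
          TensorProduct.congr (.refl _ _) (TensorProduct.tensorTensorTensorComm _ _ _ _ _)
      convert! congr(F ($(M.comm x) ⊗ₜ[k] $(Q.comm y))) using 1
      · dsimp
        induction M.rcoact x with
        | zero => simp only [LinearMap.map_zero, LinearEquiv.map_zero, TensorProduct.zero_tmul]
        | add _ _ h₁ h₂ => simp only [LinearMap.map_add, LinearEquiv.map_add, TensorProduct.add_tmul, h₁, h₂]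
        | tmul x₁ x₂ =>
        induction Q.rcoact y with
        | zero => simp only [LinearMap.map_zero, LinearEquiv.map_zero, TensorProduct.tmul_zero]
        | add _ _ h₁ h₂ => simp only [LinearMap.map_add, LinearEquiv.map_add, TensorProduct.tmul_add, h₁, h₂]
        | tmul y₁ y₂ =>
        dsimp
        induction M.lcoact x₁ with
        | zero => simp only [LinearMap.map_zero, LinearEquiv.map_zero, TensorProduct.zero_tmul]
        | add _ _ h₁ h₂ => simp only [LinearMap.map_add, LinearEquiv.map_add, TensorProduct.add_tmul, h₁, h₂]
        | tmul x₁ x₁' =>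
        induction Q.lcoact y₁ with
        | zero => simp only [LinearMap.map_zero, LinearEquiv.map_zero, TensorProduct.tmul_zero, TensorProduct.zero_tmul]
        | add _ _ h₁ h₂ =>
          simp only [LinearMap.map_add, LinearEquiv.map_add, TensorProduct.tmul_add, TensorProduct.add_tmul, h₁, h₂]
        | tmul y₁ y₁' => rfl
      · dsimp
        induction M.lcoact x with
        | zero => simp only [LinearMap.map_zero, LinearEquiv.map_zero, TensorProduct.zero_tmul]
        | add _ _ h₁ h₂ => simp only [LinearMap.map_add, LinearEquiv.map_add, TensorProduct.add_tmul, h₁, h₂]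
        | tmul x₁ x₂ =>
        induction Q.lcoact y with
        | zero => simp only [LinearMap.map_zero, LinearEquiv.map_zero, TensorProduct.tmul_zero]
        | add _ _ h₁ h₂ => simp only [LinearMap.map_add, LinearEquiv.map_add, TensorProduct.tmul_add, h₁, h₂]
        | tmul y₁ y₂ => rfl

lemma tensor_self :
    (self k C).tensor (self k D) = self k (C ⊗[k] D) := rfl

end Basic


section Twist

variable {k C D F N P Q : Type*} [Field k]
  [AddCommMonoid C] [Module k C] [Coalgebra k C] [AddCommMonoid D] [Module k D] [Coalgebra k D]
  [AddCommMonoid F] [Module k F] [Coalgebra k F]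
  [AddCommMonoid N] [Module k N] [AddCommMonoid P] [Module k P] [AddCommMonoid Q] [Module k Q]

/-- The operator `n ↦ φ(n₍₋₁₎) n₍₀₎`. -/
def hitL (M : Bicomodule k C N) (φ : WithConv (C →ₗ[k] k)) : N →ₗ[k] N :=
  (TensorProduct.lid k N).toLinearMap ∘ₗ φ.ofConv.rTensor N ∘ₗ M.lcoact

/-- The operator `n ↦ n₍₀₎ φ(n₍₁₎)`. -/
def hitR (M : Bicomodule k C N) (φ : WithConv (C →ₗ[k] k)) : N →ₗ[k] N :=
  (TensorProduct.rid k N).toLinearMap ∘ₗ φ.ofConv.lTensor N ∘ₗ M.rcoact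

/-- The map `n ↦ φ(n₍₋₁₎) f(n₍₀₎) ψ(n₍₁₎)`. -/
def sandwich (M : Bicomodule k C N) (φ : WithConv (C →ₗ[k] k)) (f : N →ₗ[k] P)
    (ψ : WithConv (C →ₗ[k] k)) : N →ₗ[k] P :=
  f ∘ₗ M.hitL φ ∘ₗ M.hitR ψ

lemma hitL_comp_hitR (M : Bicomodule k C N) (φ ψ : WithConv (C →ₗ[k] k)) :
    M.hitL φ ∘ₗ M.hitR ψ = M.hitR ψ ∘ₗ M.hitL φ := by
  ext n
  let G : C ⊗[k] (N ⊗[k] C) →ₗ[k] N := (TensorProduct.lid k N).toLinearMap ∘ₗ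
    TensorProduct.map φ.ofConv ((TensorProduct.rid k N).toLinearMap ∘ₗ ψ.ofConv.lTensor N)
  convert! congr(G $(M.comm n)) using 1
  · simp only [hitL, hitR, LinearMap.comp_apply, LinearEquiv.coe_coe]
    induction M.rcoact n with
    | zero => simp only [LinearMap.map_zero, LinearEquiv.map_zero]
    | add _ _ h₁ h₂ => simp only [LinearMap.map_add, LinearEquiv.map_add, h₁, h₂]
    | tmul a b =>
      simp only [LinearMap.lTensor_tmul, LinearMap.rTensor_tmul, TensorProduct.rid_tmul, map_smul]
      induction M.lcoact a with
      | zero => simp [TensorProduct.zero_tmul]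
      | add _ _ h₁ h₂ => simp only [LinearMap.map_add, LinearEquiv.map_add, TensorProduct.add_tmul, smul_add, h₁, h₂]
      | tmul c d => simp [G, smul_smul, mul_comm]
  · simp only [hitL, hitR, LinearMap.comp_apply, LinearEquiv.coe_coe]
    induction M.lcoact n with
    | zero => simp only [LinearMap.map_zero, LinearEquiv.map_zero]
    | add _ _ h₁ h₂ => simp only [LinearMap.map_add, LinearEquiv.map_add, h₁, h₂]
    | tmul a b => simp [G]

lemma hitL_comp_hitL (M : Bicomodule k C N) (φ ψ : WithConv (C →ₗ[k] k)) :
    M.hitL ψ ∘ₗ M.hitL φ = M.hitL (φ * ψ) := by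
  ext n
  let G : C ⊗[k] (C ⊗[k] N) →ₗ[k] N := (TensorProduct.lid k N).toLinearMap ∘ₗ
    TensorProduct.map φ.ofConv ((TensorProduct.lid k N).toLinearMap ∘ₗ ψ.ofConv.rTensor N)
  convert! congr(G $(M.lcoassoc n)).symm using 1
  · simp only [hitL, LinearMap.comp_apply, LinearEquiv.coe_coe]
    induction M.lcoact n with
    | zero => simp only [LinearMap.map_zero, LinearEquiv.map_zero]
    | add _ _ h₁ h₂ => simp only [LinearMap.map_add, LinearEquiv.map_add, h₁, h₂]
    | tmul a b => simp [G]
  · simp only [hitL, LinearMap.comp_apply, LinearEquiv.coe_coe]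
    induction M.lcoact n with
    | zero => simp only [LinearMap.map_zero, LinearEquiv.map_zero]
    | add _ _ h₁ h₂ => simp only [LinearMap.map_add, LinearEquiv.map_add, h₁, h₂]
    | tmul a b =>
      simp only [LinearMap.rTensor_tmul, TensorProduct.lid_tmul, LinearMap.convMul_apply]
      induction Coalgebra.comul (R := k) a with
      | zero => simp [TensorProduct.zero_tmul]
      | add _ _ h₁ h₂ => simp only [LinearMap.map_add, LinearEquiv.map_add, TensorProduct.add_tmul, add_smul, h₁, h₂]
      | tmul c d => simp [G, smul_smul, mul_comm]

lemma hitR_comp_hitR (M : Bicomodule k C N) (φ ψ : WithConv (C →ₗ[k] k)) :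
    M.hitR φ ∘ₗ M.hitR ψ = M.hitR (φ * ψ) := by
  ext n
  let G : N ⊗[k] (C ⊗[k] C) →ₗ[k] N := (TensorProduct.rid k N).toLinearMap ∘ₗ
    TensorProduct.map .id (LinearMap.mul' k k ∘ₗ TensorProduct.map φ.ofConv ψ.ofConv)
  convert! congr(G $(M.rcoassoc n)) using 1
  · simp only [hitR, LinearMap.comp_apply, LinearEquiv.coe_coe]
    induction M.rcoact n with
    | zero => simp only [LinearMap.map_zero, LinearEquiv.map_zero]
    | add _ _ h₁ h₂ => simp only [LinearMap.map_add, LinearEquiv.map_add, h₁, h₂]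
    | tmul a b =>
      simp only [LinearMap.lTensor_tmul, LinearMap.rTensor_tmul, TensorProduct.rid_tmul, map_smul]
      induction M.rcoact a with
      | zero => simp [TensorProduct.zero_tmul]
      | add _ _ h₁ h₂ => simp only [LinearMap.map_add, LinearEquiv.map_add, TensorProduct.add_tmul, smul_add, h₁, h₂]
      | tmul c d => simp [G, smul_smul, mul_comm]
  · simp only [hitR, LinearMap.comp_apply, LinearEquiv.coe_coe]
    induction M.rcoact n with
    | zero => simp only [LinearMap.map_zero, LinearEquiv.map_zero]
    | add _ _ h₁ h₂ => simp only [LinearMap.map_add, LinearEquiv.map_add, h₁, h₂]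
    | tmul a b => simp [G, LinearMap.convMul_apply]

lemma hitL_one (M : Bicomodule k C N) : M.hitL 1 = .id := by
  ext n
  exact M.lcounit n

lemma hitR_one (M : Bicomodule k C N) : M.hitR 1 = .id := by
  ext n
  exact M.rcounit n

lemma sandwich_one (M : Bicomodule k C N) (f : N →ₗ[k] P) : M.sandwich 1 f 1 = f := by
  simp [sandwich, hitL_one, hitR_one]

lemma comp_sandwich (M : Bicomodule k C N) (φ ψ : WithConv (C →ₗ[k] k)) (f : N →ₗ[k] P)
    (g : P →ₗ[k] Q) : g ∘ₗ M.sandwich φ f ψ = M.sandwich φ (g ∘ₗ f) ψ := rfl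

lemma sandwich_sandwich (M : Bicomodule k C N) (φ φ' ψ ψ' : WithConv (C →ₗ[k] k))
    (f : N →ₗ[k] P) :
    M.sandwich φ (M.sandwich φ' f ψ') ψ = M.sandwich (φ * φ') f (ψ' * ψ) := by
  simp only [sandwich, ← hitL_comp_hitL, ← hitR_comp_hitR]
  rw [LinearMap.comp_assoc, LinearMap.comp_assoc, LinearMap.comp_assoc,
    ← LinearMap.comp_assoc (M.hitR ψ), ← hitL_comp_hitR]
  simp only [LinearMap.comp_assoc]

lemma comp_hitL_self (φ ψ : WithConv (C →ₗ[k] k)) :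
    φ.ofConv ∘ₗ (self k C).hitL ψ = (ψ * φ).ofConv := by
  ext c
  simp only [hitL, self, LinearMap.comp_apply, LinearMap.convMul_apply, LinearEquiv.coe_coe]
  induction Coalgebra.comul (R := k) c with
  | zero => simp
  | add _ _ h₁ h₂ => simp only [LinearMap.map_add, LinearEquiv.map_add, h₁, h₂]
  | tmul a b => simp

lemma comp_hitR_self (φ ψ : WithConv (C →ₗ[k] k)) :
    φ.ofConv ∘ₗ (self k C).hitR ψ = (φ * ψ).ofConv := by
  ext c
  simp only [hitR, self, LinearMap.comp_apply, LinearMap.convMul_apply, LinearEquiv.coe_coe]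
  induction Coalgebra.comul (R := k) c with
  | zero => simp
  | add _ _ h₁ h₂ => simp only [LinearMap.map_add, LinearEquiv.map_add, h₁, h₂]
  | tmul a b => simp [mul_comm]

/-- Pull back of a functional along a linear map. -/
def pull (φ : WithConv (D →ₗ[k] k)) (f : C →ₗ[k] D) : WithConv (C →ₗ[k] k) :=
  .toConv (φ.ofConv ∘ₗ f)

lemma pull_sandwich (φ ψ : WithConv (C →ₗ[k] k)) (f : C →ₗ[k] D) (χ : WithConv (D →ₗ[k] k)) :
    pull χ ((self k C).sandwich φ f ψ) = φ * pull χ f * ψ := by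
  have h : ∀ θ : WithConv (C →ₗ[k] k),
      WithConv.toConv (θ.ofConv ∘ₗ (self k C).hitL φ ∘ₗ (self k C).hitR ψ) = φ * θ * ψ := by
    intro θ
    rw [← LinearMap.comp_assoc, comp_hitL_self, comp_hitR_self]
  exact h (pull χ f)

/-- `f : N → P` is compatible with the coactions along the map `f₀ : C → D`. -/
structure Covers (M : Bicomodule k C N) (R : Bicomodule k D P) (f₀ : C →ₗ[k] D) (f : N →ₗ[k] P) :
    Prop where
  left : ∀ n, R.lcoact (f n) = TensorProduct.map f₀ f (M.lcoact n)
  right : ∀ n, R.rcoact (f n) = TensorProduct.map f f₀ (M.rcoact n)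

lemma Covers.hitL {M : Bicomodule k C N} {R : Bicomodule k D P} {f₀ : C →ₗ[k] D} {f : N →ₗ[k] P}
    (h : Covers M R f₀ f) (φ : WithConv (D →ₗ[k] k)) :
    R.hitL φ ∘ₗ f = f ∘ₗ M.hitL (pull φ f₀) := by
  ext n
  simp only [Bicomodule.hitL, LinearMap.comp_apply, h.left, LinearEquiv.coe_coe]
  induction M.lcoact n with
  | zero => simp
  | add _ _ h₁ h₂ => simp only [LinearMap.map_add, LinearEquiv.map_add, h₁, h₂]
  | tmul a b => simp [pull]

lemma Covers.hitR {M : Bicomodule k C N} {R : Bicomodule k D P} {f₀ : C →ₗ[k] D} {f : N →ₗ[k] P}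
    (h : Covers M R f₀ f) (φ : WithConv (D →ₗ[k] k)) :
    R.hitR φ ∘ₗ f = f ∘ₗ M.hitR (pull φ f₀) := by
  ext n
  simp only [Bicomodule.hitR, LinearMap.comp_apply, h.right, LinearEquiv.coe_coe]
  induction M.rcoact n with
  | zero => simp
  | add _ _ h₁ h₂ => simp only [LinearMap.map_add, LinearEquiv.map_add, h₁, h₂]
  | tmul a b => simp [pull]

lemma Covers.sandwich_comp {M : Bicomodule k C N} {R : Bicomodule k D P} {f₀ : C →ₗ[k] D}
    {f : N →ₗ[k] P} (h : Covers M R f₀ f) (φ ψ : WithConv (D →ₗ[k] k)) (g : P →ₗ[k] Q) :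
    R.sandwich φ g ψ ∘ₗ f = M.sandwich (pull φ f₀) (g ∘ₗ f) (pull ψ f₀) := by
  simp only [Bicomodule.sandwich, LinearMap.comp_assoc, h.hitR]
  rw [← LinearMap.comp_assoc (M.hitR _), h.hitL]
  simp only [LinearMap.comp_assoc]

lemma eq_of_lid_rTensor {t t' : C ⊗[k] N}
    (h : ∀ φ : C →ₗ[k] k, TensorProduct.lid k N (φ.rTensor N t) =
      TensorProduct.lid k N (φ.rTensor N t')) : t = t' := by
  classical
  let : AddCommGroup C := Module.addCommMonoidToAddCommGroup k
  let b := Module.Basis.ofVectorSpace k C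
  apply (TensorProduct.equivFinsuppOfBasisLeft (N := N) b).injective
  ext i
  have key : ∀ s : C ⊗[k] N, TensorProduct.equivFinsuppOfBasisLeft (N := N) b s i =
      TensorProduct.lid k N ((b.coord i).rTensor N s) := by
    intro s
    induction s with
    | zero => simp
    | add _ _ h₁ h₂ => simp only [LinearMap.map_add, LinearEquiv.map_add, Finsupp.add_apply, h₁, h₂]
    | tmul a c => simp
  rw [key, key, h]

lemma eq_of_rid_lTensor {t t' : N ⊗[k] C}
    (h : ∀ φ : C →ₗ[k] k, TensorProduct.rid k N (φ.lTensor N t) =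
      TensorProduct.rid k N (φ.lTensor N t')) : t = t' := by
  apply (TensorProduct.comm k N C).injective
  apply eq_of_lid_rTensor
  intro φ
  have key : ∀ s : N ⊗[k] C, TensorProduct.lid k N (φ.rTensor N (TensorProduct.comm k N C s)) =
      TensorProduct.rid k N (φ.lTensor N s) := by
    intro s
    induction s with
    | zero => simp
    | add _ _ h₁ h₂ => simp only [LinearMap.map_add, LinearEquiv.map_add, h₁, h₂]
    | tmul a c => simp
  rw [key, key, h]

lemma Covers.of_hit {M : Bicomodule k C N} {R : Bicomodule k D P} {f₀ : C →ₗ[k] D} {f : N →ₗ[k] P}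
    (hl : ∀ φ, R.hitL φ ∘ₗ f = f ∘ₗ M.hitL (pull φ f₀))
    (hr : ∀ φ, R.hitR φ ∘ₗ f = f ∘ₗ M.hitR (pull φ f₀)) : Covers M R f₀ f where
  left n := by
    apply eq_of_lid_rTensor
    intro φ
    refine (LinearMap.congr_fun (hl (.toConv φ)) n).trans ?_
    simp only [Bicomodule.hitL, LinearMap.comp_apply, LinearEquiv.coe_coe]
    induction M.lcoact n with
    | zero => simp
    | add _ _ h₁ h₂ => simp only [LinearMap.map_add, LinearEquiv.map_add, h₁, h₂]
    | tmul a b => simp [pull]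
  right n := by
    apply eq_of_rid_lTensor
    intro φ
    refine (LinearMap.congr_fun (hr (.toConv φ)) n).trans ?_
    simp only [Bicomodule.hitR, LinearMap.comp_apply, LinearEquiv.coe_coe]
    induction M.rcoact n with
    | zero => simp
    | add _ _ h₁ h₂ => simp only [LinearMap.map_add, LinearEquiv.map_add, h₁, h₂]
    | tmul a b => simp [pull]

lemma Covers.twist {M : Bicomodule k C N} {R : Bicomodule k D P} {f₀ : C →ₗ[k] D} {f : N →ₗ[k] P}
    (h : Covers M R f₀ f) {γ δ : WithConv (C →ₗ[k] k)} (hδγ : δ * γ = 1) :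
    Covers M R ((self k C).sandwich γ f₀ δ) (M.sandwich γ f δ) := by
  have h₁ (φ) (n) := LinearMap.congr_fun (h.hitL φ) n
  have h₂ (φ) (n) := LinearMap.congr_fun (h.hitR φ) n
  have h₃ (φ ψ) (n) := LinearMap.congr_fun (M.hitL_comp_hitL φ ψ) n
  have h₄ (φ ψ) (n) := LinearMap.congr_fun (M.hitR_comp_hitR φ ψ) n
  have h₅ (φ ψ) (n) := LinearMap.congr_fun (M.hitL_comp_hitR φ ψ) n
  simp only [LinearMap.comp_apply] at h₁ h₂ h₃ h₄ h₅
  apply Covers.of_hit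
  · intro φ
    rw [pull_sandwich]
    ext n
    simp only [Bicomodule.sandwich, LinearMap.comp_apply, h₁, h₃, ← h₅, mul_assoc, hδγ, mul_one]
  · intro φ
    rw [pull_sandwich]
    ext n
    simp only [Bicomodule.sandwich, LinearMap.comp_apply, h₂, h₄, h₅, ← mul_assoc, hδγ, one_mul]

lemma Covers.comp {L : Bicomodule k F Q} {M : Bicomodule k C N} {R : Bicomodule k D P}
    {f₀ : C →ₗ[k] D} {f : N →ₗ[k] P} {g₀ : F →ₗ[k] C} {g : Q →ₗ[k] N}
    (h : Covers M R f₀ f) (h' : Covers L M g₀ g) : Covers L R (f₀ ∘ₗ g₀) (f ∘ₗ g) where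
  left n := by
    rw [LinearMap.comp_apply, h.left, h'.left, TensorProduct.map_comp, LinearMap.comp_apply]
  right n := by
    rw [LinearMap.comp_apply, h.right, h'.right, TensorProduct.map_comp, LinearMap.comp_apply]

lemma Covers.id (M : Bicomodule k C N) : Covers M M .id .id where
  left n := by simp
  right n := by simp

lemma pull_mul {f : C →ₗ[k] D} (h : Covers (self k C) (self k D) f f)
    (φ ψ : WithConv (D →ₗ[k] k)) : pull (φ * ψ) f = pull φ f * pull ψ f := by
  apply WithConv.ofConv_injective
  rw [← comp_hitL_self]
  ext c
  change (φ * ψ).ofConv (f c) = _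
  rw [← comp_hitL_self]
  exact congr(ψ.ofConv $(LinearMap.congr_fun (h.hitL φ) c))

end Twist

section TensorTwist

variable {k C D C' D' N P N' P' : Type*} [Field k]
  [AddCommMonoid C] [Module k C] [Coalgebra k C] [AddCommMonoid D] [Module k D] [Coalgebra k D]
  [AddCommMonoid C'] [Module k C'] [Coalgebra k C'] [AddCommMonoid D'] [Module k D']
  [Coalgebra k D']
  [AddCommMonoid N] [Module k N] [AddCommMonoid P] [Module k P]
  [AddCommMonoid N'] [Module k N'] [AddCommMonoid P'] [Module k P']

lemma Covers.map {M : Bicomodule k C N} {R : Bicomodule k D P} {f₀ : C →ₗ[k] D} {f : N →ₗ[k] P}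
    {M' : Bicomodule k C' N'} {R' : Bicomodule k D' P'} {f₀' : C' →ₗ[k] D'} {f' : N' →ₗ[k] P'}
    (h : Covers M R f₀ f) (h' : Covers M' R' f₀' f') :
    Covers (M.tensor M') (R.tensor R') (TensorProduct.map f₀ f₀') (TensorProduct.map f f') where
  left n := by
    induction n with
    | zero => simp only [LinearMap.map_zero, LinearEquiv.map_zero]
    | add _ _ h₁ h₂ => simp only [LinearMap.map_add, LinearEquiv.map_add, h₁, h₂]
    | tmul a b =>
      simp only [tensor, LinearMap.comp_apply, TensorProduct.map_tmul, h.left, h'.left,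
        LinearEquiv.coe_coe]
      induction M.lcoact a with
      | zero => simp only [LinearMap.map_zero, LinearEquiv.map_zero, TensorProduct.zero_tmul]
      | add _ _ h₁ h₂ => simp only [LinearMap.map_add, LinearEquiv.map_add, TensorProduct.add_tmul, h₁, h₂]
      | tmul a₁ a₂ =>
      induction M'.lcoact b with
      | zero => simp only [LinearMap.map_zero, LinearEquiv.map_zero, TensorProduct.tmul_zero]
      | add _ _ h₁ h₂ => simp only [LinearMap.map_add, LinearEquiv.map_add, TensorProduct.tmul_add, h₁, h₂]
      | tmul b₁ b₂ => simp
  right n := by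
    induction n with
    | zero => simp only [LinearMap.map_zero, LinearEquiv.map_zero]
    | add _ _ h₁ h₂ => simp only [LinearMap.map_add, LinearEquiv.map_add, h₁, h₂]
    | tmul a b =>
      simp only [tensor, LinearMap.comp_apply, TensorProduct.map_tmul, h.right, h'.right,
        LinearEquiv.coe_coe]
      induction M.rcoact a with
      | zero => simp only [LinearMap.map_zero, LinearEquiv.map_zero, TensorProduct.zero_tmul]
      | add _ _ h₁ h₂ => simp only [LinearMap.map_add, LinearEquiv.map_add, TensorProduct.add_tmul, h₁, h₂]
      | tmul a₁ a₂ =>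
      induction M'.rcoact b with
      | zero => simp only [LinearMap.map_zero, LinearEquiv.map_zero, TensorProduct.tmul_zero]
      | add _ _ h₁ h₂ => simp only [LinearMap.map_add, LinearEquiv.map_add, TensorProduct.tmul_add, h₁, h₂]
      | tmul b₁ b₂ => simp

/-- The functional `c ⊗ d ↦ φ(c) ψ(d)`. -/
def box (φ : WithConv (C →ₗ[k] k)) (ψ : WithConv (D →ₗ[k] k)) : WithConv (C ⊗[k] D →ₗ[k] k) :=
  .toConv (LinearMap.mul' k k ∘ₗ TensorProduct.map φ.ofConv ψ.ofConv)

lemma box_one_one : box (1 : WithConv (C →ₗ[k] k)) (1 : WithConv (D →ₗ[k] k)) = 1 := by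
  apply WithConv.ofConv_injective
  ext c d
  simp [box, mul_comm]

lemma box_mul_box (φ φ' : WithConv (C →ₗ[k] k)) (ψ ψ' : WithConv (D →ₗ[k] k)) :
    box φ ψ * box φ' ψ' = box (φ * φ') (ψ * ψ') := by
  apply WithConv.ofConv_injective
  ext c d
  simp only [TensorProduct.AlgebraTensorModule.curry_apply, LinearMap.restrictScalars_self,
    TensorProduct.curry_apply]
  simp only [box, LinearMap.convMul_apply, LinearMap.comp_apply, TensorProduct.map_tmul,
    LinearMap.mul'_apply, TensorProduct.comul_tmul]
  induction Coalgebra.comul (R := k) c with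
  | zero => simp only [LinearMap.map_zero, LinearEquiv.map_zero, TensorProduct.zero_tmul, zero_mul]
  | add _ _ h₁ h₂ => simp only [LinearMap.map_add, LinearEquiv.map_add, TensorProduct.add_tmul, h₁, h₂, add_mul]
  | tmul a₁ a₂ =>
  induction Coalgebra.comul (R := k) d with
  | zero => simp only [LinearMap.map_zero, LinearEquiv.map_zero, TensorProduct.tmul_zero, mul_zero]
  | add _ _ h₁ h₂ => simp only [LinearMap.map_add, LinearEquiv.map_add, TensorProduct.tmul_add, h₁, h₂, mul_add]
  | tmul b₁ b₂ => simp; ring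

lemma hitL_box (M : Bicomodule k C N) (R : Bicomodule k D P) (φ : WithConv (C →ₗ[k] k))
    (ψ : WithConv (D →ₗ[k] k)) :
    (M.tensor R).hitL (box φ ψ) = TensorProduct.map (M.hitL φ) (R.hitL ψ) := by
  ext n p
  simp only [TensorProduct.AlgebraTensorModule.curry_apply, LinearMap.restrictScalars_self,
    TensorProduct.curry_apply]
  simp only [hitL, tensor, LinearMap.comp_apply, TensorProduct.map_tmul, LinearEquiv.coe_coe]
  induction M.lcoact n with
  | zero => simp only [LinearMap.map_zero, LinearEquiv.map_zero, TensorProduct.zero_tmul]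
  | add _ _ h₁ h₂ => simp only [LinearMap.map_add, LinearEquiv.map_add, TensorProduct.add_tmul, h₁, h₂]
  | tmul a₁ a₂ =>
  induction R.lcoact p with
  | zero => simp only [LinearMap.map_zero, LinearEquiv.map_zero, TensorProduct.tmul_zero]
  | add _ _ h₁ h₂ => simp only [LinearMap.map_add, LinearEquiv.map_add, TensorProduct.tmul_add, h₁, h₂]
  | tmul b₁ b₂ => simp [box, TensorProduct.smul_tmul', TensorProduct.tmul_smul, smul_smul, mul_comm]

lemma hitR_box (M : Bicomodule k C N) (R : Bicomodule k D P) (φ : WithConv (C →ₗ[k] k))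
    (ψ : WithConv (D →ₗ[k] k)) :
    (M.tensor R).hitR (box φ ψ) = TensorProduct.map (M.hitR φ) (R.hitR ψ) := by
  ext n p
  simp only [TensorProduct.AlgebraTensorModule.curry_apply, LinearMap.restrictScalars_self,
    TensorProduct.curry_apply]
  simp only [hitR, tensor, LinearMap.comp_apply, TensorProduct.map_tmul, LinearEquiv.coe_coe]
  induction M.rcoact n with
  | zero => simp only [LinearMap.map_zero, LinearEquiv.map_zero, TensorProduct.zero_tmul]
  | add _ _ h₁ h₂ => simp only [LinearMap.map_add, LinearEquiv.map_add, TensorProduct.add_tmul, h₁, h₂]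
  | tmul a₁ a₂ =>
  induction R.rcoact p with
  | zero => simp only [LinearMap.map_zero, LinearEquiv.map_zero, TensorProduct.tmul_zero]
  | add _ _ h₁ h₂ => simp only [LinearMap.map_add, LinearEquiv.map_add, TensorProduct.tmul_add, h₁, h₂]
  | tmul b₁ b₂ => simp [box, TensorProduct.smul_tmul', TensorProduct.tmul_smul, smul_smul, mul_comm]

lemma map_sandwich (M : Bicomodule k C N) (R : Bicomodule k D P) (φ φ' : WithConv (C →ₗ[k] k))
    (ψ ψ' : WithConv (D →ₗ[k] k)) (f : N →ₗ[k] N') (g : P →ₗ[k] P') :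
    TensorProduct.map (M.sandwich φ f φ') (R.sandwich ψ g ψ') =
      (M.tensor R).sandwich (box φ ψ) (TensorProduct.map f g) (box φ' ψ') := by
  simp only [sandwich, hitL_box, hitR_box, TensorProduct.map_comp]

lemma covers_assoc {E Q : Type*} [AddCommMonoid E] [Module k E] [Coalgebra k E]
    [AddCommMonoid Q] [Module k Q]
    (M : Bicomodule k C N) (R : Bicomodule k D P) (T : Bicomodule k E Q) :
    Covers ((M.tensor R).tensor T) (M.tensor (R.tensor T))
      (TensorProduct.assoc k C D E).toLinearMap (TensorProduct.assoc k N P Q).toLinearMap where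
  left n := by
    induction n with
    | zero => simp only [LinearMap.map_zero, LinearEquiv.map_zero]
    | add _ _ h₁ h₂ => simp only [LinearMap.map_add, LinearEquiv.map_add, h₁, h₂]
    | tmul a c =>
    induction a with
    | zero => simp only [LinearMap.map_zero, LinearEquiv.map_zero, TensorProduct.zero_tmul]
    | add _ _ h₁ h₂ => simp only [LinearMap.map_add, LinearEquiv.map_add, TensorProduct.add_tmul, h₁, h₂]
    | tmul a b =>
    simp only [tensor, LinearMap.comp_apply, TensorProduct.map_tmul, LinearEquiv.coe_coe,
      TensorProduct.assoc_tmul]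
    induction M.lcoact a with
    | zero => simp only [LinearMap.map_zero, LinearEquiv.map_zero, TensorProduct.zero_tmul]
    | add _ _ h₁ h₂ => simp only [LinearMap.map_add, LinearEquiv.map_add, TensorProduct.add_tmul, h₁, h₂]
    | tmul a₁ a₂ =>
    induction R.lcoact b with
    | zero => simp only [LinearMap.map_zero, LinearEquiv.map_zero, TensorProduct.zero_tmul, TensorProduct.tmul_zero]
    | add _ _ h₁ h₂ =>
      simp only [LinearMap.map_add, LinearEquiv.map_add, TensorProduct.add_tmul, TensorProduct.tmul_add, h₁, h₂]
    | tmul b₁ b₂ =>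
    induction T.lcoact c with
    | zero => simp only [LinearMap.map_zero, LinearEquiv.map_zero, TensorProduct.tmul_zero]
    | add _ _ h₁ h₂ => simp only [LinearMap.map_add, LinearEquiv.map_add, TensorProduct.tmul_add, h₁, h₂]
    | tmul c₁ c₂ => rfl
  right n := by
    induction n with
    | zero => simp only [LinearMap.map_zero, LinearEquiv.map_zero]
    | add _ _ h₁ h₂ => simp only [LinearMap.map_add, LinearEquiv.map_add, h₁, h₂]
    | tmul a c =>
    induction a with
    | zero => simp only [LinearMap.map_zero, LinearEquiv.map_zero, TensorProduct.zero_tmul]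
    | add _ _ h₁ h₂ => simp only [LinearMap.map_add, LinearEquiv.map_add, TensorProduct.add_tmul, h₁, h₂]
    | tmul a b =>
    simp only [tensor, LinearMap.comp_apply, TensorProduct.map_tmul, LinearEquiv.coe_coe,
      TensorProduct.assoc_tmul]
    induction M.rcoact a with
    | zero => simp only [LinearMap.map_zero, LinearEquiv.map_zero, TensorProduct.zero_tmul]
    | add _ _ h₁ h₂ => simp only [LinearMap.map_add, LinearEquiv.map_add, TensorProduct.add_tmul, h₁, h₂]
    | tmul a₁ a₂ =>
    induction R.rcoact b with
    | zero => simp only [LinearMap.map_zero, LinearEquiv.map_zero, TensorProduct.zero_tmul, TensorProduct.tmul_zero]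
    | add _ _ h₁ h₂ =>
      simp only [LinearMap.map_add, LinearEquiv.map_add, TensorProduct.add_tmul, TensorProduct.tmul_add, h₁, h₂]
    | tmul b₁ b₂ =>
    induction T.rcoact c with
    | zero => simp only [LinearMap.map_zero, LinearEquiv.map_zero, TensorProduct.tmul_zero]
    | add _ _ h₁ h₂ => simp only [LinearMap.map_add, LinearEquiv.map_add, TensorProduct.tmul_add, h₁, h₂]
    | tmul c₁ c₂ => rfl

end TensorTwist

end Bicomodule

section Cocycle

open Bicomodule

/-- A normalised, convolution invertible `2`-cocycle `γ : A ⊗ A → k` on a bialgebra `A`, together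
with its (unique) convolution inverse. The product of functionals is the convolution product
`(φ * ψ)(a ⊗ b) = φ(a₍₁₎ ⊗ b₍₁₎) ψ(a₍₂₎ ⊗ b₍₂₎)`. -/
structure Cocycle (k A : Type*) [Field k] [Ring A] [Bialgebra k A] where
  /-- The cocycle `γ`. -/
  val : WithConv (A ⊗[k] A →ₗ[k] k)
  /-- The convolution inverse of `γ`. -/
  inv : WithConv (A ⊗[k] A →ₗ[k] k)
  val_mul_inv : val * inv = 1
  inv_mul_val : inv * val = 1
  val_tmul_one : ∀ a : A, val.ofConv (a ⊗ₜ 1) = Coalgebra.counit a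
  val_one_tmul : ∀ a : A, val.ofConv (1 ⊗ₜ a) = Coalgebra.counit a
  /-- `γ(a₍₁₎ ⊗ b₍₁₎) γ(a₍₂₎ b₍₂₎ ⊗ c) = γ(b₍₁₎ ⊗ c₍₁₎) γ(a ⊗ b₍₂₎ c₍₂₎)`. -/
  cocycle : ∀ a b c : A,
    (val * .toConv (val.ofConv ∘ₗ (TensorProduct.mk k A A).flip c ∘ₗ LinearMap.mul' k A)).ofConv
        (a ⊗ₜ b) =
      (val * .toConv (val.ofConv ∘ₗ TensorProduct.mk k A A a ∘ₗ LinearMap.mul' k A)).ofConv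
        (b ⊗ₜ c)

namespace Cocycle

variable {k A : Type*} [Field k] [Ring A] [Bialgebra k A]

lemma covers_mul : Covers (self k (A ⊗[k] A)) (self k A) (LinearMap.mul' k A)
    (LinearMap.mul' k A) := by
  have key : ∀ n : A ⊗[k] A, Coalgebra.comul (R := k) (LinearMap.mul' k A n) =
      TensorProduct.map (LinearMap.mul' k A) (LinearMap.mul' k A) (Coalgebra.comul n) := by
    intro n
    induction n with
    | zero => simp only [LinearMap.map_zero, LinearEquiv.map_zero]
    | add _ _ h₁ h₂ => simp only [LinearMap.map_add, LinearEquiv.map_add, h₁, h₂]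
    | tmul a b =>
    rw [LinearMap.mul'_apply, Bialgebra.comul_mul, TensorProduct.comul_tmul]
    induction Coalgebra.comul (R := k) a with
    | zero => simp only [LinearMap.map_zero, LinearEquiv.map_zero, TensorProduct.zero_tmul, zero_mul]
    | add _ _ h₁ h₂ => simp only [LinearMap.map_add, LinearEquiv.map_add, TensorProduct.add_tmul, h₁, h₂, add_mul]
    | tmul a₁ a₂ =>
    induction Coalgebra.comul (R := k) b with
    | zero => simp only [LinearMap.map_zero, LinearEquiv.map_zero, TensorProduct.tmul_zero, mul_zero]
    | add _ _ h₁ h₂ => simp only [LinearMap.map_add, LinearEquiv.map_add, TensorProduct.tmul_add, h₁, h₂, mul_add]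
    | tmul b₁ b₂ => simp
  exact ⟨key, key⟩

/-- The deformed product `a ⊗ b ↦ γ(a₍₁₎ ⊗ b₍₁₎) a₍₂₎ b₍₂₎ γ⁻¹(a₍₃₎ ⊗ b₍₃₎)`. -/
def mul (γ : Cocycle k A) : A ⊗[k] A →ₗ[k] A :=
  (self k (A ⊗[k] A)).sandwich γ.val (LinearMap.mul' k A) γ.inv

lemma sandwich_comp_sandwich {C D N P Q : Type*}
    [AddCommMonoid C] [Module k C] [Coalgebra k C] [AddCommMonoid D] [Module k D] [Coalgebra k D]
    [AddCommMonoid N] [Module k N] [AddCommMonoid P] [Module k P] [AddCommMonoid Q] [Module k Q]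
    {M : Bicomodule k C N} {R : Bicomodule k D P} {f₀ : C →ₗ[k] D} {f : N →ₗ[k] P}
    (h : Covers M R f₀ f) (φ ψ : WithConv (D →ₗ[k] k)) (g : P →ₗ[k] Q)
    {Γ Γ' : WithConv (C →ₗ[k] k)} (hΓ : Γ' * Γ = 1) :
    R.sandwich φ g ψ ∘ₗ M.sandwich Γ f Γ' =
      M.sandwich (Γ * pull φ f₀) (g ∘ₗ f) (pull ψ f₀ * Γ') := by
  rw [(h.twist hΓ).sandwich_comp, pull_sandwich, pull_sandwich, comp_sandwich, sandwich_sandwich]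
  simp only [mul_assoc, hΓ, mul_one]
  simp only [← mul_assoc, hΓ, one_mul]

lemma box_val_mul (γ : Cocycle k A) :
    box γ.val (1 : WithConv (A →ₗ[k] k)) *
        pull γ.val (TensorProduct.map (LinearMap.mul' k A) .id) =
      pull (box (1 : WithConv (A →ₗ[k] k)) γ.val *
        pull γ.val (TensorProduct.map .id (LinearMap.mul' k A)))
          (TensorProduct.assoc k A A A).toLinearMap := by
  apply WithConv.ofConv_injective
  rw [← comp_hitL_self, ← tensor_self, hitL_box, hitL_one]
  apply TensorProduct.ext_threefold
  intro a b c
  have h := γ.cocycle a b c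
  rw [← comp_hitL_self, ← comp_hitL_self] at h
  have h2 : ∀ φ : WithConv (A ⊗[k] (A ⊗[k] A) →ₗ[k] k),
      (box (1 : WithConv (A →ₗ[k] k)) γ.val * φ).ofConv =
        φ.ofConv ∘ₗ TensorProduct.map .id ((self k (A ⊗[k] A)).hitL γ.val) := by
    intro φ
    rw [← comp_hitL_self, ← tensor_self, hitL_box, hitL_one]
  simp only [pull, h2]
  simpa [pull] using h

lemma pull_one {C D : Type*} [AddCommMonoid C] [Module k C] [Coalgebra k C] [AddCommMonoid D]
    [Module k D] [Coalgebra k D] {f : C →ₗ[k] D}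
    (hf : Coalgebra.counit (R := k) ∘ₗ f = Coalgebra.counit) : pull 1 f = 1 :=
  congrArg WithConv.toConv hf

lemma counit_comp_map {C D C' D' : Type*} [AddCommMonoid C] [Module k C] [Coalgebra k C]
    [AddCommMonoid D] [Module k D] [Coalgebra k D] [AddCommMonoid C'] [Module k C']
    [Coalgebra k C'] [AddCommMonoid D'] [Module k D'] [Coalgebra k D'] {f : C →ₗ[k] D}
    {f' : C' →ₗ[k] D'} (hf : Coalgebra.counit (R := k) ∘ₗ f = Coalgebra.counit)
    (hf' : Coalgebra.counit (R := k) ∘ₗ f' = Coalgebra.counit) :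
    Coalgebra.counit (R := k) ∘ₗ TensorProduct.map f f' = Coalgebra.counit := by
  apply TensorProduct.ext'
  intro a b
  simpa using congr($(LinearMap.congr_fun hf' b) * $(LinearMap.congr_fun hf a))

lemma counit_comp_mul' : Coalgebra.counit (R := k) ∘ₗ LinearMap.mul' k A = Coalgebra.counit := by
  apply TensorProduct.ext'
  intro a b
  simp [mul_comm]

lemma mul_mul_eq_one {R : Type*} [Monoid R] {x y z w : R} (h : x * w = 1) (h' : y * z = 1) :
    (x * y) * (z * w) = 1 := by
  rw [mul_assoc, ← mul_assoc y, h', one_mul, h]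

lemma mul_box_inv (γ : Cocycle k A) :
    pull γ.inv (TensorProduct.map (LinearMap.mul' k A) .id) *
        box γ.inv (1 : WithConv (A →ₗ[k] k)) =
      pull (pull γ.inv (TensorProduct.map .id (LinearMap.mul' k A)) *
        box (1 : WithConv (A →ₗ[k] k)) γ.inv) (TensorProduct.assoc k A A A).toLinearMap := by
  have hF := (covers_mul (k := k) (A := A)).map (Covers.id (self k A))
  have hF' := (Covers.id (self k A)).map (covers_mul (k := k) (A := A))
  have hA := covers_assoc (self k A) (self k A) (self k A)
  simp only [tensor_self] at hF hF' hA
  have hA' : Coalgebra.counit (R := k) ∘ₗ (TensorProduct.assoc k A A A).toLinearMap =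
      Coalgebra.counit := by
    apply TensorProduct.ext_threefold
    intro a b c
    simp [mul_assoc]
  have n₁ := counit_comp_map (k := k) (f := LinearMap.mul' k A) (f' := (.id : A →ₗ[k] A))
    counit_comp_mul' (LinearMap.comp_id _)
  have n₂ := counit_comp_map (k := k) (f := (.id : A →ₗ[k] A)) (f' := LinearMap.mul' k A)
    (LinearMap.comp_id _) counit_comp_mul'
  have m₁ : box γ.inv (1 : WithConv (A →ₗ[k] k)) * box γ.val 1 = 1 := by
    rw [box_mul_box, γ.inv_mul_val, one_mul, box_one_one]
  have m₂ := pull_mul hF γ.inv γ.val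
  rw [γ.inv_mul_val, pull_one n₁] at m₂
  have m₃ : box (1 : WithConv (A →ₗ[k] k)) γ.val * box 1 γ.inv = 1 := by
    rw [box_mul_box, γ.val_mul_inv, one_mul, box_one_one]
  have m₄ := pull_mul hF' γ.val γ.inv
  rw [γ.val_mul_inv, pull_one n₂] at m₄
  have m₅ := mul_mul_eq_one m₃ m₄.symm
  have m₆ := pull_mul hA (box (1 : WithConv (A →ₗ[k] k)) γ.val *
    pull γ.val (TensorProduct.map .id (LinearMap.mul' k A)))
    (pull γ.inv (TensorProduct.map .id (LinearMap.mul' k A)) * box 1 γ.inv)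
  rw [m₅, pull_one hA', ← box_val_mul] at m₆
  exact left_inv_eq_right_inv (mul_mul_eq_one m₂.symm m₁) m₆.symm

/-- Associativity passes to the maps deformed by `γ`. -/
lemma sandwich_assoc (γ : Cocycle k A) {N₁ N₂ N₃ N₁₂ N₂₃ N : Type*}
    [AddCommMonoid N₁] [Module k N₁] [AddCommMonoid N₂] [Module k N₂]
    [AddCommMonoid N₃] [Module k N₃] [AddCommMonoid N₁₂] [Module k N₁₂]
    [AddCommMonoid N₂₃] [Module k N₂₃] [AddCommMonoid N] [Module k N]
    {M₁ : Bicomodule k A N₁} {M₂ : Bicomodule k A N₂} {M₃ : Bicomodule k A N₃}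
    {M₁₂ : Bicomodule k A N₁₂} {M₂₃ : Bicomodule k A N₂₃}
    {f : N₁ ⊗[k] N₂ →ₗ[k] N₁₂} {g : N₁₂ ⊗[k] N₃ →ₗ[k] N}
    {f' : N₂ ⊗[k] N₃ →ₗ[k] N₂₃} {g' : N₁ ⊗[k] N₂₃ →ₗ[k] N}
    (hf : Covers (M₁.tensor M₂) M₁₂ (LinearMap.mul' k A) f)
    (hf' : Covers (M₂.tensor M₃) M₂₃ (LinearMap.mul' k A) f')
    (h : ∀ x y z, g (f (x ⊗ₜ y) ⊗ₜ z) = g' (x ⊗ₜ f' (y ⊗ₜ z))) (x : N₁) (y : N₂) (z : N₃) :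
    (M₁₂.tensor M₃).sandwich γ.val g γ.inv
        ((M₁.tensor M₂).sandwich γ.val f γ.inv (x ⊗ₜ y) ⊗ₜ z) =
      (M₁.tensor M₂₃).sandwich γ.val g' γ.inv
        (x ⊗ₜ (M₂.tensor M₃).sandwich γ.val f' γ.inv (y ⊗ₜ z)) := by
  have e₁ := sandwich_comp_sandwich (hf.map (Covers.id M₃)) γ.val γ.inv g
    (Γ := box γ.val 1) (Γ' := box γ.inv 1)
    (by rw [box_mul_box, γ.inv_mul_val, one_mul, box_one_one])
  have e₂ := sandwich_comp_sandwich ((Covers.id M₁).map hf') γ.val γ.inv g'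
    (Γ := box 1 γ.val) (Γ' := box 1 γ.inv)
    (by rw [box_mul_box, γ.inv_mul_val, one_mul, box_one_one])
  rw [← map_sandwich, sandwich_one] at e₁ e₂
  have e₃ : g ∘ₗ TensorProduct.map f .id = (g' ∘ₗ TensorProduct.map .id f') ∘ₗ
      (TensorProduct.assoc k N₁ N₂ N₃).toLinearMap := by
    apply TensorProduct.ext_threefold
    intro x y z
    simpa using h x y z
  rw [box_val_mul, mul_box_inv, e₃, ← (covers_assoc M₁ M₂ M₃).sandwich_comp, ← e₂] at e₁
  simpa using LinearMap.congr_fun e₁ ((x ⊗ₜ y) ⊗ₜ z)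

lemma covers_tmul_right {N : Type*} [AddCommMonoid N] [Module k N] (M : Bicomodule k A N) :
    Covers M ((self k A).tensor M) (TensorProduct.mk k A A 1) (TensorProduct.mk k A N 1) where
  left n := by
    simp only [tensor, self, LinearMap.comp_apply, TensorProduct.mk_apply, TensorProduct.map_tmul,
      Bialgebra.comul_one, LinearEquiv.coe_coe]
    induction M.lcoact n with
    | zero => simp only [LinearMap.map_zero, LinearEquiv.map_zero, TensorProduct.tmul_zero]
    | add _ _ h₁ h₂ => simp only [LinearMap.map_add, LinearEquiv.map_add, TensorProduct.tmul_add, h₁, h₂]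
    | tmul a b => rfl
  right n := by
    simp only [tensor, self, LinearMap.comp_apply, TensorProduct.mk_apply, TensorProduct.map_tmul,
      Bialgebra.comul_one, LinearEquiv.coe_coe]
    induction M.rcoact n with
    | zero => simp only [LinearMap.map_zero, LinearEquiv.map_zero, TensorProduct.tmul_zero]
    | add _ _ h₁ h₂ => simp only [LinearMap.map_add, LinearEquiv.map_add, TensorProduct.tmul_add, h₁, h₂]
    | tmul a b => rfl

lemma covers_tmul_left {N : Type*} [AddCommMonoid N] [Module k N] (M : Bicomodule k A N) :
    Covers M (M.tensor (self k A)) ((TensorProduct.mk k A A).flip 1)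
      ((TensorProduct.mk k N A).flip 1) where
  left n := by
    simp only [tensor, self, LinearMap.comp_apply, TensorProduct.mk_apply, TensorProduct.map_tmul,
      Bialgebra.comul_one, LinearEquiv.coe_coe, LinearMap.flip_apply]
    induction M.lcoact n with
    | zero => simp only [LinearMap.map_zero, LinearEquiv.map_zero, TensorProduct.zero_tmul]
    | add _ _ h₁ h₂ => simp only [LinearMap.map_add, LinearEquiv.map_add, TensorProduct.add_tmul, h₁, h₂]
    | tmul a b => rfl
  right n := by
    simp only [tensor, self, LinearMap.comp_apply, TensorProduct.mk_apply, TensorProduct.map_tmul,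
      Bialgebra.comul_one, LinearEquiv.coe_coe, LinearMap.flip_apply]
    induction M.rcoact n with
    | zero => simp only [LinearMap.map_zero, LinearEquiv.map_zero, TensorProduct.zero_tmul]
    | add _ _ h₁ h₂ => simp only [LinearMap.map_add, LinearEquiv.map_add, TensorProduct.add_tmul, h₁, h₂]
    | tmul a b => rfl

lemma pull_inv_eq_one (γ : Cocycle k A) {j : A →ₗ[k] A ⊗[k] A}
    (hj : Covers (self k A) (self k (A ⊗[k] A)) j j) (h : pull γ.val j = 1)
    (h' : Coalgebra.counit ∘ₗ j = Coalgebra.counit) : pull γ.inv j = 1 := by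
  have e := pull_mul hj γ.val γ.inv
  rwa [h, one_mul, γ.val_mul_inv, pull_one h', eq_comm] at e

lemma sandwich_one_tmul (γ : Cocycle k A) {N : Type*} [AddCommMonoid N] [Module k N]
    (M : Bicomodule k A N) (f : A ⊗[k] N →ₗ[k] N) (h : ∀ n, f (1 ⊗ₜ n) = n) (n : N) :
    ((self k A).tensor M).sandwich γ.val f γ.inv (1 ⊗ₜ n) = n := by
  have e := (covers_tmul_right M).sandwich_comp γ.val γ.inv f
  have h₁ : pull γ.val (TensorProduct.mk k A A 1) = 1 := by
    apply WithConv.ofConv_injective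
    ext a
    exact γ.val_one_tmul a
  rw [h₁, γ.pull_inv_eq_one (covers_tmul_right (self k A)) h₁ (by ext; simp), sandwich_one] at e
  exact (LinearMap.congr_fun e n).trans (h n)

lemma sandwich_tmul_one (γ : Cocycle k A) {N : Type*} [AddCommMonoid N] [Module k N]
    (M : Bicomodule k A N) (f : N ⊗[k] A →ₗ[k] N) (h : ∀ n, f (n ⊗ₜ 1) = n) (n : N) :
    (M.tensor (self k A)).sandwich γ.val f γ.inv (n ⊗ₜ 1) = n := by
  have e := (covers_tmul_left M).sandwich_comp γ.val γ.inv f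
  have h₁ : pull γ.val ((TensorProduct.mk k A A).flip 1) = 1 := by
    apply WithConv.ofConv_injective
    ext a
    exact γ.val_tmul_one a
  rw [h₁, γ.pull_inv_eq_one (covers_tmul_left (self k A)) h₁ (by ext; simp), sandwich_one] at e
  exact (LinearMap.congr_fun e n).trans (h n)

lemma covers_mul_twist (γ : Cocycle k A) :
    Covers (self k (A ⊗[k] A)) (self k A) γ.mul γ.mul :=
  covers_mul.twist γ.inv_mul_val

lemma counit_mul (γ : Cocycle k A) : Coalgebra.counit ∘ₗ γ.mul = Coalgebra.counit (R := k) := by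
  have h := pull_sandwich γ.val γ.inv (LinearMap.mul' k A) 1
  have h₁ : pull (1 : WithConv (A →ₗ[k] k)) (LinearMap.mul' k A) = 1 := by
    apply WithConv.ofConv_injective
    ext a b
    simp [pull, mul_comm]
  rw [h₁, mul_one, γ.val_mul_inv] at h
  exact congrArg WithConv.ofConv h

/-- The cocycle deformation `A_γ`: the vector space `A` with the coproduct of `A` and the product
`γ.mul`. -/
def Twist (_γ : Cocycle k A) : Type _ := A

lemma mul_assoc' (γ : Cocycle k A) (a b c : A) :
    γ.mul (γ.mul (a ⊗ₜ b) ⊗ₜ c) = γ.mul (a ⊗ₜ γ.mul (b ⊗ₜ c)) :=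
  γ.sandwich_assoc (M₁ := self k A) (M₂ := self k A) (M₃ := self k A) (M₁₂ := self k A)
    (M₂₃ := self k A) covers_mul covers_mul (fun x y z ↦ by simp [mul_assoc]) a b c

lemma one_mul' (γ : Cocycle k A) (a : A) : γ.mul (1 ⊗ₜ a) = a :=
  γ.sandwich_one_tmul (self k A) (LinearMap.mul' k A) (fun n ↦ by simp) a

lemma mul_one' (γ : Cocycle k A) (a : A) : γ.mul (a ⊗ₜ 1) = a :=
  γ.sandwich_tmul_one (self k A) (LinearMap.mul' k A) (fun n ↦ by simp) a

lemma counit_mul' (γ : Cocycle k A) (a b : A) :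
    Coalgebra.counit (R := k) (γ.mul (a ⊗ₜ b)) = Coalgebra.counit a * Coalgebra.counit b :=
  (LinearMap.congr_fun γ.counit_mul (a ⊗ₜ b)).trans (by simp [mul_comm])

instance (γ : Cocycle k A) : AddCommGroup γ.Twist := inferInstanceAs (AddCommGroup A)

instance (γ : Cocycle k A) : Module k γ.Twist := inferInstanceAs (Module k A)

instance (γ : Cocycle k A) : Coalgebra k γ.Twist := inferInstanceAs (Coalgebra k A)

/-- The identity map from `A` to `A_γ`. -/
def toTwist (γ : Cocycle k A) : A ≃ₗ[k] γ.Twist := LinearEquiv.refl k A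

instance (γ : Cocycle k A) : Ring γ.Twist :=
  { (inferInstance : AddCommGroup γ.Twist) with
    mul := fun a b ↦ γ.toTwist (γ.mul (γ.toTwist.symm a ⊗ₜ γ.toTwist.symm b))
    one := γ.toTwist 1
    left_distrib := fun a b c ↦
      congrArg γ.mul (TensorProduct.tmul_add (R := k) (M := A) (N := A) a b c) |>.trans
        (map_add γ.mul _ _)
    right_distrib := fun a b c ↦
      congrArg γ.mul (TensorProduct.add_tmul (R := k) (M := A) (N := A) a b c) |>.trans
        (map_add γ.mul _ _)
    zero_mul := fun a ↦
      congrArg γ.mul (TensorProduct.zero_tmul (R := k) (M := A) (N := A) a) |>.trans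
        (map_zero γ.mul)
    mul_zero := fun a ↦
      congrArg γ.mul (TensorProduct.tmul_zero (R := k) (M := A) (N := A) a) |>.trans
        (map_zero γ.mul)
    mul_assoc := γ.mul_assoc'
    one_mul := γ.one_mul'
    mul_one := γ.mul_one' }

instance (γ : Cocycle k A) : Algebra k γ.Twist :=
  Algebra.ofModule
    (fun r a b ↦ congrArg γ.mul
      (TensorProduct.smul_tmul' (R := k) (M := A) (N := A) r a b).symm |>.trans
        (map_smul γ.mul r _))
    (fun r a b ↦ congrArg γ.mul
      (TensorProduct.tmul_smul (R := k) (M := A) (N := A) r a b) |>.trans (map_smul γ.mul r _))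

lemma twist_mul' (γ : Cocycle k A) : LinearMap.mul' k γ.Twist = γ.mul := by
  apply TensorProduct.ext'
  intro a b
  rfl

lemma toTwist_mul (γ : Cocycle k A) (a b : A) :
    γ.toTwist a * γ.toTwist b = γ.toTwist (γ.mul (a ⊗ₜ b)) := rfl

lemma map_toTwist_mul (γ : Cocycle k A) (x y : A ⊗[k] A) :
    TensorProduct.map γ.toTwist.toLinearMap γ.toTwist.toLinearMap x *
      TensorProduct.map γ.toTwist.toLinearMap γ.toTwist.toLinearMap y =
    TensorProduct.map γ.toTwist.toLinearMap γ.toTwist.toLinearMap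
      (TensorProduct.map γ.mul γ.mul
        (TensorProduct.tensorTensorTensorComm k A A A A (x ⊗ₜ y))) := by
  induction x with
  | zero => simp only [LinearMap.map_zero, LinearEquiv.map_zero, TensorProduct.zero_tmul, zero_mul]
  | add _ _ h₁ h₂ => simp only [LinearMap.map_add, LinearEquiv.map_add, TensorProduct.add_tmul, h₁, h₂, add_mul]
  | tmul a₁ a₂ =>
  induction y with
  | zero => simp only [LinearMap.map_zero, LinearEquiv.map_zero, TensorProduct.tmul_zero, mul_zero]
  | add _ _ h₁ h₂ => simp only [LinearMap.map_add, LinearEquiv.map_add, TensorProduct.tmul_add, h₁, h₂, mul_add]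
  | tmul b₁ b₂ =>
    simp only [TensorProduct.map_tmul, TensorProduct.tensorTensorTensorComm_tmul,
      LinearEquiv.coe_coe, Algebra.TensorProduct.tmul_mul_tmul, toTwist_mul]

lemma comul_toTwist (γ : Cocycle k A) (a : A) :
    Coalgebra.comul (R := k) (γ.toTwist a) =
      TensorProduct.map γ.toTwist.toLinearMap γ.toTwist.toLinearMap (Coalgebra.comul a) :=
  (LinearMap.congr_fun (TensorProduct.map_id (R := k) (M := A) (N := A)) _).symm

lemma comul_toTwist_mul (γ : Cocycle k A) (a b : A) :
    Coalgebra.comul (R := k) (γ.toTwist a * γ.toTwist b) =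
      Coalgebra.comul (γ.toTwist a) * Coalgebra.comul (γ.toTwist b) := by
  rw [comul_toTwist, comul_toTwist, map_toTwist_mul, toTwist_mul, comul_toTwist]
  exact congrArg _ (γ.covers_mul_twist.left (a ⊗ₜ b))

instance (γ : Cocycle k A) : Bialgebra k γ.Twist :=
  Bialgebra.mk' k γ.Twist (Bialgebra.counit_one (R := k) (A := A)) (γ.counit_mul' _ _)
    (Bialgebra.comul_one (R := k) (A := A)) (γ.comul_toTwist_mul _ _)

end Cocycle

end Cocycle

namespace Bicomodule

/-- A bicomodule structure transported along a surjective map. -/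
def ofSurjective {k C D N P : Type*} [Field k]
    [AddCommMonoid C] [Module k C] [Coalgebra k C] [AddCommMonoid D] [Module k D] [Coalgebra k D]
    [AddCommMonoid N] [Module k N] [AddCommMonoid P] [Module k P]
    (M : Bicomodule k C N) {f : C →ₗ[k] D} (hf : Covers (self k C) (self k D) f f)
    (hf' : Coalgebra.counit (R := k) ∘ₗ f = Coalgebra.counit) (q : N →ₗ[k] P)
    (hq : Function.Surjective q) (lco : P →ₗ[k] D ⊗[k] P) (rco : P →ₗ[k] P ⊗[k] D)
    (hl : ∀ n, lco (q n) = TensorProduct.map f q (M.lcoact n))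
    (hr : ∀ n, rco (q n) = TensorProduct.map q f (M.rcoact n)) : Bicomodule k D P where
  lcoact := lco
  rcoact := rco
  lcoassoc p := by
    obtain ⟨n, rfl⟩ := hq p
    have hc : ∀ c, Coalgebra.comul (R := k) (f c) = TensorProduct.map f f (Coalgebra.comul c) :=
      hf.left
    convert! congr(TensorProduct.map f (TensorProduct.map f q) $(M.lcoassoc n)) using 1
    all_goals
      rw [hl]
      induction M.lcoact n with
      | zero => simp only [LinearMap.map_zero, LinearEquiv.map_zero]
      | add _ _ h₁ h₂ => simp only [LinearMap.map_add, LinearEquiv.map_add, h₁, h₂]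
      | tmul a b => ?_
    · simp only [TensorProduct.map_tmul, LinearMap.rTensor_tmul, hc]
      induction Coalgebra.comul (R := k) a with
      | zero => simp only [LinearMap.map_zero, LinearEquiv.map_zero, TensorProduct.zero_tmul]
      | add _ _ h₁ h₂ => simp only [LinearMap.map_add, LinearEquiv.map_add, TensorProduct.add_tmul, h₁, h₂]
      | tmul c d => simp
    · simp [hl]
  lcounit p := by
    obtain ⟨n, rfl⟩ := hq p
    have hc : ∀ c, Coalgebra.counit (R := k) (f c) = Coalgebra.counit c :=
      LinearMap.congr_fun hf'
    rw [hl]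
    conv_rhs => rw [← M.lcounit n]
    induction M.lcoact n with
    | zero => simp only [LinearMap.map_zero, LinearEquiv.map_zero]
    | add _ _ h₁ h₂ => simp only [LinearMap.map_add, LinearEquiv.map_add, h₁, h₂]
    | tmul a b => simp [hc]
  rcoassoc p := by
    obtain ⟨n, rfl⟩ := hq p
    have hc : ∀ c, Coalgebra.comul (R := k) (f c) = TensorProduct.map f f (Coalgebra.comul c) :=
      hf.left
    convert! congr(TensorProduct.map q (TensorProduct.map f f) $(M.rcoassoc n)) using 1
    all_goals
      rw [hr]
      induction M.rcoact n with
      | zero => simp only [LinearMap.map_zero, LinearEquiv.map_zero]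
      | add _ _ h₁ h₂ => simp only [LinearMap.map_add, LinearEquiv.map_add, h₁, h₂]
      | tmul a b => ?_
    · simp only [TensorProduct.map_tmul, LinearMap.rTensor_tmul, hr]
      induction M.rcoact a with
      | zero => simp only [LinearMap.map_zero, LinearEquiv.map_zero, TensorProduct.zero_tmul]
      | add _ _ h₁ h₂ => simp only [LinearMap.map_add, LinearEquiv.map_add, TensorProduct.add_tmul, h₁, h₂]
      | tmul c d => simp
    · simp [hc]
  rcounit p := by
    obtain ⟨n, rfl⟩ := hq p
    have hc : ∀ c, Coalgebra.counit (R := k) (f c) = Coalgebra.counit c :=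
      LinearMap.congr_fun hf'
    rw [hr]
    conv_rhs => rw [← M.rcounit n]
    induction M.rcoact n with
    | zero => simp only [LinearMap.map_zero, LinearEquiv.map_zero]
    | add _ _ h₁ h₂ => simp only [LinearMap.map_add, LinearEquiv.map_add, h₁, h₂]
    | tmul a b => simp [hc]
  comm p := by
    obtain ⟨n, rfl⟩ := hq p
    convert! congr(TensorProduct.map f (TensorProduct.map q f) $(M.comm n)) using 1
    · rw [hr]
      induction M.rcoact n with
      | zero => simp only [LinearMap.map_zero, LinearEquiv.map_zero]
      | add _ _ h₁ h₂ => simp only [LinearMap.map_add, LinearEquiv.map_add, h₁, h₂]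
      | tmul a b =>
      simp only [TensorProduct.map_tmul, LinearMap.rTensor_tmul, hl]
      induction M.lcoact a with
      | zero => simp only [LinearMap.map_zero, LinearEquiv.map_zero, TensorProduct.zero_tmul]
      | add _ _ h₁ h₂ => simp only [LinearMap.map_add, LinearEquiv.map_add, TensorProduct.add_tmul, h₁, h₂]
      | tmul c d => simp
    · rw [hl]
      induction M.lcoact n with
      | zero => simp only [LinearMap.map_zero, LinearEquiv.map_zero]
      | add _ _ h₁ h₂ => simp only [LinearMap.map_add, LinearEquiv.map_add, h₁, h₂]
      | tmul a b => simp [hr]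

end Bicomodule

namespace Cocycle

variable {k A : Type*} [Field k] [Ring A] [Bialgebra k A]

open Bicomodule

lemma covers_toTwist (γ : Cocycle k A) : Covers (self k A) (self k γ.Twist)
    γ.toTwist.toLinearMap γ.toTwist.toLinearMap :=
  ⟨γ.comul_toTwist, γ.comul_toTwist⟩

lemma counit_comp_toTwist (γ : Cocycle k A) :
    Coalgebra.counit (R := k) ∘ₗ γ.toTwist.toLinearMap = Coalgebra.counit := rfl

end Cocycle

open Bicomodule in
/-- A bicovariant bimodule over a bialgebra `A`: an `A`-bimodule `E` (with left action `lact` and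
right action `ract`) which is an `A`-bicomodule, such that `Δ_E(a m) = Δ(a) Δ_E(m)` and
`Δ_E(m a) = Δ_E(m) Δ(a)`, and likewise for the right coaction. -/
structure BicovariantBimodule (k A E : Type*) [Field k] [Ring A] [Bialgebra k A]
    [AddCommGroup E] [Module k E] extends Bicomodule k A E where
  /-- The left action `a ⊗ m ↦ a m`. -/
  lact : A ⊗[k] E →ₗ[k] E
  /-- The right action `m ⊗ a ↦ m a`. -/
  ract : E ⊗[k] A →ₗ[k] E
  one_lact : ∀ m, lact (1 ⊗ₜ m) = m
  mul_lact : ∀ a b m, lact ((a * b) ⊗ₜ m) = lact (a ⊗ₜ lact (b ⊗ₜ m))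
  ract_one : ∀ m, ract (m ⊗ₜ 1) = m
  ract_mul : ∀ m a b, ract (m ⊗ₜ (a * b)) = ract (ract (m ⊗ₜ a) ⊗ₜ b)
  lact_ract : ∀ a m b, ract (lact (a ⊗ₜ m) ⊗ₜ b) = lact (a ⊗ₜ ract (m ⊗ₜ b))
  lcoact_lact : ∀ a m, lcoact (lact (a ⊗ₜ m)) = TensorProduct.map (LinearMap.mul' k A) lact
    (TensorProduct.tensorTensorTensorComm k A A A E (Coalgebra.comul a ⊗ₜ lcoact m))
  lcoact_ract : ∀ m a, lcoact (ract (m ⊗ₜ a)) = TensorProduct.map (LinearMap.mul' k A) ract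
    (TensorProduct.tensorTensorTensorComm k A E A A (lcoact m ⊗ₜ Coalgebra.comul a))
  rcoact_lact : ∀ a m, rcoact (lact (a ⊗ₜ m)) = TensorProduct.map lact (LinearMap.mul' k A)
    (TensorProduct.tensorTensorTensorComm k A A E A (Coalgebra.comul a ⊗ₜ rcoact m))
  rcoact_ract : ∀ m a, rcoact (ract (m ⊗ₜ a)) = TensorProduct.map ract (LinearMap.mul' k A)
    (TensorProduct.tensorTensorTensorComm k E A A A (rcoact m ⊗ₜ Coalgebra.comul a))

namespace BicovariantBimodule

open Bicomodule

section Braiding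

variable {k A E : Type*} [Field k] [Ring A] [Bialgebra k A] [AddCommGroup E] [Module k E]
  (M : BicovariantBimodule k A E)

/-- `m` is left-invariant: `Δ_E(m) = 1 ⊗ m`. -/
def IsLeftInvariant (m : E) : Prop := M.lcoact m = 1 ⊗ₜ m

/-- `m` is right-invariant: the right coaction maps `m` to `m ⊗ 1`. -/
def IsRightInvariant (m : E) : Prop := M.rcoact m = m ⊗ₜ 1

/-- The relations `m a ⊗ n = m ⊗ a n` that define `E ⊗_A E` as a quotient of `E ⊗_k E`. -/
def balanced : Submodule k (E ⊗[k] E) :=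
  Submodule.span k {t | ∃ (m n : E) (a : A),
    t = M.ract (m ⊗ₜ a) ⊗ₜ n - m ⊗ₜ M.lact (a ⊗ₜ n)}

/-- The tensor product `E ⊗_A E` of the bimodule `E` with itself over `A`. -/
abbrev TensorSq : Type _ := (E ⊗[k] E) ⧸ M.balanced

/-- The element `m ⊗_A n` of `E ⊗_A E`. -/
def tmul (m n : E) : M.TensorSq := M.balanced.mkQ (m ⊗ₜ n)

lemma lact_balanced (a : A) :
    M.balanced ≤ M.balanced.comap ((M.lact ∘ₗ TensorProduct.mk k A E a).rTensor E) := by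
  refine Submodule.span_le.mpr ?_
  rintro _ ⟨m, n, b, rfl⟩
  refine Submodule.subset_span ⟨M.lact (a ⊗ₜ m), n, b, ?_⟩
  simp [M.lact_ract]

lemma ract_balanced (a : A) :
    M.balanced ≤ M.balanced.comap ((M.ract ∘ₗ (TensorProduct.mk k E A).flip a).lTensor E) := by
  refine Submodule.span_le.mpr ?_
  rintro _ ⟨m, n, b, rfl⟩
  refine Submodule.subset_span ⟨m, M.ract (n ⊗ₜ a), b, ?_⟩
  simp [M.lact_ract]

/-- The left action of `a` on `E ⊗_A E`: `m ⊗_A n ↦ (a m) ⊗_A n`. -/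
def lactSq (a : A) : M.TensorSq →ₗ[k] M.TensorSq :=
  M.balanced.mapQ M.balanced _ (M.lact_balanced a)

/-- The right action of `a` on `E ⊗_A E`: `m ⊗_A n ↦ m ⊗_A (n a)`. -/
def ractSq (a : A) : M.TensorSq →ₗ[k] M.TensorSq :=
  M.balanced.mapQ M.balanced _ (M.ract_balanced a)

/-- `σ` is the Woronowicz braiding of `E`: it is an `A`-bimodule map from `E ⊗_A E` to itself with
`σ(ω ⊗_A η) = η ⊗_A ω` for all left-invariant `ω` and all right-invariant `η`. -/
structure IsBraiding (σ : M.TensorSq →ₗ[k] M.TensorSq) : Prop where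
  map_lactSq : ∀ a t, σ (M.lactSq a t) = M.lactSq a (σ t)
  map_ractSq : ∀ a t, σ (M.ractSq a t) = M.ractSq a (σ t)
  map_tmul : ∀ ω η, M.IsLeftInvariant ω → M.IsRightInvariant η →
    σ (M.tmul ω η) = M.tmul η ω

end Braiding

section Deform

variable {k A E : Type*} [Field k] [Ring A] [Bialgebra k A] [AddCommGroup E] [Module k E]
  (M : BicovariantBimodule k A E)

lemma covers_lact :
    Covers ((self k A).tensor M.toBicomodule) M.toBicomodule (LinearMap.mul' k A) M.lact where
  left n := by
    induction n with
    | zero => simp only [LinearMap.map_zero, LinearEquiv.map_zero]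
    | add _ _ h₁ h₂ => simp only [LinearMap.map_add, LinearEquiv.map_add, h₁, h₂]
    | tmul a m => exact M.lcoact_lact a m
  right n := by
    induction n with
    | zero => simp only [LinearMap.map_zero, LinearEquiv.map_zero]
    | add _ _ h₁ h₂ => simp only [LinearMap.map_add, LinearEquiv.map_add, h₁, h₂]
    | tmul a m => exact M.rcoact_lact a m

lemma covers_ract :
    Covers (M.toBicomodule.tensor (self k A)) M.toBicomodule (LinearMap.mul' k A) M.ract where
  left n := by
    induction n with
    | zero => simp only [LinearMap.map_zero, LinearEquiv.map_zero]
    | add _ _ h₁ h₂ => simp only [LinearMap.map_add, LinearEquiv.map_add, h₁, h₂]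
    | tmul m a => exact M.lcoact_ract m a
  right n := by
    induction n with
    | zero => simp only [LinearMap.map_zero, LinearEquiv.map_zero]
    | add _ _ h₁ h₂ => simp only [LinearMap.map_add, LinearEquiv.map_add, h₁, h₂]
    | tmul m a => exact M.rcoact_ract m a

/-- The deformed left action `a ⊗ m ↦ γ(a₍₁₎ ⊗ m₍₋₁₎) a₍₂₎ m₍₀₎ γ⁻¹(a₍₃₎ ⊗ m₍₁₎)`. -/
def twistLact (γ : Cocycle k A) : A ⊗[k] E →ₗ[k] E :=
  ((self k A).tensor M.toBicomodule).sandwich γ.val M.lact γ.inv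

/-- The deformed right action `m ⊗ a ↦ γ(m₍₋₁₎ ⊗ a₍₁₎) m₍₀₎ a₍₂₎ γ⁻¹(m₍₁₎ ⊗ a₍₃₎)`. -/
def twistRact (γ : Cocycle k A) : E ⊗[k] A →ₗ[k] E :=
  (M.toBicomodule.tensor (self k A)).sandwich γ.val M.ract γ.inv

lemma mul_twistLact (γ : Cocycle k A) (a b : A) (m : E) :
    M.twistLact γ (γ.mul (a ⊗ₜ b) ⊗ₜ m) = M.twistLact γ (a ⊗ₜ M.twistLact γ (b ⊗ₜ m)) :=
  γ.sandwich_assoc (M₁ := self k A) (M₂ := self k A) (M₁₂ := self k A) Cocycle.covers_mul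
    M.covers_lact M.mul_lact a b m

lemma twistRact_mul (γ : Cocycle k A) (m : E) (a b : A) :
    M.twistRact γ (m ⊗ₜ γ.mul (a ⊗ₜ b)) = M.twistRact γ (M.twistRact γ (m ⊗ₜ a) ⊗ₜ b) :=
  (γ.sandwich_assoc (M₂ := self k A) (M₃ := self k A) (M₂₃ := self k A) M.covers_ract
    Cocycle.covers_mul (fun m a b ↦ (M.ract_mul m a b).symm) m a b).symm

lemma twistLact_twistRact (γ : Cocycle k A) (a : A) (m : E) (b : A) :
    M.twistRact γ (M.twistLact γ (a ⊗ₜ m) ⊗ₜ b) = M.twistLact γ (a ⊗ₜ M.twistRact γ (m ⊗ₜ b)) :=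
  γ.sandwich_assoc (M₁ := self k A) (M₃ := self k A) M.covers_lact M.covers_ract M.lact_ract a m b

lemma lcoact_twistLact (γ : Cocycle k A) (a : A) (m : E) :
    M.lcoact (M.twistLact γ (a ⊗ₜ m)) = TensorProduct.map γ.mul (M.twistLact γ)
      (TensorProduct.tensorTensorTensorComm k A A A E (Coalgebra.comul a ⊗ₜ M.lcoact m)) :=
  (M.covers_lact.twist γ.inv_mul_val).left (a ⊗ₜ m)

lemma lcoact_twistRact (γ : Cocycle k A) (m : E) (a : A) :
    M.lcoact (M.twistRact γ (m ⊗ₜ a)) = TensorProduct.map γ.mul (M.twistRact γ)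
      (TensorProduct.tensorTensorTensorComm k A E A A (M.lcoact m ⊗ₜ Coalgebra.comul a)) :=
  (M.covers_ract.twist γ.inv_mul_val).left (m ⊗ₜ a)

lemma rcoact_twistLact (γ : Cocycle k A) (a : A) (m : E) :
    M.rcoact (M.twistLact γ (a ⊗ₜ m)) = TensorProduct.map (M.twistLact γ) γ.mul
      (TensorProduct.tensorTensorTensorComm k A A E A (Coalgebra.comul a ⊗ₜ M.rcoact m)) :=
  (M.covers_lact.twist γ.inv_mul_val).right (a ⊗ₜ m)

lemma rcoact_twistRact (γ : Cocycle k A) (m : E) (a : A) :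
    M.rcoact (M.twistRact γ (m ⊗ₜ a)) = TensorProduct.map (M.twistRact γ) γ.mul
      (TensorProduct.tensorTensorTensorComm k E A A A (M.rcoact m ⊗ₜ Coalgebra.comul a)) :=
  (M.covers_ract.twist γ.inv_mul_val).right (m ⊗ₜ a)

/-- The cocycle deformation `E_γ`, a bicovariant bimodule over `A_γ`: the vector space `E` with the
coactions of `E` and the deformed actions. -/
def deform (γ : Cocycle k A) : BicovariantBimodule k γ.Twist E where
  toBicomodule := M.toBicomodule.ofSurjective γ.covers_toTwist γ.counit_comp_toTwist .id
    Function.surjective_id (TensorProduct.map γ.toTwist.toLinearMap .id ∘ₗ M.lcoact)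
    (TensorProduct.map .id γ.toTwist.toLinearMap ∘ₗ M.rcoact) (fun _ ↦ rfl) (fun _ ↦ rfl)
  lact := M.twistLact γ ∘ₗ TensorProduct.map γ.toTwist.symm.toLinearMap .id
  ract := M.twistRact γ ∘ₗ TensorProduct.map .id γ.toTwist.symm.toLinearMap
  one_lact m := γ.sandwich_one_tmul M.toBicomodule M.lact M.one_lact m
  mul_lact a b m := M.mul_twistLact γ (γ.toTwist.symm a) (γ.toTwist.symm b) m
  ract_one m := γ.sandwich_tmul_one M.toBicomodule M.ract M.ract_one m
  ract_mul m a b := M.twistRact_mul γ m (γ.toTwist.symm a) (γ.toTwist.symm b)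
  lact_ract a m b := M.twistLact_twistRact γ (γ.toTwist.symm a) m (γ.toTwist.symm b)
  lcoact_lact a m := by
    obtain ⟨a, rfl⟩ := γ.toTwist.surjective a
    simp only [ofSurjective, LinearMap.comp_apply, TensorProduct.map_tmul, LinearEquiv.coe_coe,
      LinearEquiv.symm_apply_apply, LinearMap.id_apply, lcoact_twistLact, γ.comul_toTwist]
    induction Coalgebra.comul (R := k) a with
    | zero => simp only [LinearMap.map_zero, LinearEquiv.map_zero, TensorProduct.zero_tmul]
    | add _ _ h₁ h₂ => simp only [LinearMap.map_add, LinearEquiv.map_add, TensorProduct.add_tmul, h₁, h₂]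
    | tmul a₁ a₂ =>
    induction M.lcoact m with
    | zero => simp only [LinearMap.map_zero, LinearEquiv.map_zero, TensorProduct.tmul_zero]
    | add _ _ h₁ h₂ => simp only [LinearMap.map_add, LinearEquiv.map_add, TensorProduct.tmul_add, h₁, h₂]
    | tmul b₁ b₂ => simp [γ.toTwist_mul]
  lcoact_ract m a := by
    obtain ⟨a, rfl⟩ := γ.toTwist.surjective a
    simp only [ofSurjective, LinearMap.comp_apply, TensorProduct.map_tmul, LinearEquiv.coe_coe,
      LinearEquiv.symm_apply_apply, LinearMap.id_apply, lcoact_twistRact, γ.comul_toTwist]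
    induction Coalgebra.comul (R := k) a with
    | zero => simp only [LinearMap.map_zero, LinearEquiv.map_zero, TensorProduct.tmul_zero]
    | add _ _ h₁ h₂ => simp only [LinearMap.map_add, LinearEquiv.map_add, TensorProduct.tmul_add, h₁, h₂]
    | tmul a₁ a₂ =>
    induction M.lcoact m with
    | zero => simp only [LinearMap.map_zero, LinearEquiv.map_zero, TensorProduct.zero_tmul]
    | add _ _ h₁ h₂ => simp only [LinearMap.map_add, LinearEquiv.map_add, TensorProduct.add_tmul, h₁, h₂]
    | tmul b₁ b₂ => simp [γ.toTwist_mul]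
  rcoact_lact a m := by
    obtain ⟨a, rfl⟩ := γ.toTwist.surjective a
    simp only [ofSurjective, LinearMap.comp_apply, TensorProduct.map_tmul, LinearEquiv.coe_coe,
      LinearEquiv.symm_apply_apply, LinearMap.id_apply, rcoact_twistLact, γ.comul_toTwist]
    induction Coalgebra.comul (R := k) a with
    | zero => simp only [LinearMap.map_zero, LinearEquiv.map_zero, TensorProduct.zero_tmul]
    | add _ _ h₁ h₂ => simp only [LinearMap.map_add, LinearEquiv.map_add, TensorProduct.add_tmul, h₁, h₂]
    | tmul a₁ a₂ =>
    induction M.rcoact m with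
    | zero => simp only [LinearMap.map_zero, LinearEquiv.map_zero, TensorProduct.tmul_zero]
    | add _ _ h₁ h₂ => simp only [LinearMap.map_add, LinearEquiv.map_add, TensorProduct.tmul_add, h₁, h₂]
    | tmul b₁ b₂ => simp [γ.toTwist_mul]
  rcoact_ract m a := by
    obtain ⟨a, rfl⟩ := γ.toTwist.surjective a
    simp only [ofSurjective, LinearMap.comp_apply, TensorProduct.map_tmul, LinearEquiv.coe_coe,
      LinearEquiv.symm_apply_apply, LinearMap.id_apply, rcoact_twistRact, γ.comul_toTwist]
    induction Coalgebra.comul (R := k) a with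
    | zero => simp only [LinearMap.map_zero, LinearEquiv.map_zero, TensorProduct.tmul_zero]
    | add _ _ h₁ h₂ => simp only [LinearMap.map_add, LinearEquiv.map_add, TensorProduct.tmul_add, h₁, h₂]
    | tmul a₁ a₂ =>
    induction M.rcoact m with
    | zero => simp only [LinearMap.map_zero, LinearEquiv.map_zero, TensorProduct.zero_tmul]
    | add _ _ h₁ h₂ => simp only [LinearMap.map_add, LinearEquiv.map_add, TensorProduct.add_tmul, h₁, h₂]
    | tmul b₁ b₂ => simp [γ.toTwist_mul]

end Deform

end BicovariantBimodule

/-! ### The one-forms of a commutative bialgebra -/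


namespace OneForms

open KaehlerDifferential Bicomodule

section

variable (k A : Type*) [Field k] [CommRing A] [Bialgebra k A]

/-- The universal differential `d : A → Ω`. -/
abbrev d : A →ₗ[k] Ω[A⁄k] := (KaehlerDifferential.D k A).toLinearMap

/-- The left action `a ⊗ ω ↦ a ω` of functions on one-forms. -/
def lact : A ⊗[k] Ω[A⁄k] →ₗ[k] Ω[A⁄k] :=
  TensorProduct.lift (Algebra.lsmul k k Ω[A⁄k] : A →ₐ[k] Module.End k Ω[A⁄k]).toLinearMap

/-- The right action `ω ⊗ a ↦ a ω` of functions on one-forms. -/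
def ract : Ω[A⁄k] ⊗[k] A →ₗ[k] Ω[A⁄k] := lact k A ∘ₗ (TensorProduct.comm k _ _).toLinearMap

variable {k A} in
@[simp] lemma lact_tmul (a : A) (ω : Ω[A⁄k]) : lact k A (a ⊗ₜ ω) = a • ω := rfl

variable {k A} in
@[simp] lemma ract_tmul (a : A) (ω : Ω[A⁄k]) : ract k A (ω ⊗ₜ a) = a • ω := rfl

/-- The map `a ⊗ b ↦ a db`. -/
def proj : A ⊗[k] A →ₗ[k] Ω[A⁄k] := lact k A ∘ₗ (d k A).lTensor A

variable {k A} in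
@[simp] lemma proj_tmul (a b : A) : proj k A (a ⊗ₜ b) = a • d k A b := rfl

lemma proj_surjective : Function.Surjective (proj k A) := by
  intro ω
  have h : ω ∈ Submodule.span A (Set.range (KaehlerDifferential.D k A)) := by
    rw [KaehlerDifferential.span_range_derivation]
    trivial
  induction h using Submodule.span_induction with
  | mem x hx =>
    obtain ⟨b, rfl⟩ := hx
    exact ⟨1 ⊗ₜ b, by simp⟩
  | zero => exact ⟨0, map_zero _⟩
  | add x y _ _ hx hy =>
    obtain ⟨s, rfl⟩ := hx
    obtain ⟨t, rfl⟩ := hy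
    exact ⟨s + t, map_add _ _ _⟩
  | smul a x hmem hx =>
    clear hmem
    obtain ⟨s, rfl⟩ := hx
    refine ⟨(LinearMap.mulLeft k a).rTensor A s, ?_⟩
    induction s with
    | zero => simp
    | add _ _ h₁ h₂ => simp only [LinearMap.map_add, LinearEquiv.map_add, smul_add, h₁, h₂]
    | tmul b c => simp [mul_smul]

/-- The action of `A ⊗ A` on `A ⊗ Ω`: `(a ⊗ b) (c ⊗ ω) = a c ⊗ b ω`. -/
def lsmul : (A ⊗[k] A) ⊗[k] (A ⊗[k] Ω[A⁄k]) →ₗ[k] A ⊗[k] Ω[A⁄k] :=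
  TensorProduct.map (LinearMap.mul' k A) (lact k A) ∘ₗ
    (TensorProduct.tensorTensorTensorComm k A A A Ω[A⁄k]).toLinearMap

/-- The action of `A ⊗ A` on `Ω ⊗ A`: `(a ⊗ b) (ω ⊗ c) = a ω ⊗ b c`. -/
def rsmul : (A ⊗[k] A) ⊗[k] (Ω[A⁄k] ⊗[k] A) →ₗ[k] Ω[A⁄k] ⊗[k] A :=
  TensorProduct.map (lact k A) (LinearMap.mul' k A) ∘ₗ
    (TensorProduct.tensorTensorTensorComm k A A Ω[A⁄k] A).toLinearMap

variable {k A} in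
@[simp] lemma lsmul_tmul (a b c : A) (ω : Ω[A⁄k]) :
    lsmul k A ((a ⊗ₜ b) ⊗ₜ (c ⊗ₜ ω)) = (a * c) ⊗ₜ (b • ω) := rfl

variable {k A} in
@[simp] lemma rsmul_tmul (a b c : A) (ω : Ω[A⁄k]) :
    rsmul k A ((a ⊗ₜ b) ⊗ₜ (ω ⊗ₜ c)) = (a • ω) ⊗ₜ (b * c) := rfl

lemma lsmul_one (t : A ⊗[k] Ω[A⁄k]) : lsmul k A (1 ⊗ₜ t) = t := by
  induction t with
  | zero => simp only [TensorProduct.tmul_zero, LinearMap.map_zero, LinearEquiv.map_zero]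
  | add _ _ h₁ h₂ => simp only [LinearMap.map_add, LinearEquiv.map_add, TensorProduct.tmul_add, h₁, h₂]
  | tmul a ω => simp [Algebra.TensorProduct.one_def]

lemma rsmul_one (t : Ω[A⁄k] ⊗[k] A) : rsmul k A (1 ⊗ₜ t) = t := by
  induction t with
  | zero => simp only [TensorProduct.tmul_zero, LinearMap.map_zero, LinearEquiv.map_zero]
  | add _ _ h₁ h₂ => simp only [LinearMap.map_add, LinearEquiv.map_add, TensorProduct.tmul_add, h₁, h₂]
  | tmul a ω => simp [Algebra.TensorProduct.one_def]

lemma lsmul_mul (x y : A ⊗[k] A) (t : A ⊗[k] Ω[A⁄k]) :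
    lsmul k A ((x * y) ⊗ₜ t) = lsmul k A (x ⊗ₜ lsmul k A (y ⊗ₜ t)) := by
  induction t with
  | zero => simp only [TensorProduct.tmul_zero, LinearMap.map_zero, LinearEquiv.map_zero]
  | add _ _ h₁ h₂ => simp only [LinearMap.map_add, LinearEquiv.map_add, TensorProduct.tmul_add, h₁, h₂]
  | tmul c ω =>
  induction x with
  | zero => simp only [TensorProduct.zero_tmul, zero_mul, LinearMap.map_zero, LinearEquiv.map_zero]
  | add _ _ h₁ h₂ => simp only [LinearMap.map_add, LinearEquiv.map_add, TensorProduct.add_tmul, add_mul, h₁, h₂]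
  | tmul a a' =>
  induction y with
  | zero => simp only [TensorProduct.zero_tmul, mul_zero, LinearMap.map_zero, LinearEquiv.map_zero, TensorProduct.tmul_zero]
  | add _ _ h₁ h₂ =>
    simp only [LinearMap.map_add, LinearEquiv.map_add, TensorProduct.add_tmul, TensorProduct.tmul_add, mul_add, h₁, h₂]
  | tmul b b' => simp [mul_assoc, mul_smul]

lemma rsmul_mul (x y : A ⊗[k] A) (t : Ω[A⁄k] ⊗[k] A) :
    rsmul k A ((x * y) ⊗ₜ t) = rsmul k A (x ⊗ₜ rsmul k A (y ⊗ₜ t)) := by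
  induction t with
  | zero => simp only [TensorProduct.tmul_zero, LinearMap.map_zero, LinearEquiv.map_zero]
  | add _ _ h₁ h₂ => simp only [LinearMap.map_add, LinearEquiv.map_add, TensorProduct.tmul_add, h₁, h₂]
  | tmul c ω =>
  induction x with
  | zero => simp only [TensorProduct.zero_tmul, zero_mul, LinearMap.map_zero, LinearEquiv.map_zero]
  | add _ _ h₁ h₂ => simp only [LinearMap.map_add, LinearEquiv.map_add, TensorProduct.add_tmul, add_mul, h₁, h₂]
  | tmul a a' =>
  induction y with
  | zero => simp only [TensorProduct.zero_tmul, mul_zero, LinearMap.map_zero, LinearEquiv.map_zero, TensorProduct.tmul_zero]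
  | add _ _ h₁ h₂ =>
    simp only [LinearMap.map_add, LinearEquiv.map_add, TensorProduct.add_tmul, TensorProduct.tmul_add, mul_add, h₁, h₂]
  | tmul b b' => simp [mul_assoc, mul_smul]

lemma lTensor_d_mul (x y : A ⊗[k] A) : (d k A).lTensor A (x * y) =
    lsmul k A (x ⊗ₜ (d k A).lTensor A y) + lsmul k A (y ⊗ₜ (d k A).lTensor A x) := by
  induction x with
  | zero => simp only [TensorProduct.zero_tmul, TensorProduct.tmul_zero, zero_mul, LinearMap.map_zero, LinearEquiv.map_zero, add_zero]
  | add _ _ h₁ h₂ =>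
    simp only [LinearMap.map_add, LinearEquiv.map_add, TensorProduct.add_tmul, TensorProduct.tmul_add, add_mul, h₁, h₂]
    abel
  | tmul a a' =>
  induction y with
  | zero => simp only [TensorProduct.zero_tmul, mul_zero, LinearMap.map_zero, LinearEquiv.map_zero, TensorProduct.tmul_zero, add_zero]
  | add _ _ h₁ h₂ =>
    simp only [LinearMap.map_add, LinearEquiv.map_add, TensorProduct.add_tmul, TensorProduct.tmul_add, mul_add, h₁, h₂]
    abel
  | tmul b b' => simp [TensorProduct.tmul_add, mul_comm]

lemma rTensor_d_mul (x y : A ⊗[k] A) : (d k A).rTensor A (x * y) =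
    rsmul k A (x ⊗ₜ (d k A).rTensor A y) + rsmul k A (y ⊗ₜ (d k A).rTensor A x) := by
  induction x with
  | zero => simp only [TensorProduct.zero_tmul, TensorProduct.tmul_zero, zero_mul, LinearMap.map_zero, LinearEquiv.map_zero, add_zero]
  | add _ _ h₁ h₂ =>
    simp only [LinearMap.map_add, LinearEquiv.map_add, TensorProduct.add_tmul, TensorProduct.tmul_add, add_mul, h₁, h₂]
    abel
  | tmul a a' =>
  induction y with
  | zero => simp only [TensorProduct.zero_tmul, mul_zero, LinearMap.map_zero, LinearEquiv.map_zero, TensorProduct.tmul_zero, add_zero]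
  | add _ _ h₁ h₂ =>
    simp only [LinearMap.map_add, LinearEquiv.map_add, TensorProduct.add_tmul, TensorProduct.tmul_add, mul_add, h₁, h₂]
    abel
  | tmul b b' => simp [TensorProduct.add_tmul, mul_comm]

/-- `A ⊗ Ω`, as an `A`-module through the comultiplication. -/
def LTarget : Type _ := A ⊗[k] Ω[A⁄k]

/-- `Ω ⊗ A`, as an `A`-module through the comultiplication. -/
def RTarget : Type _ := Ω[A⁄k] ⊗[k] A

instance : AddCommGroup (LTarget k A) := inferInstanceAs (AddCommGroup (A ⊗[k] Ω[A⁄k]))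
instance : AddCommGroup (RTarget k A) := inferInstanceAs (AddCommGroup (Ω[A⁄k] ⊗[k] A))
instance : Module k (LTarget k A) := inferInstanceAs (Module k (A ⊗[k] Ω[A⁄k]))
instance : Module k (RTarget k A) := inferInstanceAs (Module k (Ω[A⁄k] ⊗[k] A))

instance : Module A (LTarget k A) where
  smul a t := lsmul k A (Coalgebra.comul a ⊗ₜ[k] (show A ⊗[k] Ω[A⁄k] from t))
  one_smul t := (congrArg (fun x ↦ lsmul k A (x ⊗ₜ[k] _)) Bialgebra.comul_one).trans
    (lsmul_one k A t)
  mul_smul a b t := (congrArg (fun x ↦ lsmul k A (x ⊗ₜ[k] _)) (Bialgebra.comul_mul a b)).trans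
    (lsmul_mul k A _ _ t)
  smul_zero a := (congrArg (lsmul k A) (TensorProduct.tmul_zero _ _)).trans (map_zero _)
  smul_add a s t := (congrArg (lsmul k A) (TensorProduct.tmul_add _ _ _)).trans (map_add _ _ _)
  add_smul a b t := (congrArg (fun x ↦ lsmul k A (x ⊗ₜ[k] _)) (map_add _ a b)).trans
    ((congrArg (lsmul k A) (TensorProduct.add_tmul _ _ _)).trans (map_add _ _ _))
  zero_smul t := (congrArg (fun x ↦ lsmul k A (x ⊗ₜ[k] _)) (map_zero _)).trans
    ((congrArg (lsmul k A) (TensorProduct.zero_tmul _ _)).trans (map_zero _))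

instance : Module A (RTarget k A) where
  smul a t := rsmul k A (Coalgebra.comul a ⊗ₜ[k] (show Ω[A⁄k] ⊗[k] A from t))
  one_smul t := (congrArg (fun x ↦ rsmul k A (x ⊗ₜ[k] _)) Bialgebra.comul_one).trans
    (rsmul_one k A t)
  mul_smul a b t := (congrArg (fun x ↦ rsmul k A (x ⊗ₜ[k] _)) (Bialgebra.comul_mul a b)).trans
    (rsmul_mul k A _ _ t)
  smul_zero a := (congrArg (rsmul k A) (TensorProduct.tmul_zero _ _)).trans (map_zero _)
  smul_add a s t := (congrArg (rsmul k A) (TensorProduct.tmul_add _ _ _)).trans (map_add _ _ _)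
  add_smul a b t := (congrArg (fun x ↦ rsmul k A (x ⊗ₜ[k] _)) (map_add _ a b)).trans
    ((congrArg (rsmul k A) (TensorProduct.add_tmul _ _ _)).trans (map_add _ _ _))
  zero_smul t := (congrArg (fun x ↦ rsmul k A (x ⊗ₜ[k] _)) (map_zero _)).trans
    ((congrArg (rsmul k A) (TensorProduct.zero_tmul _ _)).trans (map_zero _))

instance : IsScalarTower k A (LTarget k A) where
  smul_assoc r a t := (congrArg (fun x ↦ lsmul k A (x ⊗ₜ[k] _)) (map_smul _ r a)).trans
    ((congrArg (lsmul k A) (TensorProduct.smul_tmul' _ _ _).symm).trans (map_smul _ r _))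

instance : IsScalarTower k A (RTarget k A) where
  smul_assoc r a t := (congrArg (fun x ↦ rsmul k A (x ⊗ₜ[k] _)) (map_smul _ r a)).trans
    ((congrArg (rsmul k A) (TensorProduct.smul_tmul' _ _ _).symm).trans (map_smul _ r _))

/-- The derivation `b ↦ b₍₁₎ ⊗ d b₍₂₎`. -/
def lder : Derivation k A (LTarget k A) :=
  Derivation.mk' (M := LTarget k A) ((d k A).lTensor A ∘ₗ Coalgebra.comul) fun a b ↦
    (congrArg ((d k A).lTensor A) (Bialgebra.comul_mul a b)).trans (lTensor_d_mul k A _ _)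

/-- The derivation `b ↦ d b₍₁₎ ⊗ b₍₂₎`. -/
def rder : Derivation k A (RTarget k A) :=
  Derivation.mk' (M := RTarget k A) ((d k A).rTensor A ∘ₗ Coalgebra.comul) fun a b ↦
    (congrArg ((d k A).rTensor A) (Bialgebra.comul_mul a b)).trans (rTensor_d_mul k A _ _)

/-- The left coaction on one-forms: `a db ↦ a₍₁₎ b₍₁₎ ⊗ a₍₂₎ d b₍₂₎`. -/
def lcoact : Ω[A⁄k] →ₗ[k] A ⊗[k] Ω[A⁄k] :=
  (lder k A).liftKaehlerDifferential.restrictScalars k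

/-- The right coaction on one-forms: `a db ↦ a₍₁₎ d b₍₁₎ ⊗ a₍₂₎ b₍₂₎`. -/
def rcoact : Ω[A⁄k] →ₗ[k] Ω[A⁄k] ⊗[k] A :=
  (rder k A).liftKaehlerDifferential.restrictScalars k

lemma lcoact_smul (a : A) (ω : Ω[A⁄k]) :
    lcoact k A (a • ω) = lsmul k A (Coalgebra.comul a ⊗ₜ lcoact k A ω) :=
  map_smul (lder k A).liftKaehlerDifferential a ω

lemma rcoact_smul (a : A) (ω : Ω[A⁄k]) :
    rcoact k A (a • ω) = rsmul k A (Coalgebra.comul a ⊗ₜ rcoact k A ω) :=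
  map_smul (rder k A).liftKaehlerDifferential a ω

lemma lcoact_d (b : A) : lcoact k A (d k A b) = (d k A).lTensor A (Coalgebra.comul b) :=
  (lder k A).liftKaehlerDifferential_comp_D b

lemma rcoact_d (b : A) : rcoact k A (d k A b) = (d k A).rTensor A (Coalgebra.comul b) :=
  (rder k A).liftKaehlerDifferential_comp_D b

lemma lcoact_proj (t : A ⊗[k] A) : lcoact k A (proj k A t) =
    TensorProduct.map (LinearMap.mul' k A) (proj k A) ((self k (A ⊗[k] A)).lcoact t) := by
  induction t with
  | zero => simp only [LinearMap.map_zero, LinearEquiv.map_zero]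
  | add _ _ h₁ h₂ => simp only [LinearMap.map_add, LinearEquiv.map_add, h₁, h₂]
  | tmul a b =>
  rw [proj_tmul, lcoact_smul, lcoact_d, ← tensor_self]
  simp only [tensor, self, LinearMap.comp_apply, TensorProduct.map_tmul, LinearEquiv.coe_coe]
  induction Coalgebra.comul (R := k) a with
  | zero => simp only [LinearMap.map_zero, LinearEquiv.map_zero, TensorProduct.zero_tmul]
  | add _ _ h₁ h₂ => simp only [LinearMap.map_add, LinearEquiv.map_add, TensorProduct.add_tmul, h₁, h₂]
  | tmul a₁ a₂ =>
  induction Coalgebra.comul (R := k) b with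
  | zero => simp only [LinearMap.map_zero, LinearEquiv.map_zero, TensorProduct.tmul_zero]
  | add _ _ h₁ h₂ => simp only [LinearMap.map_add, LinearEquiv.map_add, TensorProduct.tmul_add, h₁, h₂]
  | tmul b₁ b₂ => simp

lemma rcoact_proj (t : A ⊗[k] A) : rcoact k A (proj k A t) =
    TensorProduct.map (proj k A) (LinearMap.mul' k A) ((self k (A ⊗[k] A)).rcoact t) := by
  induction t with
  | zero => simp only [LinearMap.map_zero, LinearEquiv.map_zero]
  | add _ _ h₁ h₂ => simp only [LinearMap.map_add, LinearEquiv.map_add, h₁, h₂]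
  | tmul a b =>
  rw [proj_tmul, rcoact_smul, rcoact_d, ← tensor_self]
  simp only [tensor, self, LinearMap.comp_apply, TensorProduct.map_tmul, LinearEquiv.coe_coe]
  induction Coalgebra.comul (R := k) a with
  | zero => simp only [LinearMap.map_zero, LinearEquiv.map_zero, TensorProduct.zero_tmul]
  | add _ _ h₁ h₂ => simp only [LinearMap.map_add, LinearEquiv.map_add, TensorProduct.add_tmul, h₁, h₂]
  | tmul a₁ a₂ =>
  induction Coalgebra.comul (R := k) b with
  | zero => simp only [LinearMap.map_zero, LinearEquiv.map_zero, TensorProduct.tmul_zero]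
  | add _ _ h₁ h₂ => simp only [LinearMap.map_add, LinearEquiv.map_add, TensorProduct.tmul_add, h₁, h₂]
  | tmul b₁ b₂ => simp

/-- The canonical bicovariant bimodule of one-forms of a commutative bialgebra `A`: the Kähler
differentials of `A`, with `a ω = ω a` and the coactions
`a db ↦ a₍₁₎ b₍₁₎ ⊗ a₍₂₎ d b₍₂₎` and `a db ↦ a₍₁₎ d b₍₁₎ ⊗ a₍₂₎ b₍₂₎`. -/
def _root_.oneForms : BicovariantBimodule k A Ω[A⁄k] where
  toBicomodule := (self k (A ⊗[k] A)).ofSurjective Cocycle.covers_mul Cocycle.counit_comp_mul'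
    (proj k A) (proj_surjective k A) (lcoact k A) (rcoact k A) (lcoact_proj k A) (rcoact_proj k A)
  lact := lact k A
  ract := ract k A
  one_lact := by simp
  mul_lact := by simp [mul_smul]
  ract_one := by simp
  ract_mul m a b := by
    rw [mul_comm a b]
    exact mul_smul b a m
  lact_ract a m b := smul_comm b a m
  lcoact_lact a m := lcoact_smul k A a m
  lcoact_ract m a := by
    refine (lcoact_smul k A a m).trans ?_
    change _ = TensorProduct.map (LinearMap.mul' k A) (ract k A)
      (TensorProduct.tensorTensorTensorComm k A Ω[A⁄k] A A (lcoact k A m ⊗ₜ Coalgebra.comul a))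
    induction Coalgebra.comul (R := k) a with
    | zero => simp only [LinearMap.map_zero, LinearEquiv.map_zero, TensorProduct.zero_tmul, TensorProduct.tmul_zero]
    | add _ _ h₁ h₂ =>
      simp only [LinearMap.map_add, LinearEquiv.map_add, TensorProduct.add_tmul, TensorProduct.tmul_add, h₁, h₂]
    | tmul a₁ a₂ =>
    induction lcoact k A m with
    | zero => simp only [LinearMap.map_zero, LinearEquiv.map_zero, TensorProduct.zero_tmul, TensorProduct.tmul_zero]
    | add _ _ h₁ h₂ =>
      simp only [LinearMap.map_add, LinearEquiv.map_add, TensorProduct.add_tmul, TensorProduct.tmul_add, h₁, h₂]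
    | tmul b₁ b₂ => simp [mul_comm]
  rcoact_lact a m := rcoact_smul k A a m
  rcoact_ract m a := by
    refine (rcoact_smul k A a m).trans ?_
    change _ = TensorProduct.map (ract k A) (LinearMap.mul' k A)
      (TensorProduct.tensorTensorTensorComm k Ω[A⁄k] A A A (rcoact k A m ⊗ₜ Coalgebra.comul a))
    induction Coalgebra.comul (R := k) a with
    | zero => simp only [LinearMap.map_zero, LinearEquiv.map_zero, TensorProduct.zero_tmul, TensorProduct.tmul_zero]
    | add _ _ h₁ h₂ =>
      simp only [LinearMap.map_add, LinearEquiv.map_add, TensorProduct.add_tmul, TensorProduct.tmul_add, h₁, h₂]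
    | tmul a₁ a₂ =>
    induction rcoact k A m with
    | zero => simp only [LinearMap.map_zero, LinearEquiv.map_zero, TensorProduct.zero_tmul, TensorProduct.tmul_zero]
    | add _ _ h₁ h₂ =>
      simp only [LinearMap.map_add, LinearEquiv.map_add, TensorProduct.add_tmul, TensorProduct.tmul_add, h₁, h₂]
    | tmul b₁ b₂ => simp [mul_comm]

end

end OneForms

/-! ### The Hopf algebra of regular functions of a group -/

section EvalTwo

variable {k V W X Y : Type*} [Field k] [AddCommGroup V] [Module k V] [AddCommGroup W] [Module k W]

/-- The function `(x, y) ↦ u(v)(x) w(z)(y)` attached to `v ⊗ z`. -/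
def evalTwo (u : V →ₗ[k] (X → k)) (w : W →ₗ[k] (Y → k)) : V ⊗[k] W →ₗ[k] (X × Y → k) :=
  TensorProduct.lift (LinearMap.mk₂ k (fun v z p ↦ u v p.1 * w z p.2)
    (fun _ _ _ ↦ by ext; simp [add_mul]) (fun _ _ _ ↦ by ext; simp [mul_assoc])
    (fun _ _ _ ↦ by ext; simp [mul_add]) (fun _ _ _ ↦ by ext; simp [mul_left_comm]))

@[simp] lemma evalTwo_tmul (u : V →ₗ[k] (X → k)) (w : W →ₗ[k] (Y → k)) (v : V) (z : W) (p : X × Y) :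
    evalTwo u w (v ⊗ₜ z) p = u v p.1 * w z p.2 := rfl

lemma evalTwo_injective {u : V →ₗ[k] (X → k)} {w : W →ₗ[k] (Y → k)} (hu : Function.Injective u)
    (hw : Function.Injective w) : Function.Injective (evalTwo u w) := by
  classical
  rw [injective_iff_map_eq_zero]
  intro t ht
  let b := Module.Basis.ofVectorSpace k W
  let s (x : X) : V ⊗[k] W →ₗ[k] W :=
    (TensorProduct.lid k W).toLinearMap ∘ₗ (LinearMap.proj x ∘ₗ u).rTensor W
  have h₁ : ∀ x y (t : V ⊗[k] W), evalTwo u w t (x, y) = w (s x t) y := by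
    intro x y t
    induction t with
    | zero => simp
    | add _ _ h₁ h₂ => simp only [map_add, Pi.add_apply, h₁, h₂]
    | tmul a c => simp [s]
  have h₂ : ∀ x i (t : V ⊗[k] W), b.repr (s x t) i =
      u (TensorProduct.equivFinsuppOfBasisRight (M := V) b t i) x := by
    intro x i t
    induction t with
    | zero => simp
    | add _ _ h₁ h₂ => simp only [map_add, Pi.add_apply, Finsupp.add_apply, h₁, h₂]
    | tmul a c => simp [s, mul_comm]
  have h₃ : ∀ x, s x t = 0 := by
    intro x
    apply hw
    ext y
    rw [← h₁, ht]
    simp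
  apply (TensorProduct.equivFinsuppOfBasisRight (M := V) b).injective
  ext i
  apply hu
  ext x
  rw [← h₂, h₃]
  simp

end EvalTwo

section RegularFunctions

variable (G : Type*) [Group G] [TopologicalSpace G]

/-- The matrix coefficients of the finite-dimensional continuous complex representations of `G`. -/
def matrixCoefficients : Set (G → ℂ) :=
  {f | ∃ (ι : Type) (_ : Fintype ι) (_ : DecidableEq ι) (ρ : G →* Matrix ι ι ℂ) (i j : ι),
    Continuous ρ ∧ f = fun g ↦ ρ g i j}

lemma one_mem_matrixCoefficients : (1 : G → ℂ) ∈ matrixCoefficients G :=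
  ⟨Unit, inferInstance, inferInstance, 1, (), (), continuous_const, by ext; simp⟩

variable {G} in
lemma mul_mem_matrixCoefficients {f f' : G → ℂ} (hf : f ∈ matrixCoefficients G)
    (hf' : f' ∈ matrixCoefficients G) : f * f' ∈ matrixCoefficients G := by
  obtain ⟨ι, _, _, ρ, i, j, hρ, rfl⟩ := hf
  obtain ⟨ι', _, _, ρ', i', j', hρ', rfl⟩ := hf'
  refine ⟨ι × ι', inferInstance, inferInstance,
    { toFun := fun g ↦ Matrix.kroneckerMap (· * ·) (ρ g) (ρ' g)
      map_one' := by simp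
      map_mul' := fun g h ↦ by simp [Matrix.mul_kronecker_mul] }, (i, i'), (j, j'), ?_, ?_⟩
  · refine continuous_matrix fun a b ↦ ?_
    exact (hρ.matrix_elem _ _).mul (hρ'.matrix_elem _ _)
  · ext g
    simp

/-- The algebra of regular functions of a topological group `G`: the linear span of the matrix
coefficients of its finite-dimensional continuous complex representations. -/
def regularFunctions : Subalgebra ℂ (G → ℂ) :=
  (Submodule.span ℂ (matrixCoefficients G)).toSubalgebra
    (Submodule.subset_span (one_mem_matrixCoefficients G)) (by
      intro f f' hf hf'
      induction hf, hf' using Submodule.span_induction₂ with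
      | mem_mem x y hx hy => exact Submodule.subset_span (mul_mem_matrixCoefficients hx hy)
      | zero_left y hy => simp
      | zero_right x hx => simp
      | add_left x y z hx hy hz h h' => rw [add_mul]; exact add_mem h h'
      | add_right x y z hx hy hz h h' => rw [mul_add]; exact add_mem h h'
      | smul_left r x y hx hy h => rw [smul_mul_assoc]; exact Submodule.smul_mem _ _ h
      | smul_right r x y hx hy h => rw [mul_smul_comm]; exact Submodule.smul_mem _ _ h)

/-- The type of regular functions of `G`. -/
def RegularFunction : Type _ := regularFunctions G

namespace RegularFunction

instance : CommRing (RegularFunction G) := inferInstanceAs (CommRing (regularFunctions G))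

instance : Algebra ℂ (RegularFunction G) := inferInstanceAs (Algebra ℂ (regularFunctions G))

/-- A regular function as a function on `G`. -/
def ev : RegularFunction G →ₐ[ℂ] (G → ℂ) := (regularFunctions G).val

variable {G}

lemma ev_injective : Function.Injective (ev G) := Subtype.val_injective

lemma ev_mem (f : RegularFunction G) : ev G f ∈ Submodule.span ℂ (matrixCoefficients G) := f.2

/-- A matrix coefficient as a regular function. -/
def coeff {ι : Type} [Fintype ι] [DecidableEq ι] (ρ : G →* Matrix ι ι ℂ) (hρ : Continuous ρ)
    (i j : ι) : RegularFunction G :=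
  ⟨fun g ↦ ρ g i j, Submodule.subset_span ⟨ι, _, _, ρ, i, j, hρ, rfl⟩⟩

@[simp] lemma ev_coeff {ι : Type} [Fintype ι] [DecidableEq ι] (ρ : G →* Matrix ι ι ℂ)
    (hρ : Continuous ρ) (i j : ι) (g : G) : ev G (coeff ρ hρ i j) g = ρ g i j := rfl

/-- The function `(x, y) ↦ Σ fᵢ(x) hᵢ(y)` attached to `Σ fᵢ ⊗ hᵢ`. -/
def ev₂ : RegularFunction G ⊗[ℂ] RegularFunction G →ₗ[ℂ] (G × G → ℂ) :=
  evalTwo (ev G).toLinearMap (ev G).toLinearMap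

/-- The function `(x, (y, z)) ↦ Σ fᵢ(x) hᵢ(y) lᵢ(z)` attached to `Σ fᵢ ⊗ hᵢ ⊗ lᵢ`. -/
def ev₃ : RegularFunction G ⊗[ℂ] (RegularFunction G ⊗[ℂ] RegularFunction G) →ₗ[ℂ]
    (G × (G × G) → ℂ) :=
  evalTwo (ev G).toLinearMap ev₂

@[simp] lemma ev₂_tmul (f h : RegularFunction G) (p : G × G) :
    ev₂ (f ⊗ₜ h) p = ev G f p.1 * ev G h p.2 := rfl

@[simp] lemma ev₃_tmul (f : RegularFunction G) (t : RegularFunction G ⊗[ℂ] RegularFunction G)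
    (p : G × (G × G)) : ev₃ (f ⊗ₜ t) p = ev G f p.1 * ev₂ t p.2 := rfl

lemma ev₂_injective : Function.Injective (ev₂ (G := G)) :=
  evalTwo_injective ev_injective ev_injective

lemma ev₃_injective : Function.Injective (ev₃ (G := G)) :=
  evalTwo_injective ev_injective ev₂_injective

/-- Precomposition with the multiplication of `G`. -/
def mulPull : (G → ℂ) →ₗ[ℂ] (G × G → ℂ) where
  toFun f p := f (p.1 * p.2)
  map_add' _ _ := rfl
  map_smul' _ _ := rfl

lemma mulPull_mem_range (f : RegularFunction G) :
    (mulPull ∘ₗ (ev G).toLinearMap) f ∈ LinearMap.range (ev₂ (G := G)) := by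
  have h : Submodule.span ℂ (matrixCoefficients G) ≤
      (LinearMap.range (ev₂ (G := G))).comap mulPull := by
    refine Submodule.span_le.mpr ?_
    rintro _ ⟨ι, _, _, ρ, i, j, hρ, rfl⟩
    refine ⟨∑ l, coeff ρ hρ i l ⊗ₜ coeff ρ hρ l j, ?_⟩
    ext p
    simp [Matrix.mul_apply, mulPull]
  exact h (ev_mem f)

/-- The coproduct: the unique `Δ f` with `(Δ f)(x, y) = f(x y)`. -/
def comul : RegularFunction G →ₗ[ℂ] RegularFunction G ⊗[ℂ] RegularFunction G :=
  (LinearEquiv.ofInjective ev₂ ev₂_injective).symm.toLinearMap ∘ₗ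
    (mulPull ∘ₗ (ev G).toLinearMap).codRestrict (LinearMap.range ev₂) mulPull_mem_range

@[simp] lemma ev₂_comul (f : RegularFunction G) (p : G × G) :
    ev₂ (comul f) p = ev G f (p.1 * p.2) :=
  congrFun (LinearEquiv.ofInjective_symm_apply (f := ev₂) (h := ev₂_injective)
    ((mulPull ∘ₗ (ev G).toLinearMap).codRestrict (LinearMap.range ev₂) mulPull_mem_range f)) p

/-- The counit: evaluation at `1`. -/
def counit : RegularFunction G →ₗ[ℂ] ℂ := LinearMap.proj 1 ∘ₗ (ev G).toLinearMap

@[simp] lemma counit_apply (f : RegularFunction G) : counit f = ev G f 1 := rfl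

lemma ev₃_assoc (t : RegularFunction G ⊗[ℂ] RegularFunction G) (h : RegularFunction G)
    (x y z : G) : ev₃ (TensorProduct.assoc ℂ _ _ _ (t ⊗ₜ h)) (x, (y, z)) =
      ev₂ t (x, y) * ev G h z := by
  induction t with
  | zero => simp only [TensorProduct.zero_tmul, map_zero, Pi.zero_apply, zero_mul]
  | add _ _ h₁ h₂ => simp only [TensorProduct.add_tmul, map_add, Pi.add_apply, h₁, h₂, add_mul]
  | tmul a b => simp [mul_assoc]

lemma ev₃_comul_left (t : RegularFunction G ⊗[ℂ] RegularFunction G) (x y z : G) :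
    ev₃ (TensorProduct.assoc ℂ _ _ _ (comul.rTensor _ t)) (x, (y, z)) = ev₂ t (x * y, z) := by
  induction t with
  | zero => simp only [map_zero, Pi.zero_apply]
  | add _ _ h₁ h₂ => simp only [map_add, Pi.add_apply, h₁, h₂]
  | tmul a b => rw [LinearMap.rTensor_tmul, ev₃_assoc, ev₂_comul, ev₂_tmul]

lemma ev₃_comul_right (t : RegularFunction G ⊗[ℂ] RegularFunction G) (x y z : G) :
    ev₃ (comul.lTensor _ t) (x, (y, z)) = ev₂ t (x, y * z) := by
  induction t with
  | zero => simp only [map_zero, Pi.zero_apply]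
  | add _ _ h₁ h₂ => simp only [map_add, Pi.add_apply, h₁, h₂]
  | tmul a b => rw [LinearMap.lTensor_tmul, ev₃_tmul, ev₂_comul, ev₂_tmul]

lemma ev_counit_left (t : RegularFunction G ⊗[ℂ] RegularFunction G) (x : G) :
    ev G (TensorProduct.lid ℂ _ (counit.rTensor _ t)) x = ev₂ t (1, x) := by
  induction t with
  | zero => simp only [map_zero, Pi.zero_apply]
  | add _ _ h₁ h₂ => simp only [map_add, Pi.add_apply, h₁, h₂]
  | tmul a b => simp

lemma ev_counit_right (t : RegularFunction G ⊗[ℂ] RegularFunction G) (x : G) :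
    ev G (TensorProduct.rid ℂ _ (counit.lTensor _ t)) x = ev₂ t (x, 1) := by
  induction t with
  | zero => simp only [map_zero, Pi.zero_apply]
  | add _ _ h₁ h₂ => simp only [map_add, Pi.add_apply, h₁, h₂]
  | tmul a b => simp [mul_comm]

instance : Coalgebra ℂ (RegularFunction G) where
  comul := comul
  counit := counit
  coassoc := by
    apply LinearMap.ext
    intro f
    apply ev₃_injective
    ext ⟨x, y, z⟩
    simp only [LinearMap.comp_apply, LinearEquiv.coe_coe, ev₃_comul_left, ev₃_comul_right,
      ev₂_comul, mul_assoc]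
  rTensor_counit_comp_comul := by
    apply LinearMap.ext
    intro f
    apply (TensorProduct.lid ℂ _).injective
    apply ev_injective
    ext x
    simp [ev_counit_left]
  lTensor_counit_comp_comul := by
    apply LinearMap.ext
    intro f
    apply (TensorProduct.rid ℂ _).injective
    apply ev_injective
    ext x
    simp [ev_counit_right]

lemma ev₂_mul (s t : RegularFunction G ⊗[ℂ] RegularFunction G) :
    ev₂ (s * t) = ev₂ s * ev₂ t := by
  induction s with
  | zero => simp only [zero_mul, map_zero]
  | add _ _ h₁ h₂ => simp only [map_add, add_mul, h₁, h₂]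
  | tmul a b =>
  induction t with
  | zero => simp only [mul_zero, map_zero]
  | add _ _ h₁ h₂ => simp only [map_add, mul_add, h₁, h₂]
  | tmul c d =>
    ext p
    simp [mul_mul_mul_comm]

lemma comul_one : comul (1 : RegularFunction G) = 1 := by
  apply ev₂_injective
  ext p
  simp [Algebra.TensorProduct.one_def]

lemma comul_mul (a b : RegularFunction G) : comul (a * b) = comul a * comul b := by
  apply ev₂_injective
  ext p
  simp [ev₂_mul]

instance : Bialgebra ℂ (RegularFunction G) :=
  Bialgebra.mk' ℂ (RegularFunction G) rfl rfl comul_one (comul_mul _ _)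

section Antipode

variable [IsTopologicalGroup G]

lemma comp_inv_mem (f : RegularFunction G) : (fun g ↦ ev G f g⁻¹) ∈ regularFunctions G := by
  have h : Submodule.span ℂ (matrixCoefficients G) ≤
      (Submodule.span ℂ (matrixCoefficients G)).comap (LinearMap.funLeft ℂ ℂ (·⁻¹ : G → G)) := by
    refine Submodule.span_le.mpr ?_
    rintro _ ⟨ι, _, _, ρ, i, j, hρ, rfl⟩
    refine Submodule.subset_span ⟨ι, inferInstance, inferInstance,
      { toFun := fun g ↦ (ρ g⁻¹).transpose
        map_one' := by simp
        map_mul' := fun g h ↦ by simp [Matrix.transpose_mul] }, j, i, ?_, rfl⟩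
    exact (hρ.comp continuous_inv).matrix_transpose
  exact h (ev_mem f)

/-- The antipode: `(S f)(g) = f(g⁻¹)`. -/
def antipode : RegularFunction G →ₗ[ℂ] RegularFunction G where
  toFun f := (⟨fun g ↦ ev G f g⁻¹, comp_inv_mem f⟩ : regularFunctions G)
  map_add' _ _ := rfl
  map_smul' _ _ := rfl

@[simp] lemma ev_antipode (f : RegularFunction G) (x : G) :
    ev G (antipode f) x = ev G f x⁻¹ := rfl

lemma ev_antipode_left (t : RegularFunction G ⊗[ℂ] RegularFunction G) (x : G) :
    ev G (LinearMap.mul' ℂ _ (antipode.rTensor _ t)) x = ev₂ t (x⁻¹, x) := by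
  induction t with
  | zero => simp only [map_zero, Pi.zero_apply]
  | add _ _ h₁ h₂ => simp only [map_add, Pi.add_apply, h₁, h₂]
  | tmul a b => simp

lemma ev_antipode_right (t : RegularFunction G ⊗[ℂ] RegularFunction G) (x : G) :
    ev G (LinearMap.mul' ℂ _ (antipode.lTensor _ t)) x = ev₂ t (x, x⁻¹) := by
  induction t with
  | zero => simp only [map_zero, Pi.zero_apply]
  | add _ _ h₁ h₂ => simp only [map_add, Pi.add_apply, h₁, h₂]
  | tmul a b => simp

/-- The Hopf algebra of regular functions of a topological group. -/
instance : HopfAlgebra ℂ (RegularFunction G) where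
  antipode := antipode
  mul_antipode_rTensor_comul := by
    apply LinearMap.ext
    intro f
    apply ev_injective
    ext x
    refine (ev_antipode_left _ x).trans ((ev₂_comul f _).trans ?_)
    rw [inv_mul_cancel]
    exact (congrFun ((ev G).commutes (counit f)) x).symm
  mul_antipode_lTensor_comul := by
    apply LinearMap.ext
    intro f
    apply ev_injective
    ext x
    refine (ev_antipode_right _ x).trans ((ev₂_comul f _).trans ?_)
    rw [mul_inv_cancel]
    exact (congrFun ((ev G).commutes (counit f)) x).symm

end Antipode

end RegularFunction

end RegularFunctions


/-! ### Smooth Lie groups -/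

/-- A smooth Lie group is regular enough for its tangent space at `1` to be a Lie algebra. -/
instance instLEInftyMinSmoothness : ENat.LEInfty (minSmoothness ℝ 3) where
  out := by
    rw [minSmoothness_of_isRCLikeNormedField]
    exact ENat.LEInfty.out

end

/-!
Let `S` be the antipode of `A`. Every `m` in a bicovariant bimodule `E` is
`m₍₋₂₎ (S(m₍₋₁₎) m₍₀₎)`, and the elements `S(m₍₋₁₎) m₍₀₎` are left-invariant; likewise `E`
is generated by its right-invariant elements as a right module (`isGeneratedByInvariants`).
Hence the elements `ω ⊗_A η`, with `ω` left-invariant and `η` right-invariant, generate the bimodule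
`E ⊗_A E`, and a braiding is unique (`IsGeneratedByInvariants.braiding_unique`). It exists because
`m ⊗ n ↦ m₍₋₂₎ (n₍₀₎ S(n₍₁₎)) ⊗_A (S(m₍₋₁₎) m₍₀₎) n₍₂₎` is balanced over `A`
(`crossSq_balanced`).

For the deformation by `γ`, no antipode of `A_γ` is needed. The coactions of `E_γ` are those of `E`,
so the invariant elements are the same, and they still generate
(`IsGeneratedByInvariants.deform`). The 2-cocycle identity makes
`m ⊗ n ↦ γ(m₍₋₁₎ ⊗ n₍₋₁₎) m₍₀₎ ⊗ n₍₀₎ γ⁻¹(m₍₁₎ ⊗ n₍₁₎)` an isomorphism from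
`E_γ ⊗_{A_γ} E_γ` to `E ⊗_A E` which turns the actions of `A_γ` into the deformed actions on
`E ⊗_A E` (`untwistSqEquiv`). The braiding `σ` of `E` commutes with both coactions
(`IsBraiding.covers`), hence with the deformed actions, and `γ` is normalised, hence the isomorphism
fixes `ω ⊗ η` and `η ⊗ ω`. So the conjugate of `σ` is the braiding of `E_γ` (`IsBraiding.deform`),
and it squares to the identity if `σ` does.

For the one-forms of a commutative Hopf algebra the left and the right action agree, so the flip of
`E ⊗_A E` is well defined. It is the braiding (`isBraiding_oneFormsFlip`), and its square is the
identity. Thus the second claim is an instance of the first; a Lie group enters only as a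
topological group, which gives its algebra of regular functions an antipode.
-/

noncomputable section

/-! ### Convolution operators on tensor products of bicomodules -/

namespace Bicomodule

section Expansion

variable {k C D N P : Type*} [Field k]
  [AddCommMonoid C] [Module k C] [Coalgebra k C] [AddCommMonoid D] [Module k D] [Coalgebra k D]
  [AddCommMonoid N] [Module k N] [AddCommMonoid P] [Module k P]

lemma Covers.of_comp_surjective {C' N' : Type*} [AddCommMonoid C'] [Module k C'] [Coalgebra k C']
    [AddCommMonoid N'] [Module k N']
    {M : Bicomodule k C N} {M' : Bicomodule k C' N'} {R : Bicomodule k D P}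
    {q₀ : C →ₗ[k] C'} {q : N →ₗ[k] N'} {g₀ : C' →ₗ[k] D} {g : N' →ₗ[k] P}
    (hq : Covers M M' q₀ q) (hs : Function.Surjective q)
    (h : Covers M R (g₀ ∘ₗ q₀) (g ∘ₗ q)) : Covers M' R g₀ g where
  left n := by
    obtain ⟨n, rfl⟩ := hs n
    rw [hq.left, ← LinearMap.comp_apply (TensorProduct.map g₀ g), ← TensorProduct.map_comp]
    exact h.left n
  right n := by
    obtain ⟨n, rfl⟩ := hs n
    rw [hq.right, ← LinearMap.comp_apply (TensorProduct.map g g₀), ← TensorProduct.map_comp]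
    exact h.right n

variable (M : Bicomodule k C N) (R : Bicomodule k D P)

/-- With `n₍₋₁₎ ⊗ n₍₀₎ = Σ cᵢ ⊗ nᵢ`, the operator `hitL Γ` sends `n ⊗ p` to
`Σ nᵢ ⊗ hitL (Γ(cᵢ ⊗ -)) p`. -/
lemma exists_hitL_tmul_eq_left (n : N) : ∃ s : Multiset (C × N),
    ∀ (Γ : WithConv (C ⊗[k] D →ₗ[k] k)) (p : P), (M.tensor R).hitL Γ (n ⊗ₜ p) =
      (s.map fun i ↦ i.2 ⊗ₜ[k] R.hitL (pull Γ (TensorProduct.mk k C D i.1)) p).sum := by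
  obtain ⟨s, hs⟩ := TensorProduct.exists_multiset (M.lcoact n)
  refine ⟨s, fun Γ p ↦ ?_⟩
  simp only [hitL, tensor, LinearMap.comp_apply, TensorProduct.map_tmul, LinearEquiv.coe_coe, hs]
  clear hs
  induction s using Multiset.induction with
  | empty => simp
  | cons i s ih =>
    simp only [Multiset.map_cons, Multiset.sum_cons, TensorProduct.add_tmul, map_add, ih]
    congr 1
    induction R.lcoact p with
    | zero => simp
    | add _ _ h₁ h₂ => simp only [TensorProduct.tmul_add, map_add, h₁, h₂]
    | tmul d p' => simp [pull]

/-- With `p₍₋₁₎ ⊗ p₍₀₎ = Σ dᵢ ⊗ pᵢ`, the operator `hitL Γ` sends `n ⊗ p` to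
`Σ hitL (Γ(- ⊗ dᵢ)) n ⊗ pᵢ`. -/
lemma exists_hitL_tmul_eq_right (p : P) : ∃ s : Multiset (D × P),
    ∀ (Γ : WithConv (C ⊗[k] D →ₗ[k] k)) (n : N), (M.tensor R).hitL Γ (n ⊗ₜ p) =
      (s.map fun i ↦ M.hitL (pull Γ ((TensorProduct.mk k C D).flip i.1)) n ⊗ₜ[k] i.2).sum := by
  obtain ⟨s, hs⟩ := TensorProduct.exists_multiset (R.lcoact p)
  refine ⟨s, fun Γ n ↦ ?_⟩
  simp only [hitL, tensor, LinearMap.comp_apply, TensorProduct.map_tmul, LinearEquiv.coe_coe, hs]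
  clear hs
  induction s using Multiset.induction with
  | empty => simp
  | cons i s ih =>
    simp only [Multiset.map_cons, Multiset.sum_cons, TensorProduct.tmul_add, map_add, ih]
    congr 1
    induction M.lcoact n with
    | zero => simp
    | add _ _ h₁ h₂ => simp only [TensorProduct.add_tmul, map_add, h₁, h₂]
    | tmul d p' => simp [pull, TensorProduct.smul_tmul']

/-- With `n₍₀₎ ⊗ n₍₁₎ = Σ nᵢ ⊗ cᵢ`, the operator `hitR Γ` sends `n ⊗ p` to
`Σ nᵢ ⊗ hitR (Γ(cᵢ ⊗ -)) p`. -/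
lemma exists_hitR_tmul_eq_left (n : N) : ∃ s : Multiset (N × C),
    ∀ (Γ : WithConv (C ⊗[k] D →ₗ[k] k)) (p : P), (M.tensor R).hitR Γ (n ⊗ₜ p) =
      (s.map fun i ↦ i.1 ⊗ₜ[k] R.hitR (pull Γ (TensorProduct.mk k C D i.2)) p).sum := by
  obtain ⟨s, hs⟩ := TensorProduct.exists_multiset (M.rcoact n)
  refine ⟨s, fun Γ p ↦ ?_⟩
  simp only [hitR, tensor, LinearMap.comp_apply, TensorProduct.map_tmul, LinearEquiv.coe_coe, hs]
  clear hs
  induction s using Multiset.induction with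
  | empty => simp
  | cons i s ih =>
    simp only [Multiset.map_cons, Multiset.sum_cons, TensorProduct.add_tmul, map_add, ih]
    congr 1
    induction R.rcoact p with
    | zero => simp
    | add _ _ h₁ h₂ => simp only [TensorProduct.tmul_add, map_add, h₁, h₂]
    | tmul d p' => simp [pull]

/-- With `p₍₀₎ ⊗ p₍₁₎ = Σ pᵢ ⊗ dᵢ`, the operator `hitR Γ` sends `n ⊗ p` to
`Σ hitR (Γ(- ⊗ dᵢ)) n ⊗ pᵢ`. -/
lemma exists_hitR_tmul_eq_right (p : P) : ∃ s : Multiset (P × D),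
    ∀ (Γ : WithConv (C ⊗[k] D →ₗ[k] k)) (n : N), (M.tensor R).hitR Γ (n ⊗ₜ p) =
      (s.map fun i ↦ M.hitR (pull Γ ((TensorProduct.mk k C D).flip i.2)) n ⊗ₜ[k] i.1).sum := by
  obtain ⟨s, hs⟩ := TensorProduct.exists_multiset (R.rcoact p)
  refine ⟨s, fun Γ n ↦ ?_⟩
  simp only [hitR, tensor, LinearMap.comp_apply, TensorProduct.map_tmul, LinearEquiv.coe_coe, hs]
  clear hs
  induction s using Multiset.induction with
  | empty => simp
  | cons i s ih =>
    simp only [Multiset.map_cons, Multiset.sum_cons, TensorProduct.tmul_add, map_add, ih]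
    congr 1
    induction M.rcoact n with
    | zero => simp
    | add _ _ h₁ h₂ => simp only [TensorProduct.add_tmul, map_add, h₁, h₂]
    | tmul d p' => simp [pull, TensorProduct.smul_tmul']

variable {M R}

lemma hitL_tmul_of_lcoact_left {n : N} {c : C} (h : M.lcoact n = c ⊗ₜ n)
    (Γ : WithConv (C ⊗[k] D →ₗ[k] k)) (p : P) : (M.tensor R).hitL Γ (n ⊗ₜ p) =
      n ⊗ₜ R.hitL (pull Γ (TensorProduct.mk k C D c)) p := by
  simp only [hitL, tensor, LinearMap.comp_apply, TensorProduct.map_tmul, LinearEquiv.coe_coe, h]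
  induction R.lcoact p with
  | zero => simp
  | add _ _ h₁ h₂ => simp only [TensorProduct.tmul_add, map_add, h₁, h₂]
  | tmul d p' => simp [pull]

lemma hitL_tmul_of_lcoact_right {p : P} {d : D} (h : R.lcoact p = d ⊗ₜ p)
    (Γ : WithConv (C ⊗[k] D →ₗ[k] k)) (n : N) : (M.tensor R).hitL Γ (n ⊗ₜ p) =
      M.hitL (pull Γ ((TensorProduct.mk k C D).flip d)) n ⊗ₜ p := by
  simp only [hitL, tensor, LinearMap.comp_apply, TensorProduct.map_tmul, LinearEquiv.coe_coe, h]
  induction M.lcoact n with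
  | zero => simp
  | add _ _ h₁ h₂ => simp only [TensorProduct.add_tmul, map_add, h₁, h₂]
  | tmul d p' => simp [pull, TensorProduct.smul_tmul']

lemma hitR_tmul_of_rcoact_left {n : N} {c : C} (h : M.rcoact n = n ⊗ₜ c)
    (Γ : WithConv (C ⊗[k] D →ₗ[k] k)) (p : P) : (M.tensor R).hitR Γ (n ⊗ₜ p) =
      n ⊗ₜ R.hitR (pull Γ (TensorProduct.mk k C D c)) p := by
  simp only [hitR, tensor, LinearMap.comp_apply, TensorProduct.map_tmul, LinearEquiv.coe_coe, h]
  induction R.rcoact p with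
  | zero => simp
  | add _ _ h₁ h₂ => simp only [TensorProduct.tmul_add, map_add, h₁, h₂]
  | tmul d p' => simp [pull]

lemma hitR_tmul_of_rcoact_right {p : P} {d : D} (h : R.rcoact p = p ⊗ₜ d)
    (Γ : WithConv (C ⊗[k] D →ₗ[k] k)) (n : N) : (M.tensor R).hitR Γ (n ⊗ₜ p) =
      M.hitR (pull Γ ((TensorProduct.mk k C D).flip d)) n ⊗ₜ p := by
  simp only [hitR, tensor, LinearMap.comp_apply, TensorProduct.map_tmul, LinearEquiv.coe_coe, h]
  induction M.rcoact n with
  | zero => simp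
  | add _ _ h₁ h₂ => simp only [TensorProduct.add_tmul, map_add, h₁, h₂]
  | tmul d p' => simp [pull, TensorProduct.smul_tmul']

end Expansion

end Bicomodule

/-! ### The bicomodule `E ⊗_A E` -/

namespace BicovariantBimodule

open Bicomodule

section TensorSquare

variable {k A E : Type*} [Field k] [Ring A] [Bialgebra k A] [AddCommGroup E] [Module k E]
  (M : BicovariantBimodule k A E)

lemma mkQ_ract_tmul (m : E) (a : A) (n : E) :
    M.balanced.mkQ (M.ract (m ⊗ₜ a) ⊗ₜ n) = M.balanced.mkQ (m ⊗ₜ M.lact (a ⊗ₜ n)) :=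
  (Submodule.Quotient.eq _).2 (Submodule.subset_span ⟨m, n, a, rfl⟩)

lemma tmul_ract_left (m : E) (a : A) (n : E) :
    M.tmul (M.ract (m ⊗ₜ a)) n = M.tmul m (M.lact (a ⊗ₜ n)) :=
  M.mkQ_ract_tmul m a n

/-- The balancing relation, as an identity of maps on `(E ⊗ A) ⊗ E`. -/
lemma mkQ_comp_map_ract :
    M.balanced.mkQ ∘ₗ TensorProduct.map M.ract .id =
      M.balanced.mkQ ∘ₗ TensorProduct.map .id M.lact ∘ₗ
        (TensorProduct.assoc k E A E).toLinearMap :=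
  TensorProduct.ext_threefold fun m a n ↦ M.mkQ_ract_tmul m a n

lemma mul'_comp_map_mul' :
    LinearMap.mul' k A ∘ₗ TensorProduct.map (LinearMap.mul' k A) .id =
      LinearMap.mul' k A ∘ₗ TensorProduct.map .id (LinearMap.mul' k A) ∘ₗ
        (TensorProduct.assoc k A A A).toLinearMap :=
  TensorProduct.ext_threefold fun a b c ↦ by simp [mul_assoc]

lemma covers_map_ract : Covers ((M.toBicomodule.tensor (self k A)).tensor M.toBicomodule)
    (M.toBicomodule.tensor M.toBicomodule) (TensorProduct.map (LinearMap.mul' k A) .id)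
    (TensorProduct.map M.ract .id) :=
  M.covers_ract.map (Covers.id _)

lemma covers_map_lact : Covers ((M.toBicomodule.tensor (self k A)).tensor M.toBicomodule)
    (M.toBicomodule.tensor M.toBicomodule)
    (TensorProduct.map .id (LinearMap.mul' k A) ∘ₗ (TensorProduct.assoc k A A A).toLinearMap)
    (TensorProduct.map .id M.lact ∘ₗ (TensorProduct.assoc k E A E).toLinearMap) :=
  ((Covers.id _).map M.covers_lact).comp (covers_assoc _ _ _)

/-- The left coaction `m ⊗_A n ↦ m₍₋₁₎ n₍₋₁₎ ⊗ (m₍₀₎ ⊗_A n₍₀₎)` on `E ⊗_A E`. -/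
def lcoactSq : M.TensorSq →ₗ[k] A ⊗[k] M.TensorSq :=
  M.balanced.liftQ (TensorProduct.map (LinearMap.mul' k A) M.balanced.mkQ ∘ₗ
    (M.toBicomodule.tensor M.toBicomodule).lcoact) <| by
    refine Submodule.span_le.mpr ?_
    rintro _ ⟨m, n, a, rfl⟩
    have h₁ := M.covers_map_ract.left ((m ⊗ₜ a) ⊗ₜ n)
    have h₂ := M.covers_map_lact.left ((m ⊗ₜ a) ⊗ₜ n)
    simp only [TensorProduct.map_tmul, LinearMap.comp_apply, LinearEquiv.coe_coe,
      TensorProduct.assoc_tmul, LinearMap.id_apply] at h₁ h₂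
    rw [SetLike.mem_coe, LinearMap.mem_ker, map_sub, sub_eq_zero, LinearMap.comp_apply,
      LinearMap.comp_apply, h₁, h₂, TensorProduct.map_map, TensorProduct.map_map,
      mul'_comp_map_mul', mkQ_comp_map_ract]

/-- The right coaction `m ⊗_A n ↦ (m₍₀₎ ⊗_A n₍₀₎) ⊗ m₍₁₎ n₍₁₎` on `E ⊗_A E`. -/
def rcoactSq : M.TensorSq →ₗ[k] M.TensorSq ⊗[k] A :=
  M.balanced.liftQ (TensorProduct.map M.balanced.mkQ (LinearMap.mul' k A) ∘ₗ
    (M.toBicomodule.tensor M.toBicomodule).rcoact) <| by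
    refine Submodule.span_le.mpr ?_
    rintro _ ⟨m, n, a, rfl⟩
    have h₁ := M.covers_map_ract.right ((m ⊗ₜ a) ⊗ₜ n)
    have h₂ := M.covers_map_lact.right ((m ⊗ₜ a) ⊗ₜ n)
    simp only [TensorProduct.map_tmul, LinearMap.comp_apply, LinearEquiv.coe_coe,
      TensorProduct.assoc_tmul, LinearMap.id_apply] at h₁ h₂
    rw [SetLike.mem_coe, LinearMap.mem_ker, map_sub, sub_eq_zero, LinearMap.comp_apply,
      LinearMap.comp_apply, h₁, h₂, TensorProduct.map_map, TensorProduct.map_map,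
      mul'_comp_map_mul', mkQ_comp_map_ract]

/-- The codiagonal bicomodule structure of `E ⊗_A E`. -/
def bicomoduleSq : Bicomodule k A M.TensorSq :=
  (M.toBicomodule.tensor M.toBicomodule).ofSurjective Cocycle.covers_mul Cocycle.counit_comp_mul'
    M.balanced.mkQ M.balanced.mkQ_surjective M.lcoactSq M.rcoactSq (fun _ ↦ rfl) (fun _ ↦ rfl)

lemma covers_mkQ : Covers (M.toBicomodule.tensor M.toBicomodule) M.bicomoduleSq
    (LinearMap.mul' k A) M.balanced.mkQ :=
  ⟨fun _ ↦ rfl, fun _ ↦ rfl⟩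

/-- The left action of `A` on `E ⊗_A E`, as a map on `A ⊗ (E ⊗_A E)`. -/
def lactSq' : A ⊗[k] M.TensorSq →ₗ[k] M.TensorSq :=
  TensorProduct.lift (LinearMap.mk₂ k (fun a t ↦ M.lactSq a t)
    (fun a b t ↦ by
      obtain ⟨t, rfl⟩ := M.balanced.mkQ_surjective t
      refine (congrArg M.balanced.mkQ ?_).trans (map_add _ _ _)
      simp only [map_add, LinearMap.comp_add, LinearMap.rTensor_add, LinearMap.add_apply])
    (fun c a t ↦ by
      obtain ⟨t, rfl⟩ := M.balanced.mkQ_surjective t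
      refine (congrArg M.balanced.mkQ ?_).trans (map_smul _ _ _)
      simp only [map_smul, LinearMap.comp_smul, LinearMap.rTensor_smul, LinearMap.smul_apply])
    (fun a s t ↦ map_add _ s t) (fun c a t ↦ map_smul _ c t))

/-- The right action of `A` on `E ⊗_A E`, as a map on `(E ⊗_A E) ⊗ A`. -/
def ractSq' : M.TensorSq ⊗[k] A →ₗ[k] M.TensorSq :=
  TensorProduct.lift (LinearMap.mk₂ k (fun t a ↦ M.ractSq a t)
    (fun s t a ↦ map_add _ s t) (fun c t a ↦ map_smul _ c t)
    (fun t a b ↦ by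
      obtain ⟨t, rfl⟩ := M.balanced.mkQ_surjective t
      refine (congrArg M.balanced.mkQ ?_).trans (map_add _ _ _)
      simp only [map_add, LinearMap.comp_add, LinearMap.lTensor_add, LinearMap.add_apply])
    (fun c t a ↦ by
      obtain ⟨t, rfl⟩ := M.balanced.mkQ_surjective t
      refine (congrArg M.balanced.mkQ ?_).trans (map_smul _ _ _)
      simp only [map_smul, LinearMap.comp_smul, LinearMap.lTensor_smul, LinearMap.smul_apply]))

@[simp] lemma lactSq'_tmul (a : A) (t : M.TensorSq) : M.lactSq' (a ⊗ₜ t) = M.lactSq a t := rfl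

@[simp] lemma ractSq'_tmul (a : A) (t : M.TensorSq) : M.ractSq' (t ⊗ₜ a) = M.ractSq a t := rfl

@[simp] lemma lactSq_tmul (a : A) (m n : E) :
    M.lactSq a (M.tmul m n) = M.tmul (M.lact (a ⊗ₜ m)) n := rfl

@[simp] lemma ractSq_tmul (a : A) (m n : E) :
    M.ractSq a (M.tmul m n) = M.tmul m (M.ract (n ⊗ₜ a)) := rfl

lemma covers_lactSq' : Covers ((self k A).tensor M.bicomoduleSq) M.bicomoduleSq
    (LinearMap.mul' k A) M.lactSq' := by
  have h := M.covers_mkQ.comp (M.covers_lact.map (Covers.id M.toBicomodule))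
  have e : M.balanced.mkQ ∘ₗ TensorProduct.map M.lact .id = M.lactSq' ∘ₗ
      TensorProduct.map .id M.balanced.mkQ ∘ₗ (TensorProduct.assoc k A E E).toLinearMap :=
    TensorProduct.ext_threefold fun a m n ↦ rfl
  rw [mul'_comp_map_mul', e] at h
  have hq := ((Covers.id (self k A)).map M.covers_mkQ).comp
    (covers_assoc (self k A) M.toBicomodule M.toBicomodule)
  refine hq.of_comp_surjective ?_ h
  rw [LinearMap.coe_comp]
  exact (TensorProduct.map_surjective Function.surjective_id M.balanced.mkQ_surjective).comp
    (LinearEquiv.surjective _)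

lemma covers_ractSq' : Covers (M.bicomoduleSq.tensor (self k A)) M.bicomoduleSq
    (LinearMap.mul' k A) M.ractSq' := by
  have h := M.covers_mkQ.comp (((Covers.id M.toBicomodule).map M.covers_ract).comp
    (covers_assoc M.toBicomodule M.toBicomodule (self k A)))
  have e : M.balanced.mkQ ∘ₗ TensorProduct.map .id M.ract ∘ₗ
      (TensorProduct.assoc k E E A).toLinearMap =
        M.ractSq' ∘ₗ TensorProduct.map M.balanced.mkQ .id :=
    TensorProduct.ext_threefold fun a m n ↦ rfl
  rw [← mul'_comp_map_mul', e] at h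
  have hq := M.covers_mkQ.map (Covers.id (self k A))
  exact hq.of_comp_surjective
    (TensorProduct.map_surjective M.balanced.mkQ_surjective Function.surjective_id) h

end TensorSquare

end BicovariantBimodule

/-! ### Invariant elements generate -/

namespace BicovariantBimodule

open Bicomodule

section Invariants

variable {k A E : Type*} [Field k] [Ring A] [Bialgebra k A] [AddCommGroup E] [Module k E]
  (M : BicovariantBimodule k A E)

variable {M}

lemma IsLeftInvariant.hitL_eq {ω : E} (h : M.IsLeftInvariant ω) (φ : WithConv (A →ₗ[k] k)) :
    M.hitL φ ω = φ.ofConv 1 • ω := by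
  have h' : M.lcoact ω = 1 ⊗ₜ ω := h
  simp [hitL, h']

lemma IsRightInvariant.hitR_eq {η : E} (h : M.IsRightInvariant η) (φ : WithConv (A →ₗ[k] k)) :
    M.hitR φ η = φ.ofConv 1 • η := by
  have h' : M.rcoact η = η ⊗ₜ 1 := h
  simp [hitR, h']

lemma IsLeftInvariant.smul {ω : E} (h : M.IsLeftInvariant ω) (c : k) :
    M.IsLeftInvariant (c • ω) := by
  have h' : M.lcoact ω = 1 ⊗ₜ ω := h
  simp [IsLeftInvariant, h']

lemma IsRightInvariant.smul {η : E} (h : M.IsRightInvariant η) (c : k) :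
    M.IsRightInvariant (c • η) := by
  have h' : M.rcoact η = η ⊗ₜ 1 := h
  simp [IsRightInvariant, h', TensorProduct.smul_tmul']

lemma IsLeftInvariant.hitL {ω : E} (h : M.IsLeftInvariant ω) (φ : WithConv (A →ₗ[k] k)) :
    M.IsLeftInvariant (M.hitL φ ω) := by
  rw [h.hitL_eq]
  exact h.smul _

lemma IsRightInvariant.hitR {η : E} (h : M.IsRightInvariant η) (φ : WithConv (A →ₗ[k] k)) :
    M.IsRightInvariant (M.hitR φ η) := by
  rw [h.hitR_eq]
  exact h.smul _

/-- The right coaction preserves left invariance, because the two coactions commute. -/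
lemma IsLeftInvariant.hitR {ω : E} (h : M.IsLeftInvariant ω) (φ : WithConv (A →ₗ[k] k)) :
    M.IsLeftInvariant (M.hitR φ ω) := by
  apply eq_of_lid_rTensor
  intro ψ
  refine (LinearMap.congr_fun (M.hitL_comp_hitR (.toConv ψ) φ) ω).trans ?_
  rw [LinearMap.comp_apply, h.hitL_eq]
  simp

/-- The left coaction preserves right invariance, because the two coactions commute. -/
lemma IsRightInvariant.hitL {η : E} (h : M.IsRightInvariant η) (φ : WithConv (A →ₗ[k] k)) :
    M.IsRightInvariant (M.hitL φ η) := by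
  apply eq_of_rid_lTensor
  intro ψ
  refine (LinearMap.congr_fun (M.hitL_comp_hitR φ (.toConv ψ)) η).symm.trans ?_
  rw [LinearMap.comp_apply, h.hitR_eq]
  simp

variable (M)

/-- The subspace `A ⊗ U` of `A ⊗ E`, where `U` is the space of left-invariant elements. -/
def leftInvariantSpan : Submodule k (A ⊗[k] E) :=
  Submodule.span k {x | ∃ (a : A) (ω : E), M.IsLeftInvariant ω ∧ x = a ⊗ₜ ω}

/-- The subspace `V ⊗ A` of `E ⊗ A`, where `V` is the space of right-invariant elements. -/
def rightInvariantSpan : Submodule k (E ⊗[k] A) :=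
  Submodule.span k {x | ∃ (η : E) (a : A), M.IsRightInvariant η ∧ x = η ⊗ₜ a}

/-- `E` is generated by its left-invariant elements as a left module, and by its right-invariant
elements as a right module. -/
structure IsGeneratedByInvariants : Prop where
  left : ∀ m, ∃ x ∈ M.leftInvariantSpan, M.lact x = m
  right : ∀ m, ∃ x ∈ M.rightInvariantSpan, M.ract x = m

variable {M}

lemma hitL_mem_leftInvariantSpan (Γ : WithConv (A ⊗[k] A →ₗ[k] k)) {x : A ⊗[k] E}
    (hx : x ∈ M.leftInvariantSpan) :
    ((self k A).tensor M.toBicomodule).hitL Γ x ∈ M.leftInvariantSpan := by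
  refine (Submodule.span_le (p := M.leftInvariantSpan.comap _)).mpr ?_ hx
  rintro _ ⟨a, ω, hω, rfl⟩
  obtain ⟨s, hs⟩ := exists_hitL_tmul_eq_left (self k A) M.toBicomodule a
  rw [SetLike.mem_coe, Submodule.mem_comap, hs]
  refine multiset_sum_mem _ fun y hy ↦ ?_
  obtain ⟨i, -, rfl⟩ := Multiset.mem_map.mp hy
  exact Submodule.subset_span ⟨_, _, hω.hitL _, rfl⟩

lemma hitR_mem_leftInvariantSpan (Γ : WithConv (A ⊗[k] A →ₗ[k] k)) {x : A ⊗[k] E}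
    (hx : x ∈ M.leftInvariantSpan) :
    ((self k A).tensor M.toBicomodule).hitR Γ x ∈ M.leftInvariantSpan := by
  refine (Submodule.span_le (p := M.leftInvariantSpan.comap _)).mpr ?_ hx
  rintro _ ⟨a, ω, hω, rfl⟩
  obtain ⟨s, hs⟩ := exists_hitR_tmul_eq_left (self k A) M.toBicomodule a
  rw [SetLike.mem_coe, Submodule.mem_comap, hs]
  refine multiset_sum_mem _ fun y hy ↦ ?_
  obtain ⟨i, -, rfl⟩ := Multiset.mem_map.mp hy
  exact Submodule.subset_span ⟨_, _, hω.hitR _, rfl⟩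

lemma hitL_mem_rightInvariantSpan (Γ : WithConv (A ⊗[k] A →ₗ[k] k)) {x : E ⊗[k] A}
    (hx : x ∈ M.rightInvariantSpan) :
    (M.toBicomodule.tensor (self k A)).hitL Γ x ∈ M.rightInvariantSpan := by
  refine (Submodule.span_le (p := M.rightInvariantSpan.comap _)).mpr ?_ hx
  rintro _ ⟨η, a, hη, rfl⟩
  obtain ⟨s, hs⟩ := exists_hitL_tmul_eq_right M.toBicomodule (self k A) a
  rw [SetLike.mem_coe, Submodule.mem_comap, hs]
  refine multiset_sum_mem _ fun y hy ↦ ?_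
  obtain ⟨i, -, rfl⟩ := Multiset.mem_map.mp hy
  exact Submodule.subset_span ⟨_, _, hη.hitL _, rfl⟩

lemma hitR_mem_rightInvariantSpan (Γ : WithConv (A ⊗[k] A →ₗ[k] k)) {x : E ⊗[k] A}
    (hx : x ∈ M.rightInvariantSpan) :
    (M.toBicomodule.tensor (self k A)).hitR Γ x ∈ M.rightInvariantSpan := by
  refine (Submodule.span_le (p := M.rightInvariantSpan.comap _)).mpr ?_ hx
  rintro _ ⟨η, a, hη, rfl⟩
  obtain ⟨s, hs⟩ := exists_hitR_tmul_eq_right M.toBicomodule (self k A) a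
  rw [SetLike.mem_coe, Submodule.mem_comap, hs]
  refine multiset_sum_mem _ fun y hy ↦ ?_
  obtain ⟨i, -, rfl⟩ := Multiset.mem_map.mp hy
  exact Submodule.subset_span ⟨_, _, hη.hitR _, rfl⟩

variable (M)

lemma isLeftInvariant_deform (γ : Cocycle k A) {ω : E} :
    (M.deform γ).IsLeftInvariant ω ↔ M.IsLeftInvariant ω := by
  have h : Function.Injective (TensorProduct.map γ.toTwist.toLinearMap (.id : E →ₗ[k] E)) :=
    (TensorProduct.congr γ.toTwist (.refl k E)).injective
  exact h.eq_iff (a := M.lcoact ω) (b := 1 ⊗ₜ ω)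

lemma isRightInvariant_deform (γ : Cocycle k A) {η : E} :
    (M.deform γ).IsRightInvariant η ↔ M.IsRightInvariant η := by
  have h : Function.Injective (TensorProduct.map (.id : E →ₗ[k] E) γ.toTwist.toLinearMap) :=
    (TensorProduct.congr (.refl k E) γ.toTwist).injective
  exact h.eq_iff (a := M.rcoact η) (b := η ⊗ₜ 1)

lemma deform_lact_map (γ : Cocycle k A) (x : A ⊗[k] E) :
    (M.deform γ).lact (TensorProduct.map γ.toTwist.toLinearMap .id x) = M.twistLact γ x := by
  induction x with
  | zero => simp only [map_zero]
  | add _ _ h₁ h₂ => simp only [map_add, h₁, h₂]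
  | tmul a m => rfl

lemma deform_ract_map (γ : Cocycle k A) (x : E ⊗[k] A) :
    (M.deform γ).ract (TensorProduct.map .id γ.toTwist.toLinearMap x) = M.twistRact γ x := by
  induction x with
  | zero => simp only [map_zero]
  | add _ _ h₁ h₂ => simp only [map_add, h₁, h₂]
  | tmul a m => rfl

lemma map_mem_leftInvariantSpan_deform (γ : Cocycle k A) {x : A ⊗[k] E}
    (hx : x ∈ M.leftInvariantSpan) :
    TensorProduct.map γ.toTwist.toLinearMap .id x ∈ (M.deform γ).leftInvariantSpan := by
  refine (Submodule.span_le (p := (M.deform γ).leftInvariantSpan.comap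
    (TensorProduct.map γ.toTwist.toLinearMap .id))).mpr ?_ hx
  rintro _ ⟨a, ω, hω, rfl⟩
  exact Submodule.subset_span ⟨γ.toTwist a, ω, (M.isLeftInvariant_deform γ).mpr hω,
    TensorProduct.map_tmul _ _ _ _⟩

lemma map_mem_rightInvariantSpan_deform (γ : Cocycle k A) {x : E ⊗[k] A}
    (hx : x ∈ M.rightInvariantSpan) :
    TensorProduct.map .id γ.toTwist.toLinearMap x ∈ (M.deform γ).rightInvariantSpan := by
  refine (Submodule.span_le (p := (M.deform γ).rightInvariantSpan.comap
    (TensorProduct.map .id γ.toTwist.toLinearMap))).mpr ?_ hx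
  rintro _ ⟨η, a, hη, rfl⟩
  exact Submodule.subset_span ⟨η, γ.toTwist a, (M.isRightInvariant_deform γ).mpr hη,
    TensorProduct.map_tmul _ _ _ _⟩

lemma sandwich_twistLact (γ : Cocycle k A) :
    ((self k A).tensor M.toBicomodule).sandwich γ.inv (M.twistLact γ) γ.val = M.lact := by
  rw [twistLact, sandwich_sandwich, γ.inv_mul_val, sandwich_one]

lemma sandwich_twistRact (γ : Cocycle k A) :
    (M.toBicomodule.tensor (self k A)).sandwich γ.inv (M.twistRact γ) γ.val = M.ract := by
  rw [twistRact, sandwich_sandwich, γ.inv_mul_val, sandwich_one]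

variable {M}

/-- The undeformed action is obtained from the deformed one by operators that preserve
`A ⊗ U` and `V ⊗ A`. -/
lemma IsGeneratedByInvariants.deform (h : M.IsGeneratedByInvariants) (γ : Cocycle k A) :
    (M.deform γ).IsGeneratedByInvariants where
  left m := by
    obtain ⟨x, hx, rfl⟩ := h.left m
    refine ⟨TensorProduct.map γ.toTwist.toLinearMap .id
      (((self k A).tensor M.toBicomodule).hitL γ.inv
        (((self k A).tensor M.toBicomodule).hitR γ.val x)), ?_, ?_⟩
    · exact M.map_mem_leftInvariantSpan_deform γ
        (hitL_mem_leftInvariantSpan _ (hitR_mem_leftInvariantSpan _ hx))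
    · rw [deform_lact_map, ← M.sandwich_twistLact γ]
      rfl
  right m := by
    obtain ⟨x, hx, rfl⟩ := h.right m
    refine ⟨TensorProduct.map .id γ.toTwist.toLinearMap
      ((M.toBicomodule.tensor (self k A)).hitL γ.inv
        ((M.toBicomodule.tensor (self k A)).hitR γ.val x)), ?_, ?_⟩
    · exact M.map_mem_rightInvariantSpan_deform γ
        (hitL_mem_rightInvariantSpan _ (hitR_mem_rightInvariantSpan _ hx))
    · rw [deform_ract_map, ← M.sandwich_twistRact γ]
      rfl

/-- `E ⊗_A E` is generated as a bimodule by the `ω ⊗_A η` with `ω` left-invariant and `η`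
right-invariant. -/
lemma IsGeneratedByInvariants.eq_top (h : M.IsGeneratedByInvariants) {S : Submodule k M.TensorSq}
    (hl : ∀ a, ∀ t ∈ S, M.lactSq a t ∈ S) (hr : ∀ a, ∀ t ∈ S, M.ractSq a t ∈ S)
    (hS : ∀ ω η, M.IsLeftInvariant ω → M.IsRightInvariant η → M.tmul ω η ∈ S) : S = ⊤ := by
  have h₁ : ∀ m n, M.tmul m n ∈ S := by
    intro m n
    obtain ⟨x, hx, rfl⟩ := h.left m
    obtain ⟨y, hy, rfl⟩ := h.right n
    refine (Submodule.span_le (p := S.comap (M.balanced.mkQ ∘ₗ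
      (TensorProduct.mk k E E).flip (M.ract y) ∘ₗ M.lact))).mpr ?_ hx
    rintro _ ⟨a, ω, hω, rfl⟩
    refine (Submodule.span_le (p := S.comap (M.balanced.mkQ ∘ₗ
      TensorProduct.mk k E E (M.lact (a ⊗ₜ ω)) ∘ₗ M.ract))).mpr ?_ hy
    rintro _ ⟨η, b, hη, rfl⟩
    exact hl a _ (hr b _ (hS ω η hω hη))
  rw [eq_top_iff]
  rintro t -
  obtain ⟨t, rfl⟩ := M.balanced.mkQ_surjective t
  induction t with
  | zero => simp
  | add _ _ h₁ h₂ => rw [map_add]; exact add_mem h₁ h₂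
  | tmul m n => exact h₁ m n

lemma IsGeneratedByInvariants.braiding_unique (h : M.IsGeneratedByInvariants)
    {σ τ : M.TensorSq →ₗ[k] M.TensorSq} (hσ : M.IsBraiding σ) (hτ : M.IsBraiding τ) : σ = τ := by
  rw [← LinearMap.eqLocus_eq_top]
  refine h.eq_top (fun a t ht ↦ ?_) (fun a t ht ↦ ?_) (fun ω η hω hη ↦ ?_)
  · rw [LinearMap.mem_eqLocus] at ht ⊢
    rw [hσ.map_lactSq, hτ.map_lactSq, ht]
  · rw [LinearMap.mem_eqLocus] at ht ⊢
    rw [hσ.map_ractSq, hτ.map_ractSq, ht]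
  · rw [LinearMap.mem_eqLocus, hσ.map_tmul ω η hω hη, hτ.map_tmul ω η hω hη]

/-- For left-invariant `ω`, the left coaction of `ω ⊗_A n` is that of `n`. -/
lemma hitL_tmul_of_left {ω : E} (hω : M.IsLeftInvariant ω) (φ : WithConv (A →ₗ[k] k)) (n : E) :
    M.bicomoduleSq.hitL φ (M.tmul ω n) = M.tmul ω (M.hitL φ n) := by
  refine (LinearMap.congr_fun (M.covers_mkQ.hitL φ) (ω ⊗ₜ n)).trans ?_
  rw [LinearMap.comp_apply, hitL_tmul_of_lcoact_left hω]
  congr 4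
  apply WithConv.ofConv_injective
  ext a
  simp [pull]

lemma hitL_tmul_of_right {ω : E} (hω : M.IsLeftInvariant ω) (φ : WithConv (A →ₗ[k] k)) (n : E) :
    M.bicomoduleSq.hitL φ (M.tmul n ω) = M.tmul (M.hitL φ n) ω := by
  refine (LinearMap.congr_fun (M.covers_mkQ.hitL φ) (n ⊗ₜ ω)).trans ?_
  rw [LinearMap.comp_apply, hitL_tmul_of_lcoact_right hω]
  congr 4
  apply WithConv.ofConv_injective
  ext a
  simp [pull]

/-- For right-invariant `η`, the right coaction of `η ⊗_A n` is that of `n`. -/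
lemma hitR_tmul_of_left {η : E} (hη : M.IsRightInvariant η) (φ : WithConv (A →ₗ[k] k)) (n : E) :
    M.bicomoduleSq.hitR φ (M.tmul η n) = M.tmul η (M.hitR φ n) := by
  refine (LinearMap.congr_fun (M.covers_mkQ.hitR φ) (η ⊗ₜ n)).trans ?_
  rw [LinearMap.comp_apply, hitR_tmul_of_rcoact_left hη]
  congr 4
  apply WithConv.ofConv_injective
  ext a
  simp [pull]

lemma hitR_tmul_of_right {η : E} (hη : M.IsRightInvariant η) (φ : WithConv (A →ₗ[k] k)) (n : E) :
    M.bicomoduleSq.hitR φ (M.tmul n η) = M.tmul (M.hitR φ n) η := by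
  refine (LinearMap.congr_fun (M.covers_mkQ.hitR φ) (n ⊗ₜ η)).trans ?_
  rw [LinearMap.comp_apply, hitR_tmul_of_rcoact_right hη]
  congr 4
  apply WithConv.ofConv_injective
  ext a
  simp [pull]

/-- The `t` on which `σ` commutes with all operators `hitL φ` form a sub-bimodule. It contains the
generators `ω ⊗_A η`: the left coaction of both `ω ⊗_A η` and `η ⊗_A ω` is that of `η`, and it
keeps `η` right-invariant. -/
lemma IsBraiding.comp_hitL (h : M.IsGeneratedByInvariants) {σ : M.TensorSq →ₗ[k] M.TensorSq}
    (hσ : M.IsBraiding σ) (φ : WithConv (A →ₗ[k] k)) :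
    M.bicomoduleSq.hitL φ ∘ₗ σ = σ ∘ₗ M.bicomoduleSq.hitL φ := by
  have key : (⨅ φ, LinearMap.eqLocus (M.bicomoduleSq.hitL φ ∘ₗ σ)
      (σ ∘ₗ M.bicomoduleSq.hitL φ)) = ⊤ := by
    refine h.eq_top (fun a t ht ↦ ?_) (fun a t ht ↦ ?_) (fun ω η hω hη ↦ ?_)
    all_goals
      simp only [Submodule.mem_iInf, LinearMap.mem_eqLocus, LinearMap.comp_apply] at *
      intro φ
    · obtain ⟨s, hs⟩ := exists_hitL_tmul_eq_left (self k A) M.bicomoduleSq a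
      have e := fun t ↦ LinearMap.congr_fun (M.covers_lactSq'.hitL φ) (a ⊗ₜ t)
      simp only [LinearMap.comp_apply, lactSq'_tmul, hs, map_multiset_sum, Multiset.map_map,
        Function.comp_def] at e
      simp only [hσ.map_lactSq, e, ht, map_multiset_sum, Multiset.map_map, Function.comp_def]
    · obtain ⟨s, hs⟩ := exists_hitL_tmul_eq_right M.bicomoduleSq (self k A) a
      have e := fun t ↦ LinearMap.congr_fun (M.covers_ractSq'.hitL φ) (t ⊗ₜ a)
      simp only [LinearMap.comp_apply, ractSq'_tmul, hs, map_multiset_sum, Multiset.map_map,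
        Function.comp_def] at e
      simp only [hσ.map_ractSq, e, ht, map_multiset_sum, Multiset.map_map, Function.comp_def]
    · rw [hσ.map_tmul ω η hω hη, hitL_tmul_of_right hω, hitL_tmul_of_left hω,
        hσ.map_tmul _ _ hω (hη.hitL φ)]
  exact LinearMap.eqLocus_eq_top.mp (eq_top_iff.mpr (key ▸ iInf_le _ φ))

/-- The counterpart of `IsBraiding.comp_hitL`, where the right coaction acts on `ω` alone. -/
lemma IsBraiding.comp_hitR (h : M.IsGeneratedByInvariants) {σ : M.TensorSq →ₗ[k] M.TensorSq}
    (hσ : M.IsBraiding σ) (φ : WithConv (A →ₗ[k] k)) :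
    M.bicomoduleSq.hitR φ ∘ₗ σ = σ ∘ₗ M.bicomoduleSq.hitR φ := by
  have key : (⨅ φ, LinearMap.eqLocus (M.bicomoduleSq.hitR φ ∘ₗ σ)
      (σ ∘ₗ M.bicomoduleSq.hitR φ)) = ⊤ := by
    refine h.eq_top (fun a t ht ↦ ?_) (fun a t ht ↦ ?_) (fun ω η hω hη ↦ ?_)
    all_goals
      simp only [Submodule.mem_iInf, LinearMap.mem_eqLocus, LinearMap.comp_apply] at *
      intro φ
    · obtain ⟨s, hs⟩ := exists_hitR_tmul_eq_left (self k A) M.bicomoduleSq a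
      have e := fun t ↦ LinearMap.congr_fun (M.covers_lactSq'.hitR φ) (a ⊗ₜ t)
      simp only [LinearMap.comp_apply, lactSq'_tmul, hs, map_multiset_sum, Multiset.map_map,
        Function.comp_def] at e
      simp only [hσ.map_lactSq, e, ht, map_multiset_sum, Multiset.map_map, Function.comp_def]
    · obtain ⟨s, hs⟩ := exists_hitR_tmul_eq_right M.bicomoduleSq (self k A) a
      have e := fun t ↦ LinearMap.congr_fun (M.covers_ractSq'.hitR φ) (t ⊗ₜ a)
      simp only [LinearMap.comp_apply, ractSq'_tmul, hs, map_multiset_sum, Multiset.map_map,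
        Function.comp_def] at e
      simp only [hσ.map_ractSq, e, ht, map_multiset_sum, Multiset.map_map, Function.comp_def]
    · rw [hσ.map_tmul ω η hω hη, hitR_tmul_of_left hη, hitR_tmul_of_right hη,
        hσ.map_tmul _ _ (hω.hitR φ) hη]
  exact LinearMap.eqLocus_eq_top.mp (eq_top_iff.mpr (key ▸ iInf_le _ φ))

lemma pull_id {C : Type*} [AddCommMonoid C] [Module k C] [Coalgebra k C]
    (φ : WithConv (C →ₗ[k] k)) : pull φ .id = φ := rfl

/-- A Woronowicz braiding commutes with the coactions. -/
lemma IsBraiding.covers (h : M.IsGeneratedByInvariants) {σ : M.TensorSq →ₗ[k] M.TensorSq}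
    (hσ : M.IsBraiding σ) : Covers M.bicomoduleSq M.bicomoduleSq .id σ :=
  .of_hit (hσ.comp_hitL h) (hσ.comp_hitR h)

end Invariants

end BicovariantBimodule

/-! ### Transport of braidings along a cocycle -/

open Bicomodule in
/-- The converse of `Cocycle.sandwich_assoc`: an associativity law of maps for the actions deformed
by `γ` gives one for the original actions, once the outer maps are deformed by `γ⁻¹`. -/
lemma Cocycle.sandwich_inv_assoc {k A : Type*} [Field k] [Ring A] [Bialgebra k A]
    (γ : Cocycle k A) {N₁ N₂ N₃ N₁₂ N₂₃ N : Type*}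
    [AddCommMonoid N₁] [Module k N₁] [AddCommMonoid N₂] [Module k N₂]
    [AddCommMonoid N₃] [Module k N₃] [AddCommMonoid N₁₂] [Module k N₁₂]
    [AddCommMonoid N₂₃] [Module k N₂₃] [AddCommMonoid N] [Module k N]
    {M₁ : Bicomodule k A N₁} {M₂ : Bicomodule k A N₂} {M₃ : Bicomodule k A N₃}
    {M₁₂ : Bicomodule k A N₁₂} {M₂₃ : Bicomodule k A N₂₃}
    {f : N₁ ⊗[k] N₂ →ₗ[k] N₁₂} {g : N₁₂ ⊗[k] N₃ →ₗ[k] N}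
    {f' : N₂ ⊗[k] N₃ →ₗ[k] N₂₃} {g' : N₁ ⊗[k] N₂₃ →ₗ[k] N}
    (hf : Covers (M₁.tensor M₂) M₁₂ (LinearMap.mul' k A) f)
    (hf' : Covers (M₂.tensor M₃) M₂₃ (LinearMap.mul' k A) f')
    (h : ∀ x y z, g ((M₁.tensor M₂).sandwich γ.val f γ.inv (x ⊗ₜ y) ⊗ₜ z) =
      g' (x ⊗ₜ (M₂.tensor M₃).sandwich γ.val f' γ.inv (y ⊗ₜ z))) (x : N₁) (y : N₂) (z : N₃) :
    (M₁₂.tensor M₃).sandwich γ.inv g γ.val (f (x ⊗ₜ y) ⊗ₜ z) =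
      (M₁.tensor M₂₃).sandwich γ.inv g' γ.val (x ⊗ₜ f' (y ⊗ₜ z)) := by
  have u₁ : (M₁.tensor M₂).sandwich γ.inv ((M₁.tensor M₂).sandwich γ.val f γ.inv) γ.val = f := by
    rw [sandwich_sandwich, γ.inv_mul_val, sandwich_one]
  have u₂ : (M₂.tensor M₃).sandwich γ.inv ((M₂.tensor M₃).sandwich γ.val f' γ.inv) γ.val = f' := by
    rw [sandwich_sandwich, γ.inv_mul_val, sandwich_one]
  have e₁ := (hf.map (Covers.id M₃)).sandwich_comp γ.inv γ.val g
  have e₂ := ((Covers.id M₁).map hf').sandwich_comp γ.inv γ.val g'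
  have v₁ := map_sandwich (M₁.tensor M₂) M₃ γ.inv γ.val 1 1
    ((M₁.tensor M₂).sandwich γ.val f γ.inv) (.id : N₃ →ₗ[k] N₃)
  have v₂ := map_sandwich M₁ (M₂.tensor M₃) 1 1 γ.inv γ.val (.id : N₁ →ₗ[k] N₁)
    ((M₂.tensor M₃).sandwich γ.val f' γ.inv)
  rw [u₁, sandwich_one] at v₁
  rw [u₂, sandwich_one] at v₂
  have e₃ : g ∘ₗ TensorProduct.map ((M₁.tensor M₂).sandwich γ.val f γ.inv) .id =
      (g' ∘ₗ TensorProduct.map .id ((M₂.tensor M₃).sandwich γ.val f' γ.inv)) ∘ₗ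
        (TensorProduct.assoc k N₁ N₂ N₃).toLinearMap := by
    apply TensorProduct.ext_threefold
    intro x y z
    simpa using h x y z
  have w₁ : g ∘ₗ TensorProduct.map f .id = ((M₁.tensor M₂).tensor M₃).sandwich (box γ.inv 1)
      (g ∘ₗ TensorProduct.map ((M₁.tensor M₂).sandwich γ.val f γ.inv) .id) (box γ.val 1) := by
    rw [v₁, comp_sandwich]
  have w₂ : g' ∘ₗ TensorProduct.map .id f' = (M₁.tensor (M₂.tensor M₃)).sandwich (box 1 γ.inv)
      (g' ∘ₗ TensorProduct.map .id ((M₂.tensor M₃).sandwich γ.val f' γ.inv)) (box 1 γ.val) := by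
    rw [v₂, comp_sandwich]
  rw [w₁, sandwich_sandwich, mul_box_inv, box_val_mul, e₃,
    ← (covers_assoc M₁ M₂ M₃).sandwich_comp] at e₁
  rw [w₂, sandwich_sandwich] at e₂
  rw [← e₂] at e₁
  simpa using LinearMap.congr_fun e₁ ((x ⊗ₜ y) ⊗ₜ z)

namespace BicovariantBimodule

open Bicomodule

section Transport

variable {k A E : Type*} [Field k] [Ring A] [Bialgebra k A] [AddCommGroup E] [Module k E]
  (M : BicovariantBimodule k A E) (γ : Cocycle k A)

/-- The map `E_γ ⊗_{A_γ} E_γ → E ⊗_A E`,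
`m ⊗ n ↦ γ(m₍₋₁₎ ⊗ n₍₋₁₎) m₍₀₎ ⊗ n₍₀₎ γ⁻¹(m₍₁₎ ⊗ n₍₁₎)`. -/
def untwistSq : (M.deform γ).TensorSq →ₗ[k] M.TensorSq :=
  (M.deform γ).balanced.liftQ
    ((M.toBicomodule.tensor M.toBicomodule).sandwich γ.val M.balanced.mkQ γ.inv) <| by
    refine Submodule.span_le.mpr ?_
    rintro _ ⟨m, n, a, rfl⟩
    rw [SetLike.mem_coe, LinearMap.mem_ker, map_sub, sub_eq_zero]
    exact γ.sandwich_assoc (M₂ := self k A) M.covers_ract M.covers_lact M.mkQ_ract_tmul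
      m (γ.toTwist.symm a) n

/-- The map `E ⊗_A E → E_γ ⊗_{A_γ} E_γ`,
`m ⊗ n ↦ γ⁻¹(m₍₋₁₎ ⊗ n₍₋₁₎) m₍₀₎ ⊗ n₍₀₎ γ(m₍₁₎ ⊗ n₍₁₎)`. -/
def twistSq : M.TensorSq →ₗ[k] (M.deform γ).TensorSq :=
  M.balanced.liftQ
    ((M.toBicomodule.tensor M.toBicomodule).sandwich γ.inv (M.deform γ).balanced.mkQ γ.val) <| by
    refine Submodule.span_le.mpr ?_
    rintro _ ⟨m, n, a, rfl⟩
    rw [SetLike.mem_coe, LinearMap.mem_ker, map_sub, sub_eq_zero]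
    exact γ.sandwich_inv_assoc (M₂ := self k A) M.covers_ract M.covers_lact
      (fun m a n ↦ (M.deform γ).mkQ_ract_tmul m (γ.toTwist a) n) m a n

lemma untwistSq_comp_mkQ : M.untwistSq γ ∘ₗ (M.deform γ).balanced.mkQ =
    (M.toBicomodule.tensor M.toBicomodule).sandwich γ.val M.balanced.mkQ γ.inv :=
  Submodule.liftQ_mkQ _ _ _

lemma twistSq_comp_mkQ : M.twistSq γ ∘ₗ M.balanced.mkQ =
    (M.toBicomodule.tensor M.toBicomodule).sandwich γ.inv (M.deform γ).balanced.mkQ γ.val :=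
  Submodule.liftQ_mkQ _ _ _

lemma untwistSq_comp_twistSq : M.untwistSq γ ∘ₗ M.twistSq γ = .id := by
  apply Submodule.linearMap_qext
  rw [LinearMap.comp_assoc, twistSq_comp_mkQ, comp_sandwich, untwistSq_comp_mkQ,
    sandwich_sandwich, γ.inv_mul_val, sandwich_one, LinearMap.id_comp]

lemma twistSq_comp_untwistSq : M.twistSq γ ∘ₗ M.untwistSq γ = .id := by
  apply Submodule.linearMap_qext
  rw [LinearMap.comp_assoc, untwistSq_comp_mkQ, comp_sandwich, twistSq_comp_mkQ,
    sandwich_sandwich, γ.val_mul_inv, sandwich_one, LinearMap.id_comp]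

/-- The isomorphism `E_γ ⊗_{A_γ} E_γ ≃ E ⊗_A E`. -/
def untwistSqEquiv : (M.deform γ).TensorSq ≃ₗ[k] M.TensorSq :=
  .ofLinearMap (M.untwistSq γ) (M.twistSq γ) (M.untwistSq_comp_twistSq γ)
    (M.twistSq_comp_untwistSq γ)

/-- `untwistSq` turns the left action of `A_γ` into the deformed left action on `E ⊗_A E`. -/
lemma untwistSq_lactSq (a : γ.Twist) (t : (M.deform γ).TensorSq) :
    M.untwistSq γ ((M.deform γ).lactSq a t) =
      ((self k A).tensor M.bicomoduleSq).sandwich γ.val M.lactSq' γ.inv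
        (γ.toTwist.symm a ⊗ₜ M.untwistSq γ t) := by
  obtain ⟨t, rfl⟩ := (M.deform γ).balanced.mkQ_surjective t
  induction t with
  | zero => simp only [map_zero, TensorProduct.tmul_zero]
  | add _ _ h₁ h₂ => simp only [map_add, TensorProduct.tmul_add, h₁, h₂]
  | tmul m n =>
    exact γ.sandwich_assoc (M₁ := self k A) (g := M.balanced.mkQ) (g' := M.lactSq') M.covers_lact
      M.covers_mkQ (fun _ _ _ ↦ rfl) (γ.toTwist.symm a) m n

/-- `untwistSq` turns the right action of `A_γ` into the deformed right action on `E ⊗_A E`. -/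
lemma untwistSq_ractSq (a : γ.Twist) (t : (M.deform γ).TensorSq) :
    M.untwistSq γ ((M.deform γ).ractSq a t) =
      (M.bicomoduleSq.tensor (self k A)).sandwich γ.val M.ractSq' γ.inv
        (M.untwistSq γ t ⊗ₜ γ.toTwist.symm a) := by
  obtain ⟨t, rfl⟩ := (M.deform γ).balanced.mkQ_surjective t
  induction t with
  | zero => simp only [map_zero, TensorProduct.zero_tmul]
  | add _ _ h₁ h₂ => simp only [map_add, TensorProduct.add_tmul, h₁, h₂]
  | tmul m n =>
    exact (γ.sandwich_assoc (M₃ := self k A) (g := M.ractSq') (g' := M.balanced.mkQ) M.covers_mkQ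
      M.covers_ract (fun _ _ _ ↦ rfl) m n (γ.toTwist.symm a)).symm

variable {M}

/-- A braiding, commuting with the coactions, is linear for the deformed left action. -/
lemma sandwich_lactSq_comm {σ : M.TensorSq →ₗ[k] M.TensorSq}
    (hc : Covers M.bicomoduleSq M.bicomoduleSq .id σ) (hσ : M.IsBraiding σ) (a : A)
    (t : M.TensorSq) :
    σ (((self k A).tensor M.bicomoduleSq).sandwich γ.val M.lactSq' γ.inv (a ⊗ₜ t)) =
      ((self k A).tensor M.bicomoduleSq).sandwich γ.val M.lactSq' γ.inv (a ⊗ₜ σ t) := by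
  have e := ((Covers.id (self k A)).map hc).sandwich_comp γ.val γ.inv M.lactSq'
  have e' : M.lactSq' ∘ₗ TensorProduct.map .id σ = σ ∘ₗ M.lactSq' :=
    TensorProduct.ext' fun a t ↦ (hσ.map_lactSq a t).symm
  rw [TensorProduct.map_id, pull_id, pull_id, e', ← comp_sandwich] at e
  exact (LinearMap.congr_fun e (a ⊗ₜ t)).symm

/-- A braiding, commuting with the coactions, is linear for the deformed right action. -/
lemma sandwich_ractSq_comm {σ : M.TensorSq →ₗ[k] M.TensorSq}
    (hc : Covers M.bicomoduleSq M.bicomoduleSq .id σ) (hσ : M.IsBraiding σ) (a : A)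
    (t : M.TensorSq) :
    σ ((M.bicomoduleSq.tensor (self k A)).sandwich γ.val M.ractSq' γ.inv (t ⊗ₜ a)) =
      (M.bicomoduleSq.tensor (self k A)).sandwich γ.val M.ractSq' γ.inv (σ t ⊗ₜ a) := by
  have e := (hc.map (Covers.id (self k A))).sandwich_comp γ.val γ.inv M.ractSq'
  have e' : M.ractSq' ∘ₗ TensorProduct.map σ .id = σ ∘ₗ M.ractSq' :=
    TensorProduct.ext' fun t a ↦ (hσ.map_ractSq a t).symm
  rw [TensorProduct.map_id, pull_id, pull_id, e', ← comp_sandwich] at e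
  exact (LinearMap.congr_fun e (t ⊗ₜ a)).symm

lemma pull_val_mk_one : pull γ.val (TensorProduct.mk k A A 1) = 1 := by
  apply WithConv.ofConv_injective
  ext a
  exact γ.val_one_tmul a

lemma pull_val_mk_flip_one : pull γ.val ((TensorProduct.mk k A A).flip 1) = 1 := by
  apply WithConv.ofConv_injective
  ext a
  exact γ.val_tmul_one a

lemma pull_inv_mk_one : pull γ.inv (TensorProduct.mk k A A 1) = 1 :=
  γ.pull_inv_eq_one (Cocycle.covers_tmul_right (self k A)) (pull_val_mk_one γ) (by ext; simp)

lemma pull_inv_mk_flip_one : pull γ.inv ((TensorProduct.mk k A A).flip 1) = 1 :=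
  γ.pull_inv_eq_one (Cocycle.covers_tmul_left (self k A)) (pull_val_mk_flip_one γ) (by ext; simp)

/-- Since `γ` is normalised, the deformation does not affect `ω ⊗ η` for left-invariant `ω` and
right-invariant `η`. -/
lemma untwistSq_tmul {ω η : E} (hω : M.IsLeftInvariant ω) (hη : M.IsRightInvariant η) :
    M.untwistSq γ ((M.deform γ).tmul ω η) = M.tmul ω η := by
  refine (LinearMap.congr_fun (M.untwistSq_comp_mkQ γ) (ω ⊗ₜ η)).trans ?_
  rw [sandwich, LinearMap.comp_apply, LinearMap.comp_apply, hitR_tmul_of_rcoact_right hη,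
    pull_inv_mk_flip_one, hitR_one, LinearMap.id_apply, hitL_tmul_of_lcoact_left hω,
    pull_val_mk_one, hitL_one, LinearMap.id_apply]
  rfl

/-- The deformation does not affect `η ⊗ ω` either. -/
lemma untwistSq_tmul_swap {ω η : E} (hω : M.IsLeftInvariant ω) (hη : M.IsRightInvariant η) :
    M.untwistSq γ ((M.deform γ).tmul η ω) = M.tmul η ω := by
  refine (LinearMap.congr_fun (M.untwistSq_comp_mkQ γ) (η ⊗ₜ ω)).trans ?_
  rw [sandwich, LinearMap.comp_apply, LinearMap.comp_apply, hitR_tmul_of_rcoact_left hη,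
    pull_inv_mk_one, hitR_one, LinearMap.id_apply, hitL_tmul_of_lcoact_right hω,
    pull_val_mk_flip_one, hitL_one, LinearMap.id_apply]
  rfl

/-- The Woronowicz braiding of `E_γ` is conjugate to that of `E`. -/
lemma IsBraiding.deform (h : M.IsGeneratedByInvariants) {σ : M.TensorSq →ₗ[k] M.TensorSq}
    (hσ : M.IsBraiding σ) :
    (M.deform γ).IsBraiding ((M.untwistSqEquiv γ).symm.conj σ) where
  map_lactSq a t := by
    rw [LinearEquiv.conj_apply_apply, LinearEquiv.conj_apply_apply, LinearEquiv.symm_symm,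
      LinearEquiv.symm_apply_eq]
    refine Eq.trans ?_ (M.untwistSq_lactSq γ a _).symm
    refine (congrArg σ (M.untwistSq_lactSq γ a t)).trans ?_
    rw [sandwich_lactSq_comm γ (hσ.covers h) hσ]
    exact congrArg (fun s ↦ ((self k A).tensor M.bicomoduleSq).sandwich γ.val M.lactSq' γ.inv
      (γ.toTwist.symm a ⊗ₜ s)) ((M.untwistSqEquiv γ).apply_symm_apply _).symm
  map_ractSq a t := by
    rw [LinearEquiv.conj_apply_apply, LinearEquiv.conj_apply_apply, LinearEquiv.symm_symm,
      LinearEquiv.symm_apply_eq]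
    refine Eq.trans ?_ (M.untwistSq_ractSq γ a _).symm
    refine (congrArg σ (M.untwistSq_ractSq γ a t)).trans ?_
    rw [sandwich_ractSq_comm γ (hσ.covers h) hσ]
    exact congrArg (fun s ↦ (M.bicomoduleSq.tensor (self k A)).sandwich γ.val M.ractSq' γ.inv
      (s ⊗ₜ γ.toTwist.symm a)) ((M.untwistSqEquiv γ).apply_symm_apply _).symm
  map_tmul ω η hω hη := by
    rw [isLeftInvariant_deform] at hω
    rw [isRightInvariant_deform] at hη
    rw [LinearEquiv.conj_apply_apply, LinearEquiv.symm_symm, LinearEquiv.symm_apply_eq]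
    refine (congrArg σ (untwistSq_tmul γ hω hη)).trans ?_
    rw [hσ.map_tmul ω η hω hη]
    exact (untwistSq_tmul_swap γ hω hη).symm

end Transport

end BicovariantBimodule

/-! ### Hopf modules are generated by their invariants -/

namespace HopfAlgebra

open WithConv

variable {k A B : Type*} [Field k] [Ring A] [HopfAlgebra k A] [Ring B] [Algebra k B]

lemma algHom_comp_antipode_mul (f : A →ₐ[k] B) :
    toConv (f.toLinearMap ∘ₗ antipode k) * toConv f.toLinearMap = 1 := by
  have h := LinearMap.algHom_comp_convMul_distrib f (toConv (antipode k (A := A)))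
    (toConv LinearMap.id)
  rw [LinearMap.antipode_mul_id] at h
  apply ofConv_injective
  refine h.symm.trans ?_
  ext a
  simp

lemma algHom_mul_comp_antipode (f : A →ₐ[k] B) :
    toConv f.toLinearMap * toConv (f.toLinearMap ∘ₗ antipode k) = 1 := by
  have h := LinearMap.algHom_comp_convMul_distrib f (toConv LinearMap.id)
    (toConv (antipode k (A := A)))
  rw [LinearMap.id_mul_antipode] at h
  apply ofConv_injective
  refine h.symm.trans ?_
  ext a
  simp

/-- The comultiplication is the convolution product of the two inclusions of `A` in `A ⊗ A`. -/
lemma includeLeft_convMul_includeRight :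
    toConv (Algebra.TensorProduct.includeLeft : A →ₐ[k] A ⊗[k] A).toLinearMap *
      toConv (Algebra.TensorProduct.includeRight : A →ₐ[k] A ⊗[k] A).toLinearMap =
        toConv (Bialgebra.comulAlgHom k A).toLinearMap := by
  apply ofConv_injective
  ext a
  simp only [LinearMap.convMul_apply, AlgHom.toLinearMap_apply, Bialgebra.comulAlgHom_apply]
  induction Coalgebra.comul (R := k) a with
  | zero => simp only [map_zero]
  | add _ _ h₁ h₂ => simp only [map_add, h₁, h₂]
  | tmul x y => simp

/-- `Δ(S(a₍₁₎)) (a₍₂₎ ⊗ 1) = 1 ⊗ S(a)`: in the convolution algebra of maps `A → A ⊗ A`, both sides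
are inverse to `a ↦ 1 ⊗ a`. -/
lemma comul_antipode_mul_includeLeft (a : A) :
    LinearMap.mul' k (A ⊗[k] A) (TensorProduct.map (Coalgebra.comul ∘ₗ antipode k)
      (Algebra.TensorProduct.includeLeft : A →ₐ[k] A ⊗[k] A).toLinearMap (Coalgebra.comul a)) =
        1 ⊗ₜ antipode k a := by
  have h := algHom_comp_antipode_mul (Bialgebra.comulAlgHom k A)
  rw [← includeLeft_convMul_includeRight, ← mul_assoc] at h
  have h' := left_inv_eq_right_inv h (algHom_mul_comp_antipode _)
  exact LinearMap.congr_fun (congrArg ofConv h') a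

/-- `(1 ⊗ a₍₁₎) Δ(S(a₍₂₎)) = S(a) ⊗ 1`: in the convolution algebra of maps `A → A ⊗ A`, both sides
are inverse to `a ↦ a ⊗ 1`. -/
lemma includeRight_mul_comul_antipode (a : A) :
    LinearMap.mul' k (A ⊗[k] A) (TensorProduct.map
      (Algebra.TensorProduct.includeRight : A →ₐ[k] A ⊗[k] A).toLinearMap
      (Coalgebra.comul ∘ₗ antipode k) (Coalgebra.comul a)) = antipode k a ⊗ₜ 1 := by
  have h := algHom_mul_comp_antipode (Bialgebra.comulAlgHom k A)
  rw [← includeLeft_convMul_includeRight, mul_assoc] at h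
  have h' := left_inv_eq_right_inv (algHom_comp_antipode_mul _) h
  exact LinearMap.congr_fun (congrArg ofConv h') a |>.symm

end HopfAlgebra

namespace BicovariantBimodule

open Bicomodule HopfAlgebra

section Hopf

variable {k A E Z : Type*} [Field k] [Ring A] [HopfAlgebra k A] [AddCommGroup E] [Module k E]
  [AddCommGroup Z] [Module k Z] (M : BicovariantBimodule k A E)

/-- A computation with `m₍₋₂₎ ⊗ m₍₋₁₎ ⊗ m₍₀₎` may be done on `a₍₁₎ ⊗ a₍₂₎ ⊗ n`, where `a ⊗ n` stands
for `m₍₋₁₎ ⊗ m₍₀₎`. -/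
lemma apply_lTensor_lcoact {F : A ⊗[k] (A ⊗[k] E) →ₗ[k] Z} {G : A ⊗[k] E →ₗ[k] Z}
    (h : ∀ a m, F (TensorProduct.assoc k A A E (Coalgebra.comul a ⊗ₜ m)) = G (a ⊗ₜ m)) (m : E) :
    F (M.lcoact.lTensor A (M.lcoact m)) = G (M.lcoact m) := by
  rw [← M.lcoassoc]
  induction M.lcoact m with
  | zero => simp only [map_zero]
  | add _ _ h₁ h₂ => simp only [map_add, h₁, h₂]
  | tmul a m => exact h a m

/-- A computation with `m₍₀₎ ⊗ m₍₁₎ ⊗ m₍₂₎` may be done on `n ⊗ a₍₁₎ ⊗ a₍₂₎`, where `n ⊗ a` stands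
for `m₍₀₎ ⊗ m₍₁₎`. -/
lemma apply_rTensor_rcoact {F : (E ⊗[k] A) ⊗[k] A →ₗ[k] Z} {G : E ⊗[k] A →ₗ[k] Z}
    (h : ∀ m a, F ((TensorProduct.assoc k E A A).symm (m ⊗ₜ Coalgebra.comul a)) = G (m ⊗ₜ a))
    (m : E) : F (M.rcoact.rTensor A (M.rcoact m)) = G (M.rcoact m) := by
  rw [← (TensorProduct.assoc k E A A).symm_apply_apply (M.rcoact.rTensor A _), M.rcoassoc]
  induction M.rcoact m with
  | zero => simp only [map_zero]
  | add _ _ h₁ h₂ => simp only [map_add, h₁, h₂]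
  | tmul m a => exact h m a

lemma lact_algebraMap (c : k) (m : E) : M.lact (algebraMap k A c ⊗ₜ m) = c • m := by
  rw [Algebra.algebraMap_eq_smul_one, ← TensorProduct.smul_tmul', map_smul, M.one_lact]

lemma ract_algebraMap (c : k) (m : E) : M.ract (m ⊗ₜ algebraMap k A c) = c • m := by
  rw [Algebra.algebraMap_eq_smul_one, TensorProduct.tmul_smul, map_smul, M.ract_one]

/-- The projection `m ↦ S(m₍₋₁₎) m₍₀₎` onto the left-invariant elements. -/
def leftProj : E →ₗ[k] E := M.lact ∘ₗ (antipode k).rTensor E ∘ₗ M.lcoact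

/-- The projection `m ↦ m₍₀₎ S(m₍₁₎)` onto the right-invariant elements. -/
def rightProj : E →ₗ[k] E := M.ract ∘ₗ (antipode k).lTensor E ∘ₗ M.rcoact

lemma leftProj_apply (m : E) : M.leftProj m = M.lact ((antipode k).rTensor E (M.lcoact m)) := rfl

lemma rightProj_apply (m : E) : M.rightProj m = M.ract ((antipode k).lTensor E (M.rcoact m)) := rfl

variable {M} in
lemma IsLeftInvariant.leftProj_eq {ω : E} (h : M.IsLeftInvariant ω) : M.leftProj ω = ω := by
  have h' : M.lcoact ω = 1 ⊗ₜ ω := h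
  rw [leftProj_apply, h', LinearMap.rTensor_tmul, antipode_one, M.one_lact]

variable {M} in
lemma IsRightInvariant.rightProj_eq {η : E} (h : M.IsRightInvariant η) : M.rightProj η = η := by
  have h' : M.rcoact η = η ⊗ₜ 1 := h
  rw [rightProj_apply, h', LinearMap.lTensor_tmul, antipode_one, M.ract_one]

lemma isLeftInvariant_leftProj (m : E) : M.IsLeftInvariant (M.leftProj m) := by
  -- `D` is the action `a ⊗ x ↦ Δ(a) x` of `A` on `A ⊗ E`.
  let D : A ⊗[k] (A ⊗[k] E) →ₗ[k] A ⊗[k] E := TensorProduct.map (LinearMap.mul' k A) M.lact ∘ₗ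
    (TensorProduct.tensorTensorTensorComm k A A A E).toLinearMap ∘ₗ Coalgebra.comul.rTensor _
  have h₁ : ∀ y, M.lcoact (M.lact y) = D (M.lcoact.lTensor A y) := by
    intro y
    induction y with
    | zero => simp only [map_zero]
    | add _ _ h₁ h₂ => simp only [map_add, h₁, h₂]
    | tmul a m => exact M.lcoact_lact a m
  have h₂ : ∀ y, M.lcoact.lTensor A ((antipode k).rTensor E y) =
      (antipode k).rTensor (A ⊗[k] E) (M.lcoact.lTensor A y) := by
    intro y
    induction y with
    | zero => simp only [map_zero]
    | add _ _ h₁ h₂ => simp only [map_add, h₁, h₂]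
    | tmul a m => simp
  have h₃ : ∀ m (z : A ⊗[k] A) (v : A), TensorProduct.map (LinearMap.mul' k A) M.lact
      (TensorProduct.tensorTensorTensorComm k A A A E (z ⊗ₜ (v ⊗ₜ m))) =
        (M.lact ∘ₗ (TensorProduct.mk k A E).flip m).lTensor A (z * (v ⊗ₜ 1)) := by
    intro m z v
    induction z with
    | zero => simp only [map_zero, TensorProduct.zero_tmul, zero_mul]
    | add _ _ h₁ h₂ => simp only [map_add, TensorProduct.add_tmul, add_mul, h₁, h₂]
    | tmul x y => simp
  have h₄ : ∀ m (t : A ⊗[k] A),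
      D ((antipode k).rTensor _ (TensorProduct.assoc k A A E (t ⊗ₜ m))) =
        (M.lact ∘ₗ (TensorProduct.mk k A E).flip m).lTensor A
          (LinearMap.mul' k (A ⊗[k] A) (TensorProduct.map (Coalgebra.comul ∘ₗ antipode k)
            (Algebra.TensorProduct.includeLeft : A →ₐ[k] A ⊗[k] A).toLinearMap t)) := by
    intro m t
    induction t with
    | zero => simp only [map_zero, TensorProduct.zero_tmul]
    | add _ _ h₁ h₂ => simp only [map_add, TensorProduct.add_tmul, h₁, h₂]
    | tmul u v => exact h₃ m _ v
  rw [IsLeftInvariant, leftProj_apply, h₁, h₂]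
  refine M.apply_lTensor_lcoact (F := D ∘ₗ (antipode k).rTensor _)
    (G := TensorProduct.mk k A E 1 ∘ₗ M.lact ∘ₗ (antipode k).rTensor E) (fun a m ↦ ?_) m
  rw [LinearMap.comp_apply, h₄, comul_antipode_mul_includeLeft]
  rfl

lemma isRightInvariant_rightProj (m : E) : M.IsRightInvariant (M.rightProj m) := by
  -- `D` is the action `x ⊗ a ↦ x Δ(a)` of `A` on `E ⊗ A`.
  let D : (E ⊗[k] A) ⊗[k] A →ₗ[k] E ⊗[k] A := TensorProduct.map M.ract (LinearMap.mul' k A) ∘ₗ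
    (TensorProduct.tensorTensorTensorComm k E A A A).toLinearMap ∘ₗ Coalgebra.comul.lTensor _
  have h₁ : ∀ y, M.rcoact (M.ract y) = D (M.rcoact.rTensor A y) := by
    intro y
    induction y with
    | zero => simp only [map_zero]
    | add _ _ h₁ h₂ => simp only [map_add, h₁, h₂]
    | tmul m a => exact M.rcoact_ract m a
  have h₂ : ∀ y, M.rcoact.rTensor A ((antipode k).lTensor E y) =
      (antipode k).lTensor (E ⊗[k] A) (M.rcoact.rTensor A y) := by
    intro y
    induction y with
    | zero => simp only [map_zero]
    | add _ _ h₁ h₂ => simp only [map_add, h₁, h₂]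
    | tmul a m => simp
  have h₃ : ∀ m (z : A ⊗[k] A) (v : A), TensorProduct.map M.ract (LinearMap.mul' k A)
      (TensorProduct.tensorTensorTensorComm k E A A A ((m ⊗ₜ v) ⊗ₜ z)) =
        (M.ract ∘ₗ TensorProduct.mk k E A m).rTensor A ((1 ⊗ₜ v) * z) := by
    intro m z v
    induction z with
    | zero => simp only [map_zero, TensorProduct.tmul_zero, mul_zero]
    | add _ _ h₁ h₂ => simp only [map_add, TensorProduct.tmul_add, mul_add, h₁, h₂]
    | tmul x y => simp
  have h₄ : ∀ m (t : A ⊗[k] A),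
      D ((antipode k).lTensor _ ((TensorProduct.assoc k E A A).symm (m ⊗ₜ t))) =
        (M.ract ∘ₗ TensorProduct.mk k E A m).rTensor A
          (LinearMap.mul' k (A ⊗[k] A) (TensorProduct.map
            (Algebra.TensorProduct.includeRight : A →ₐ[k] A ⊗[k] A).toLinearMap
            (Coalgebra.comul ∘ₗ antipode k) t)) := by
    intro m t
    induction t with
    | zero => simp only [map_zero, TensorProduct.tmul_zero]
    | add _ _ h₁ h₂ => simp only [map_add, TensorProduct.tmul_add, h₁, h₂]
    | tmul u v => exact h₃ m _ u
  rw [IsRightInvariant, rightProj_apply, h₁, h₂]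
  refine M.apply_rTensor_rcoact (F := D ∘ₗ (antipode k).lTensor _)
    (G := (TensorProduct.mk k E A).flip 1 ∘ₗ M.ract ∘ₗ (antipode k).lTensor E)
    (fun m a ↦ ?_) m
  rw [LinearMap.comp_apply, h₄, includeRight_mul_comul_antipode]
  rfl

/-- The map `m ↦ m₍₋₁₎ ⊗ S(m₍₀₎₍₋₁₎) m₍₀₎₍₀₎`, a section of the left action. -/
def leftSplit : E →ₗ[k] A ⊗[k] E := M.leftProj.lTensor A ∘ₗ M.lcoact

/-- The map `m ↦ m₍₀₎₍₀₎ S(m₍₀₎₍₁₎) ⊗ m₍₁₎`, a section of the right action. -/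
def rightSplit : E →ₗ[k] E ⊗[k] A := M.rightProj.rTensor A ∘ₗ M.rcoact

lemma lact_leftSplit (m : E) : M.lact (M.leftSplit m) = m := by
  have h : ∀ m (t : A ⊗[k] A), M.lact ((M.lact ∘ₗ (antipode k).rTensor E).lTensor A
      (TensorProduct.assoc k A A E (t ⊗ₜ m))) =
        M.lact (LinearMap.mul' k A ((antipode k).lTensor A t) ⊗ₜ m) := by
    intro m t
    induction t with
    | zero => simp only [map_zero, TensorProduct.zero_tmul]
    | add _ _ h₁ h₂ => simp only [map_add, TensorProduct.add_tmul, h₁, h₂]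
    | tmul u v => simp [M.mul_lact]
  have h' := M.apply_lTensor_lcoact (F := M.lact ∘ₗ (M.lact ∘ₗ (antipode k).rTensor E).lTensor A)
    (G := (TensorProduct.lid k E).toLinearMap ∘ₗ Coalgebra.counit.rTensor E) (fun a m ↦ by
      rw [LinearMap.comp_apply, h, mul_antipode_lTensor_comul_apply, lact_algebraMap]
      simp) m
  refine Eq.trans ?_ (h'.trans (M.lcounit m))
  rw [leftSplit, leftProj, ← LinearMap.comp_assoc, LinearMap.lTensor_comp]
  rfl

lemma ract_rightSplit (m : E) : M.ract (M.rightSplit m) = m := by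
  have h : ∀ m (t : A ⊗[k] A), M.ract ((M.ract ∘ₗ (antipode k).lTensor E).rTensor A
      ((TensorProduct.assoc k E A A).symm (m ⊗ₜ t))) =
        M.ract (m ⊗ₜ LinearMap.mul' k A ((antipode k).rTensor A t)) := by
    intro m t
    induction t with
    | zero => simp only [map_zero, TensorProduct.tmul_zero]
    | add _ _ h₁ h₂ => simp only [map_add, TensorProduct.tmul_add, h₁, h₂]
    | tmul u v => simp [M.ract_mul]
  have h' := M.apply_rTensor_rcoact (F := M.ract ∘ₗ (M.ract ∘ₗ (antipode k).lTensor E).rTensor A)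
    (G := (TensorProduct.rid k E).toLinearMap ∘ₗ Coalgebra.counit.lTensor E) (fun m a ↦ by
      rw [LinearMap.comp_apply, h, mul_antipode_rTensor_comul_apply, ract_algebraMap]
      simp) m
  refine Eq.trans ?_ (h'.trans (M.rcounit m))
  rw [rightSplit, rightProj, ← LinearMap.comp_assoc, LinearMap.rTensor_comp]
  rfl

/-- The fundamental theorem of Hopf modules: `m = m₍₋₂₎ (S(m₍₋₁₎) m₍₀₎)`, and similarly on the
right. -/
lemma isGeneratedByInvariants : M.IsGeneratedByInvariants where
  left m := by
    refine ⟨M.leftSplit m, ?_, M.lact_leftSplit m⟩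
    rw [leftSplit, LinearMap.comp_apply]
    induction M.lcoact m with
    | zero => simp
    | add _ _ h₁ h₂ => rw [map_add]; exact add_mem h₁ h₂
    | tmul a m => exact Submodule.subset_span ⟨a, _, M.isLeftInvariant_leftProj m, rfl⟩
  right m := by
    refine ⟨M.rightSplit m, ?_, M.ract_rightSplit m⟩
    rw [rightSplit, LinearMap.comp_apply]
    induction M.rcoact m with
    | zero => simp
    | add _ _ h₁ h₂ => rw [map_add]; exact add_mem h₁ h₂
    | tmul m a => exact Submodule.subset_span ⟨_, a, M.isRightInvariant_rightProj m, rfl⟩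

end Hopf

end BicovariantBimodule

/-! ### Existence of the braiding -/

namespace BicovariantBimodule

open Bicomodule HopfAlgebra

section Existence

variable {k A E : Type*} [Field k] [Ring A] [HopfAlgebra k A] [AddCommGroup E] [Module k E]
  (M : BicovariantBimodule k A E)

/-- `P(a m) = ε(a) P(m)` for the projection `P` onto the left-invariant elements. -/
lemma leftProj_lact (a : A) (m : E) :
    M.leftProj (M.lact (a ⊗ₜ m)) = Coalgebra.counit (R := k) a • M.leftProj m := by
  have h : ∀ b n (t : A ⊗[k] A), M.lact ((antipode k).rTensor E
      (TensorProduct.map (LinearMap.mul' k A) M.lact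
        (TensorProduct.tensorTensorTensorComm k A A A E (t ⊗ₜ (b ⊗ₜ n))))) =
      M.lact (antipode k b ⊗ₜ M.lact (LinearMap.mul' k A ((antipode k).rTensor A t) ⊗ₜ n)) := by
    intro b n t
    induction t with
    | zero => simp only [map_zero, TensorProduct.zero_tmul, TensorProduct.tmul_zero]
    | add _ _ h₁ h₂ => simp only [map_add, TensorProduct.add_tmul, TensorProduct.tmul_add, h₁, h₂]
    | tmul u v => simp [← M.mul_lact, antipode_mul_antidistrib, mul_assoc]
  rw [leftProj_apply, leftProj_apply, M.lcoact_lact]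
  induction M.lcoact m with
  | zero => simp only [map_zero, TensorProduct.tmul_zero, smul_zero]
  | add _ _ h₁ h₂ => simp only [map_add, TensorProduct.tmul_add, h₁, h₂, smul_add]
  | tmul b n =>
    rw [h, mul_antipode_rTensor_comul_apply, lact_algebraMap, TensorProduct.tmul_smul, map_smul]
    rfl

/-- `Q(m a) = ε(a) Q(m)` for the projection `Q` onto the right-invariant elements. -/
lemma rightProj_ract (m : E) (a : A) :
    M.rightProj (M.ract (m ⊗ₜ a)) = Coalgebra.counit (R := k) a • M.rightProj m := by
  have h : ∀ b n (t : A ⊗[k] A), M.ract ((antipode k).lTensor E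
      (TensorProduct.map M.ract (LinearMap.mul' k A)
        (TensorProduct.tensorTensorTensorComm k E A A A ((n ⊗ₜ b) ⊗ₜ t)))) =
      M.ract (M.ract (n ⊗ₜ LinearMap.mul' k A ((antipode k).lTensor A t)) ⊗ₜ antipode k b) := by
    intro b n t
    induction t with
    | zero => simp only [map_zero, TensorProduct.zero_tmul, TensorProduct.tmul_zero]
    | add _ _ h₁ h₂ => simp only [map_add, TensorProduct.add_tmul, TensorProduct.tmul_add, h₁, h₂]
    | tmul u v => simp [← M.ract_mul, antipode_mul_antidistrib, mul_assoc]
  rw [rightProj_apply, rightProj_apply, M.rcoact_ract]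
  induction M.rcoact m with
  | zero => simp only [map_zero, TensorProduct.zero_tmul, smul_zero]
  | add _ _ h₁ h₂ => simp only [map_add, TensorProduct.add_tmul, h₁, h₂, smul_add]
  | tmul n b =>
    rw [h, mul_antipode_lTensor_comul_apply, ract_algebraMap, ← TensorProduct.smul_tmul', map_smul]
    rfl

/-- The map `a ⊗ b ↦ S(a) (n b)`. -/
def antipodeConjLeft (n : E) : A ⊗[k] A →ₗ[k] E :=
  M.lact ∘ₗ TensorProduct.map (antipode k) (M.ract ∘ₗ TensorProduct.mk k E A n)

/-- The map `a ⊗ b ↦ (a n) S(b)`. -/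
def antipodeConjRight (n : E) : A ⊗[k] A →ₗ[k] E :=
  M.ract ∘ₗ TensorProduct.map (M.lact ∘ₗ (TensorProduct.mk k A E).flip n) (antipode k)

@[simp] lemma antipodeConjLeft_tmul (n : E) (a b : A) :
    M.antipodeConjLeft n (a ⊗ₜ b) = M.lact (antipode k a ⊗ₜ M.ract (n ⊗ₜ b)) := rfl

@[simp] lemma antipodeConjRight_tmul (n : E) (a b : A) :
    M.antipodeConjRight n (a ⊗ₜ b) = M.ract (M.lact (a ⊗ₜ n) ⊗ₜ antipode k b) := rfl

/-- `P(m a) = S(a₍₁₎) P(m) a₍₂₎`. -/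
lemma leftProj_ract (m : E) (a : A) :
    M.leftProj (M.ract (m ⊗ₜ a)) = M.antipodeConjLeft (M.leftProj m) (Coalgebra.comul a) := by
  rw [leftProj_apply, leftProj_apply, M.lcoact_ract]
  induction Coalgebra.comul (R := k) a with
  | zero => simp only [map_zero, TensorProduct.tmul_zero]
  | add _ _ h₁ h₂ => simp only [map_add, TensorProduct.tmul_add, h₁, h₂]
  | tmul u v =>
  rw [antipodeConjLeft_tmul]
  induction M.lcoact m with
  | zero => simp only [map_zero, TensorProduct.zero_tmul, TensorProduct.tmul_zero]
  | add _ _ h₁ h₂ => simp only [map_add, TensorProduct.add_tmul, TensorProduct.tmul_add, h₁, h₂]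
  | tmul b n => simp [M.mul_lact, M.lact_ract, antipode_mul_antidistrib]

/-- `Q(a m) = a₍₁₎ Q(m) S(a₍₂₎)`. -/
lemma rightProj_lact (a : A) (m : E) :
    M.rightProj (M.lact (a ⊗ₜ m)) = M.antipodeConjRight (M.rightProj m) (Coalgebra.comul a) := by
  rw [rightProj_apply, rightProj_apply, M.rcoact_lact]
  induction Coalgebra.comul (R := k) a with
  | zero => simp only [map_zero, TensorProduct.zero_tmul]
  | add _ _ h₁ h₂ => simp only [map_add, TensorProduct.add_tmul, h₁, h₂]
  | tmul u v =>
  rw [antipodeConjRight_tmul]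
  induction M.rcoact m with
  | zero => simp only [map_zero, TensorProduct.zero_tmul, TensorProduct.tmul_zero]
  | add _ _ h₁ h₂ => simp only [map_add, TensorProduct.add_tmul, TensorProduct.tmul_add, h₁, h₂]
  | tmul n b => simp [M.ract_mul, M.lact_ract, antipode_mul_antidistrib]

lemma leftSplit_lact (a : A) (m : E) :
    M.leftSplit (M.lact (a ⊗ₜ m)) = (LinearMap.mulLeft k a).rTensor E (M.leftSplit m) := by
  have h : ∀ b n (t : A ⊗[k] A), M.leftProj.lTensor A
      (TensorProduct.map (LinearMap.mul' k A) M.lact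
        (TensorProduct.tensorTensorTensorComm k A A A E (t ⊗ₜ (b ⊗ₜ n)))) =
      (TensorProduct.rid k A (Coalgebra.counit.lTensor A t) * b) ⊗ₜ M.leftProj n := by
    intro b n t
    induction t with
    | zero => simp only [map_zero, TensorProduct.zero_tmul, zero_mul]
    | add _ _ h₁ h₂ => simp only [map_add, TensorProduct.add_tmul, add_mul, h₁, h₂]
    | tmul u v => simp [leftProj_lact, TensorProduct.smul_tmul']
  rw [leftSplit, LinearMap.comp_apply, LinearMap.comp_apply, M.lcoact_lact]
  induction M.lcoact m with
  | zero => simp only [map_zero, TensorProduct.tmul_zero]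
  | add _ _ h₁ h₂ => simp only [map_add, TensorProduct.tmul_add, h₁, h₂]
  | tmul b n =>
    rw [h, Coalgebra.lTensor_counit_comul]
    simp

lemma rightSplit_ract (m : E) (a : A) :
    M.rightSplit (M.ract (m ⊗ₜ a)) = (LinearMap.mulRight k a).lTensor E (M.rightSplit m) := by
  have h : ∀ b n (t : A ⊗[k] A), M.rightProj.rTensor A
      (TensorProduct.map M.ract (LinearMap.mul' k A)
        (TensorProduct.tensorTensorTensorComm k E A A A ((n ⊗ₜ b) ⊗ₜ t))) =
      M.rightProj n ⊗ₜ (b * TensorProduct.lid k A (Coalgebra.counit.rTensor A t)) := by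
    intro b n t
    induction t with
    | zero => simp only [map_zero, TensorProduct.tmul_zero, mul_zero]
    | add _ _ h₁ h₂ => simp only [map_add, TensorProduct.tmul_add, mul_add, h₁, h₂]
    | tmul u v => simp [rightProj_ract, TensorProduct.smul_tmul']
  rw [rightSplit, LinearMap.comp_apply, LinearMap.comp_apply, M.rcoact_ract]
  induction M.rcoact m with
  | zero => simp only [map_zero, TensorProduct.zero_tmul]
  | add _ _ h₁ h₂ => simp only [map_add, TensorProduct.add_tmul, h₁, h₂]
  | tmul n b =>
    rw [h, Coalgebra.rTensor_counit_comul]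
    simp

variable {M} in
lemma IsLeftInvariant.leftSplit_eq {ω : E} (h : M.IsLeftInvariant ω) :
    M.leftSplit ω = 1 ⊗ₜ ω := by
  have h' : M.lcoact ω = 1 ⊗ₜ ω := h
  rw [leftSplit, LinearMap.comp_apply, h', LinearMap.lTensor_tmul, h.leftProj_eq]

variable {M} in
lemma IsRightInvariant.rightSplit_eq {η : E} (h : M.IsRightInvariant η) :
    M.rightSplit η = η ⊗ₜ 1 := by
  have h' : M.rcoact η = η ⊗ₜ 1 := h
  rw [rightSplit, LinearMap.comp_apply, h', LinearMap.rTensor_tmul, h.rightProj_eq]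

/-- The map `(a ⊗ ω) ⊗ (η ⊗ b) ↦ a η ⊗_A ω b`. -/
def crossSq : (A ⊗[k] E) ⊗[k] (E ⊗[k] A) →ₗ[k] M.TensorSq :=
  M.balanced.mkQ ∘ₗ TensorProduct.map M.lact M.ract ∘ₗ
    (TensorProduct.tensorTensorTensorComm k A E E A).toLinearMap

@[simp] lemma crossSq_tmul (a : A) (ω η : E) (b : A) :
    M.crossSq ((a ⊗ₜ ω) ⊗ₜ (η ⊗ₜ b)) = M.tmul (M.lact (a ⊗ₜ η)) (M.ract (ω ⊗ₜ b)) := rfl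

/-- For `b ⊗ ω` in place of `leftSplit m` and `η ⊗ c` in place of `rightSplit n`, both sides equal
`b a₍₁₎ η ⊗_A S(a₍₂₎) ω a₍₃₎ c`. -/
lemma crossSq_balanced (m n : E) (a : A) :
    M.crossSq (M.leftSplit (M.ract (m ⊗ₜ a)) ⊗ₜ M.rightSplit n) =
      M.crossSq (M.leftSplit m ⊗ₜ M.rightSplit (M.lact (a ⊗ₜ n))) := by
  simp only [leftSplit, rightSplit, LinearMap.comp_apply, M.lcoact_ract, M.rcoact_lact]
  induction M.lcoact m with
  | zero => simp only [map_zero, TensorProduct.zero_tmul]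
  | add _ _ h₁ h₂ => simp only [map_add, TensorProduct.add_tmul, h₁, h₂]
  | tmul b m =>
  induction M.rcoact n with
  | zero => simp only [map_zero, TensorProduct.tmul_zero]
  | add _ _ h₁ h₂ => simp only [map_add, TensorProduct.tmul_add, h₁, h₂]
  | tmul n c =>
  -- `Φ(x ⊗ y ⊗ z) = b x η ⊗_A S(y) ω z c`; the two sides are `Φ` of the two iterated coproducts.
  let Φ : A ⊗[k] (A ⊗[k] A) →ₗ[k] M.TensorSq := M.balanced.mkQ ∘ₗ TensorProduct.map
    (M.lact ∘ₗ (TensorProduct.mk k A E).flip (M.rightProj n) ∘ₗ LinearMap.mulLeft k b)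
    (M.ract ∘ₗ (TensorProduct.mk k E A).flip c ∘ₗ M.antipodeConjLeft (M.leftProj m))
  have hΦ : ∀ x y z, Φ (x ⊗ₜ (y ⊗ₜ z)) = M.tmul (M.lact ((b * x) ⊗ₜ M.rightProj n))
      (M.ract (M.lact (antipode k y ⊗ₜ M.ract (M.leftProj m ⊗ₜ z)) ⊗ₜ c)) := fun _ _ _ ↦ rfl
  have h₁ : ∀ t, M.crossSq (M.leftProj.lTensor A (TensorProduct.map (LinearMap.mul' k A) M.ract
      (TensorProduct.tensorTensorTensorComm k A E A A ((b ⊗ₜ m) ⊗ₜ t))) ⊗ₜ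
        M.rightProj.rTensor A (n ⊗ₜ c)) = Φ (Coalgebra.comul.lTensor A t) := by
    intro t
    induction t with
    | zero => simp only [map_zero, TensorProduct.zero_tmul, TensorProduct.tmul_zero]
    | add _ _ h₁ h₂ => simp only [map_add, TensorProduct.add_tmul, TensorProduct.tmul_add, h₁, h₂]
    | tmul x y =>
      simp only [TensorProduct.tensorTensorTensorComm_tmul, TensorProduct.map_tmul,
        LinearMap.lTensor_tmul, LinearMap.rTensor_tmul, LinearMap.mul'_apply, leftProj_ract,
        crossSq_tmul]
      rfl
  have h₂ : ∀ t, M.crossSq (M.leftProj.lTensor A (b ⊗ₜ m) ⊗ₜ M.rightProj.rTensor A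
      (TensorProduct.map M.lact (LinearMap.mul' k A)
        (TensorProduct.tensorTensorTensorComm k A A E A (t ⊗ₜ (n ⊗ₜ c))))) =
          Φ (TensorProduct.assoc k A A A (Coalgebra.comul.rTensor A t)) := by
    intro t
    induction t with
    | zero => simp only [map_zero, TensorProduct.zero_tmul, TensorProduct.tmul_zero]
    | add _ _ h₁ h₂ => simp only [map_add, TensorProduct.add_tmul, TensorProduct.tmul_add, h₁, h₂]
    | tmul x y =>
      simp only [TensorProduct.tensorTensorTensorComm_tmul, TensorProduct.map_tmul,
        LinearMap.lTensor_tmul, LinearMap.rTensor_tmul, LinearMap.mul'_apply, rightProj_lact,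
        crossSq_tmul]
      induction Coalgebra.comul (R := k) x with
      | zero =>
        simp only [map_zero, TensorProduct.zero_tmul, TensorProduct.tmul_zero]
        exact congrArg M.balanced.mkQ (TensorProduct.zero_tmul _ _) |>.trans (map_zero _)
      | add _ _ h₁ h₂ =>
        simp only [map_add, TensorProduct.add_tmul, TensorProduct.tmul_add, ← h₁, ← h₂]
        exact congrArg M.balanced.mkQ (TensorProduct.add_tmul _ _ _) |>.trans (map_add _ _ _)
      | tmul x x' =>
        rw [TensorProduct.assoc_tmul, hΦ, antipodeConjRight_tmul, ← M.lact_ract, tmul_ract_left,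
          M.mul_lact, M.lact_ract, ← M.ract_mul]
  rw [h₁, h₂, Coalgebra.coassoc_apply]

/-- The Woronowicz braiding
`m ⊗_A n ↦ m₍₋₂₎ (n₍₀₎ S(n₍₁₎)) ⊗_A (S(m₍₋₁₎) m₍₀₎) n₍₂₎`. -/
def braiding : M.TensorSq →ₗ[k] M.TensorSq :=
  M.balanced.liftQ (M.crossSq ∘ₗ TensorProduct.map M.leftSplit M.rightSplit) <| by
    refine Submodule.span_le.mpr ?_
    rintro _ ⟨m, n, a, rfl⟩
    rw [SetLike.mem_coe, LinearMap.mem_ker, map_sub, sub_eq_zero]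
    exact M.crossSq_balanced m n a

lemma isBraiding_braiding : M.IsBraiding M.braiding where
  map_lactSq a t := by
    obtain ⟨t, rfl⟩ := M.balanced.mkQ_surjective t
    induction t with
    | zero => simp only [map_zero]
    | add _ _ h₁ h₂ => simp only [map_add, h₁, h₂]
    | tmul m n =>
      change M.crossSq (M.leftSplit (M.lact (a ⊗ₜ m)) ⊗ₜ M.rightSplit n) =
        M.lactSq a (M.crossSq (M.leftSplit m ⊗ₜ M.rightSplit n))
      rw [leftSplit_lact]
      induction M.leftSplit m with
      | zero => simp only [map_zero, TensorProduct.zero_tmul]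
      | add _ _ h₁ h₂ => simp only [map_add, TensorProduct.add_tmul, h₁, h₂]
      | tmul b ω =>
      induction M.rightSplit n with
      | zero => simp only [map_zero, TensorProduct.tmul_zero]
      | add _ _ h₁ h₂ => simp only [map_add, TensorProduct.tmul_add, h₁, h₂]
      | tmul η c => simp [M.mul_lact]
  map_ractSq a t := by
    obtain ⟨t, rfl⟩ := M.balanced.mkQ_surjective t
    induction t with
    | zero => simp only [map_zero]
    | add _ _ h₁ h₂ => simp only [map_add, h₁, h₂]
    | tmul m n =>
      change M.crossSq (M.leftSplit m ⊗ₜ M.rightSplit (M.ract (n ⊗ₜ a))) =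
        M.ractSq a (M.crossSq (M.leftSplit m ⊗ₜ M.rightSplit n))
      rw [rightSplit_ract]
      induction M.leftSplit m with
      | zero => simp only [map_zero, TensorProduct.zero_tmul]
      | add _ _ h₁ h₂ => simp only [map_add, TensorProduct.add_tmul, h₁, h₂]
      | tmul b ω =>
      induction M.rightSplit n with
      | zero => simp only [map_zero, TensorProduct.tmul_zero]
      | add _ _ h₁ h₂ => simp only [map_add, TensorProduct.tmul_add, h₁, h₂]
      | tmul η c => simp [M.ract_mul]
  map_tmul ω η hω hη := by
    change M.crossSq (M.leftSplit ω ⊗ₜ M.rightSplit η) = _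
    rw [hω.leftSplit_eq, hη.rightSplit_eq, crossSq_tmul, M.one_lact, M.ract_one]

lemma existsUnique_isBraiding : ∃! σ, M.IsBraiding σ :=
  ⟨M.braiding, M.isBraiding_braiding, fun _ hτ ↦
    M.isGeneratedByInvariants.braiding_unique hτ M.isBraiding_braiding⟩

lemma existsUnique_isBraiding_deform (γ : Cocycle k A) : ∃! σ, (M.deform γ).IsBraiding σ :=
  ⟨_, M.isBraiding_braiding.deform γ M.isGeneratedByInvariants, fun _ hτ ↦
    (M.isGeneratedByInvariants.deform γ).braiding_unique hτ
      (M.isBraiding_braiding.deform γ M.isGeneratedByInvariants)⟩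

variable {M} in
lemma IsBraiding.deform_comp_self (γ : Cocycle k A) {σ : M.TensorSq →ₗ[k] M.TensorSq}
    {σγ : (M.deform γ).TensorSq →ₗ[k] (M.deform γ).TensorSq} (hσ : M.IsBraiding σ)
    (hσγ : (M.deform γ).IsBraiding σγ) (h : σ ∘ₗ σ = .id) : σγ ∘ₗ σγ = .id := by
  rw [(M.isGeneratedByInvariants.deform γ).braiding_unique hσγ
    (hσ.deform γ M.isGeneratedByInvariants), ← LinearEquiv.conj_comp, h, LinearEquiv.conj_id]

end Existence

end BicovariantBimodule

/-! ### One-forms of a commutative bialgebra -/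

section OneForms

open BicovariantBimodule

variable (k A : Type*) [Field k] [CommRing A] [Bialgebra k A]

/-- The flip `m ⊗_A n ↦ n ⊗_A m` of one-forms: it is well defined because the left and the right
action of the commutative algebra `A` agree. -/
def oneFormsFlip : (oneForms k A).TensorSq →ₗ[k] (oneForms k A).TensorSq :=
  (oneForms k A).balanced.mapQ (oneForms k A).balanced (TensorProduct.comm k _ _).toLinearMap <| by
    refine Submodule.span_le.mpr ?_
    rintro _ ⟨m, n, a, rfl⟩
    have h := (oneForms k A).balanced.neg_mem (Submodule.subset_span ⟨n, m, a, rfl⟩)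
    rw [neg_sub] at h
    rw [SetLike.mem_coe, Submodule.mem_comap, map_sub]
    exact h

lemma isBraiding_oneFormsFlip : (oneForms k A).IsBraiding (oneFormsFlip k A) where
  map_lactSq a t := by
    obtain ⟨t, rfl⟩ := (oneForms k A).balanced.mkQ_surjective t
    induction t with
    | zero => simp only [map_zero]
    | add _ _ h₁ h₂ => simp only [map_add, h₁, h₂]
    | tmul m n => exact ((oneForms k A).tmul_ract_left n a m).symm
  map_ractSq a t := by
    obtain ⟨t, rfl⟩ := (oneForms k A).balanced.mkQ_surjective t
    induction t with
    | zero => simp only [map_zero]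
    | add _ _ h₁ h₂ => simp only [map_add, h₁, h₂]
    | tmul m n => exact (oneForms k A).tmul_ract_left n a m
  map_tmul ω η _ _ := rfl

lemma oneFormsFlip_comp_self : oneFormsFlip k A ∘ₗ oneFormsFlip k A = .id := by
  apply Submodule.linearMap_qext
  exact TensorProduct.ext' fun m n ↦ rfl

end OneForms

end

open scoped Manifold ContDiff in
theorem mainTheorem6 :
    (∀ (A : Type*) [Ring A] [HopfAlgebra ℂ A] (E : Type*) [AddCommGroup E] [Module ℂ E]
      (M : BicovariantBimodule ℂ A E) (γ : Cocycle ℂ A),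
      (∃! σ, M.IsBraiding σ) ∧ (∃! σγ, (M.deform γ).IsBraiding σγ) ∧
      ∀ σ σγ, M.IsBraiding σ → (M.deform γ).IsBraiding σγ →
        σ ∘ₗ σ = LinearMap.id → σγ ∘ₗ σγ = LinearMap.id) ∧
    (∀ (n : ℕ) (G : Type*) [Group G] [TopologicalSpace G]
      [ChartedSpace (EuclideanSpace ℝ (Fin n)) G] [LieGroup (𝓡 n) ∞ G] [CompactSpace G] [T2Space G]
      [LieAlgebra.IsSemisimple ℝ (GroupLieAlgebra (𝓡 n) G)]
      (γ : Cocycle ℂ (RegularFunction G)),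
      (∃! σγ, ((oneForms ℂ (RegularFunction G)).deform γ).IsBraiding σγ) ∧
      ∀ σγ, ((oneForms ℂ (RegularFunction G)).deform γ).IsBraiding σγ →
        σγ ∘ₗ σγ = LinearMap.id) := by
  refine ⟨fun A _ _ E _ _ M γ ↦ ⟨M.existsUnique_isBraiding, M.existsUnique_isBraiding_deform γ,
    fun σ σγ hσ hσγ h ↦ hσ.deform_comp_self γ hσγ h⟩, fun n G _ _ _ _ _ _ _ γ ↦ ?_⟩
  have : IsTopologicalGroup G := topologicalGroup_of_lieGroup (𝓡 n) ∞
  exact ⟨(oneForms ℂ (RegularFunction G)).existsUnique_isBraiding_deform γ, fun σγ hσγ ↦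
    (isBraiding_oneFormsFlip ℂ (RegularFunction G)).deform_comp_self γ hσγ
      (oneFormsFlip_comp_self ℂ (RegularFunction G))⟩
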